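/- Conventions. A closed polyhedron in $\mathbb R^n$ is an intersection of finitely many closed half-spaces (it may be unbounded); it is rational if the half-spaces can be chosen with normal vectors in $\mathbb Z^n$. A \emph{polyhedral complex} of dimension $d$ in $\mathbb R^n$ is a finite (possibly empty) union $T$ of non-empty rational closed polyhedra of dimension $d$. A point $p\in T$ is smooth if $T-p$ coincides with a vector subspace $T_pT$ in a neighborhood of $0$. The complex $T$ is \emph{tropical} if there is a positive locally constant function $w$ on its smooth points such that, for every rational vector subspace $L\subset\mathbb R^n$ of dimension $n-d$, the number $$\sum_{p\in T\cap(L-x)} w(p)\left|\frac{\mathbb Z^n}{(\mathbb Z^n\cap L)+(\mathbb Z^n\cap T_pT)}\right|,$$ which makes sense for almost all $x\in\mathbb R^n$, does not depend on $x$ (outside a set of measure zero). The \emph{stable intersection} $A\wedge B$ of sets $A,B\subset\mathbb R^n$ is the set of all $x\in A\cap B$ such that for every $\varepsilon>0$ there is $\delta>0$ such that for every $v\in\mathbb R^n$ with $|v|<\delta$ the set $(A+v)\cap B$ contains a point at distance less than $\varepsilon$ from $x$. A set is (purely) $j$-dimensional if it is non-empty and its dimension in every neighborhood of each of its points is $j$;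 for $j<0$ there are no such sets. Proposition. Let $P$ be a non-empty polyhedron in $\mathbb R^n$, open in its affine span (that is, the relative interior of a closed polyhedron, not necessarily rational), and let $\partial P$ be its relative boundary. Let $T$ be a tropical complex in $\mathbb R^n$ of dimension $\dim T$, and let $k\in\mathbb Z$ be such that $\dim P+\dim T=n+k$. Then: 1) The stable intersection $S=T\wedge P$ is purely $k$-dimensional or empty. 2) The intersection $\overline S\cap\partial P$ of the closure of $S$ with the relative boundary of $P$ is purely $(k-1)$-dimensional or empty. 3) The set $\overline S\cap\partial P$ is empty if and only if every connected component of $S$ is contained in an affine subspace that is contained in $P$. -/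

import Mathlib

open Set Topology MeasureTheory

namespace TropPurity

/-- The space `ℝⁿ` with its Euclidean norm. -/
abbrev Vec (n : ℕ) : Type := EuclideanSpace ℝ (Fin n)

/-- The lattice `ℤⁿ ⊆ ℝⁿ`. -/
def lattice (n : ℕ) : AddSubgroup (Vec n) where
  carrier := {x | ∀ i, ∃ z : ℤ, x i = z}
  zero_mem' := fun _ => ⟨0, by simp⟩
  add_mem' := by
    intro x y hx hy i
    obtain ⟨a, ha⟩ := hx i
    obtain ⟨b, hb⟩ := hy i
    exact ⟨a + b, by simp [ha, hb]⟩
  neg_mem' := by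
    intro x hx i
    obtain ⟨a, ha⟩ := hx i
    exact ⟨-a, by simp [ha]⟩

/-- A vector subspace is rational if it is spanned by integer vectors. -/
def IsRationalSubspace {n : ℕ} (L : Submodule ℝ (Vec n)) : Prop :=
  Submodule.span ℝ {x : Vec n | x ∈ lattice n ∧ x ∈ L} = L

/-- A closed convex polyhedron: a finite intersection of closed half-spaces
(possibly unbounded, possibly of smaller dimension). -/
def IsPolyhedron {n : ℕ} (Q : Set (Vec n)) : Prop :=
  ∃ H : Finset (Vec n × ℝ), Q = {x | ∀ h ∈ H, inner ℝ h.1 x ≤ h.2}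

/-- A rational closed convex polyhedron: the half-spaces have integer normal covectors. -/
def IsRationalPolyhedron {n : ℕ} (Q : Set (Vec n)) : Prop :=
  ∃ H : Finset (Vec n × ℝ),
    (∀ h ∈ H, h.1 ∈ lattice n) ∧ Q = {x | ∀ h ∈ H, inner ℝ h.1 x ≤ h.2}

/-- The dimension of a convex set: the dimension of its affine span. -/
noncomputable def convexDim {n : ℕ} (Q : Set (Vec n)) : ℕ :=
  Module.finrank ℝ (vectorSpan ℝ Q)

/-- A non-empty polyhedron that is open in its affine span: the relative interior of a non-empty
closed polyhedron. -/
def IsRelOpenPolyhedron {n : ℕ} (P : Set (Vec n)) : Prop :=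
  P.Nonempty ∧ ∃ Q : Set (Vec n), IsPolyhedron Q ∧ P = intrinsicInterior ℝ Q

/-- A polyhedral complex of dimension `d`: a finite union of `d`-dimensional closed convex rational
polyhedra. -/
def IsPolyhedralComplex {n : ℕ} (d : ℕ) (T : Set (Vec n)) : Prop :=
  ∃ F : Set (Set (Vec n)), F.Finite ∧
    (∀ C ∈ F, IsRationalPolyhedron C ∧ C.Nonempty ∧ convexDim C = d) ∧ T = ⋃₀ F

/-- A point `p ∈ T` is smooth if `T - p` coincides with a vector subspace near `0`. -/
def IsSmoothPoint {n : ℕ} (T : Set (Vec n)) (p : Vec n) : Prop :=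
  p ∈ T ∧ ∃ V : Submodule ℝ (Vec n), ∀ᶠ v in 𝓝 (0 : Vec n), p + v ∈ T ↔ v ∈ V

/-- The tangent space of `T` at `p`. At a smooth point it is the vector subspace with which
`T - p` coincides near `0` (see `tangentSpace_eq`). -/
def tangentSpace {n : ℕ} (T : Set (Vec n)) (p : Vec n) : Submodule ℝ (Vec n) :=
  Submodule.span ℝ {v | ∀ᶠ t in 𝓝 (0 : ℝ), p + t • v ∈ T}

theorem tangentSpace_eq {n : ℕ} {T : Set (Vec n)} {p : Vec n} {V : Submodule ℝ (Vec n)}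
    (h : ∀ᶠ v in 𝓝 (0 : Vec n), p + v ∈ T ↔ v ∈ V) : tangentSpace T p = V := by
  have key : {v | ∀ᶠ t in 𝓝 (0 : ℝ), p + t • v ∈ T} = (V : Set (Vec n)) := by
    ext v
    have hc : Filter.Tendsto (fun t : ℝ => t • v) (𝓝 0) (𝓝 (0 : Vec n)) := by
      have : Continuous (fun t : ℝ => t • v) := by fun_prop
      simpa using this.tendsto 0
    have h' := hc.eventually h
    constructor
    · intro hv
      have h2 : ∀ᶠ t in 𝓝[≠] (0 : ℝ), t • v ∈ V :=
        ((h'.and hv).mono fun t ht => ht.1.1 ht.2).filter_mono nhdsWithin_le_nhds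
      obtain ⟨t, ht, ht0⟩ := (h2.and self_mem_nhdsWithin).exists
      exact (V.smul_mem_iff ht0).1 ht
    · intro hv
      exact h'.mono fun t ht => ht.2 (V.smul_mem t hv)
  rw [tangentSpace, key, Submodule.span_eq]

/-- The lattice index `|ℤⁿ / ((ℤⁿ ∩ L) + (ℤⁿ ∩ V))|` of two subspaces. -/
noncomputable def latticeIndex {n : ℕ} (L V : Submodule ℝ (Vec n)) : ℕ :=
  ((lattice n ⊓ L.toAddSubgroup) ⊔ (lattice n ⊓ V.toAddSubgroup)).relIndex (lattice n)

/-- The tropical intersection number of the translate `L - x` with `T`, for the weight `w`. For a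
polyhedral complex `T` and a rational subspace `L` of complementary dimension, for almost all `x`
the sum is finite, its points `p` are smooth, and the intersections are transversal. -/
noncomputable def intersectionNumber {n : ℕ} (T : Set (Vec n)) (w : Vec n → ℝ)
    (L : Submodule ℝ (Vec n)) (x : Vec n) : ℝ :=
  ∑ᶠ p ∈ {p : Vec n | p ∈ T ∧ p + x ∈ L}, w p * (latticeIndex L (tangentSpace T p) : ℝ)

/-- A tropical complex of dimension `d`: a `d`-dimensional polyhedral complex that admits a positive
locally constant weight on its smooth points, such that all tropical intersection numbers with
rational subspaces of complementary dimension are independent of (almost every) translation. -/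
def IsTropicalComplex {n : ℕ} (d : ℕ) (T : Set (Vec n)) : Prop :=
  IsPolyhedralComplex d T ∧
    ∃ w : Vec n → ℝ,
      (∀ p, IsSmoothPoint T p → 0 < w p) ∧
      (∀ p, IsSmoothPoint T p → ∀ᶠ q in 𝓝[{q | IsSmoothPoint T q}] p, w q = w p) ∧
      ∀ L : Submodule ℝ (Vec n), IsRationalSubspace L → Module.finrank ℝ L + d = n →
        ∃ c : ℝ, ∀ᵐ x : Vec n, intersectionNumber T w L x = c

/-- The stable intersection of two sets: the points `x ∈ A ∩ B` such that `(A + v) ∩ B` has points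
arbitrarily close to `x` as soon as `v` is sufficiently small. (The distance to the empty set is
infinite.) -/
def stableIntersection {n : ℕ} (A B : Set (Vec n)) : Set (Vec n) :=
  {x | x ∈ A ∩ B ∧ ∀ ε : ℝ, 0 < ε → ∃ δ : ℝ, 0 < δ ∧ ∀ v : Vec n, ‖v‖ < δ →
    ∃ y ∈ ((fun a => a + v) '' A) ∩ B, dist x y < ε}

/-- The set `S` is empty or `k`-dimensional, of pure dimension: its dimension is `k` in every
neighbourhood of each of its points. For `k < 0` only the empty set is allowed. -/
def IsEmptyOrPureDim {n : ℕ} (k : ℤ) (S : Set (Vec n)) : Prop :=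
  ∀ x ∈ S, ∀ U ∈ 𝓝 x, ∃ j : ℕ, (j : ℤ) = k ∧ dimH (S ∩ U) = j

end TropPurity

/-! Write `T` as a finite union of cells and let `V` be the direction of `P`. The tropical
hypothesis is used only through a maximum principle (`MaxPrinciple`): at a point on a flat of
codimension one in `T`, a functional that vanishes on the flat and is nonpositive on all tangent
cones of cells vanishes on them.

This principle comes from balancing (`exists_balancing`). Translates of a rational `L` on either
side of a codimension-one flat `E` have equal intersection numbers. They differ only in the
half-flats at `E` that they meet, and each lattice index is proportional to the height of a
primitive vector over the hyperplane `E + L`. So the weighted heights of the half-flats cancel for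
generic `L`, which gives a relation `∑ κ u • u = 0` with positive coefficients between the rays at
`E`.

The maximum principle yields the main tool, `exists_tcone_sub_mem`: if one cell at `x` is
complementary to `L`, then the tangent cones at `x` of the cells complementary to `L` cover the
quotient by `L`. Otherwise a generic path from an uncovered point to the covered region would enter
that region across a cone of codimension one, and the maximum principle supplies a cell on the
uncovered side.

The three statements follow from suitable choices of `L`. With `L ≤ V`, the stable intersection
consists of the points of `P` on cells with `dir D ⊔ V = ⊤`, and the covering of `V` modulo `L`
gives dimension `k`. With `L` also inside a supporting hyperplane of `P`, a path that leaves the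
cone of `P` must cross its boundary over a face of dimension at least `k - 1`. With `L` in the
kernel of a functional `a`, a maximum of `a` on a component propagates, so `a` is constant there;
this is applied to the inequalities that define `P`. -/

namespace TropPurity

open Module Filter

variable {n : ℕ}

/-! ### Local geometry of polyhedra and hyperplane arrangements. -/

/-- The closed polyhedron cut out by a finite family of half-spaces. -/
def poly (H : Finset (Vec n × ℝ)) : Set (Vec n) := {x | ∀ h ∈ H, inner ℝ h.1 x ≤ h.2}

/-- The tangent cone at `p` of the polyhedron cut out by `H`. -/
def tcone (H : Finset (Vec n × ℝ)) (p : Vec n) : Set (Vec n) :=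
  {v | ∀ h ∈ H, inner ℝ h.1 p = h.2 → inner ℝ h.1 v ≤ 0}

/-- The direction of the smallest flat through `p` of the arrangement of hyperplanes that bound the
half-spaces in `A`. -/
def flat (A : Finset (Vec n × ℝ)) (p : Vec n) : Submodule ℝ (Vec n) where
  carrier := {v | ∀ h ∈ A, inner ℝ h.1 p = h.2 → inner ℝ h.1 v = 0}
  zero_mem' := fun h _ _ => inner_zero_right _
  add_mem' := by
    intro a b ha hb h hh hp
    rw [inner_add_right, ha h hh hp, hb h hh hp, add_zero]
  smul_mem' := by
    intro c a ha h hh hp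
    rw [inner_smul_right, ha h hh hp, mul_zero]

/-- The direction of the affine span of a polyhedron. -/
noncomputable abbrev dir (H : Finset (Vec n × ℝ)) : Submodule ℝ (Vec n) := vectorSpan ℝ (poly H)

theorem mem_flat {A : Finset (Vec n × ℝ)} {p v : Vec n} :
    v ∈ flat A p ↔ ∀ h ∈ A, inner ℝ h.1 p = h.2 → inner ℝ h.1 v = 0 := Iff.rfl

theorem flat_subset_tcone {A H : Finset (Vec n × ℝ)} (hHA : H ⊆ A) {p v : Vec n}
    (hv : v ∈ flat A p) : v ∈ tcone H p := fun h hh hp => (hv h (hHA hh) hp).le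

theorem smul_mem_tcone {H : Finset (Vec n × ℝ)} {p v : Vec n} {s : ℝ} (hs : 0 ≤ s)
    (hv : v ∈ tcone H p) : s • v ∈ tcone H p := by
  intro h hh hp
  rw [inner_smul_right]
  exact mul_nonpos_of_nonneg_of_nonpos hs (hv h hh hp)

theorem add_mem_tcone {H : Finset (Vec n × ℝ)} {p v w : Vec n}
    (hv : v ∈ tcone H p) (hw : w ∈ tcone H p) : v + w ∈ tcone H p := by
  intro h hh hp
  rw [inner_add_right]
  exact add_nonpos (hv h hh hp) (hw h hh hp)

theorem zero_mem_tcone {H : Finset (Vec n × ℝ)} {p : Vec n} : (0 : Vec n) ∈ tcone H p :=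
  fun h _ _ => (inner_zero_right h.1).le

theorem convex_tcone (H : Finset (Vec n × ℝ)) (p : Vec n) : Convex ℝ (tcone H p) :=
  fun _ hx _ hy _ _ ha hb _ => add_mem_tcone (smul_mem_tcone ha hx) (smul_mem_tcone hb hy)

theorem convex_poly (H : Finset (Vec n × ℝ)) : Convex ℝ (poly H) := by
  intro x hx y hy a b ha hb hab h hh
  rw [inner_add_right, inner_smul_right, inner_smul_right]
  have h1 := mul_le_mul_of_nonneg_left (hx h hh) ha
  have h2 := mul_le_mul_of_nonneg_left (hy h hh) hb
  calc _ ≤ a * h.2 + b * h.2 := add_le_add h1 h2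
    _ = h.2 := by rw [← add_mul, hab, one_mul]

theorem isClosed_poly (H : Finset (Vec n × ℝ)) : IsClosed (poly H) := by
  simp only [poly, ofPred_forall]
  exact isClosed_iInter fun h => isClosed_iInter fun _ =>
    isClosed_le (by fun_prop) continuous_const

theorem isClosed_tcone (H : Finset (Vec n × ℝ)) (p : Vec n) : IsClosed (tcone H p) := by
  simp only [tcone, ofPred_forall]
  exact isClosed_iInter fun h => isClosed_iInter fun _ => isClosed_iInter fun _ =>
    isClosed_le (by fun_prop) continuous_const

/-- The position of nearby points with respect to the hyperplanes not through `p` is constant. -/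
theorem eventually_side (A : Finset (Vec n × ℝ)) (p : Vec n) :
    ∀ᶠ v in 𝓝 (0 : Vec n), ∀ h ∈ A,
      (inner ℝ h.1 p < h.2 → inner ℝ h.1 (p + v) < h.2) ∧
      (h.2 < inner ℝ h.1 p → h.2 < inner ℝ h.1 (p + v)) := by
  rw [eventually_all_finset]
  intro h _
  have hc : Tendsto (fun v : Vec n => (inner ℝ h.1 (p + v) : ℝ)) (𝓝 0) (𝓝 (inner ℝ h.1 p)) := by
    have : Continuous (fun v : Vec n => (inner ℝ h.1 (p + v) : ℝ)) := by fun_prop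
    simpa using this.tendsto 0
  refine Filter.Eventually.and ?_ ?_
  · by_cases hlt : inner ℝ h.1 p < h.2
    · filter_upwards [hc.eventually (gt_mem_nhds hlt)] with v hv _ using hv
    · exact Eventually.of_forall fun _ h' => absurd h' hlt
  · by_cases hlt : h.2 < inner ℝ h.1 p
    · filter_upwards [hc.eventually (lt_mem_nhds hlt)] with v hv _ using hv
    · exact Eventually.of_forall fun _ h' => absurd h' hlt

/-- Constraints that are strict or strictly violated at `p` stay so nearby, so only the active ones
matter. If `p` is outside, both sides fail for small `v`, which is why `p ∈ poly H` is not assumed.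
-/
theorem eventually_mem_poly (H : Finset (Vec n × ℝ)) (p : Vec n) :
    ∀ᶠ v in 𝓝 (0 : Vec n), p + v ∈ poly H ↔ p ∈ poly H ∧ v ∈ tcone H p := by
  filter_upwards [eventually_side H p] with v hv
  constructor
  · intro hm
    refine ⟨fun h hh => ?_, fun h hh hp => ?_⟩
    · by_contra! hlt
      exact absurd (hm h hh) (not_le.2 ((hv h hh).2 hlt))
    · have := hm h hh
      rw [inner_add_right, hp] at this
      linarith
  · rintro ⟨hp, ht⟩ h hh
    rcases (hp h hh).lt_or_eq with hlt | heq
    · exact ((hv h hh).1 hlt).le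
    · rw [inner_add_right, heq]
      linarith [ht h hh heq]

/-- A hyperplane that misses `p` misses a neighbourhood of `p`, so a small move can only lose active
hyperplanes. -/
theorem eventually_mem_flat_iff (A : Finset (Vec n × ℝ)) (p : Vec n) :
    ∀ᶠ v in 𝓝 (0 : Vec n), ∀ h ∈ A,
      (inner ℝ h.1 (p + v) = h.2 ↔ inner ℝ h.1 p = h.2 ∧ inner ℝ h.1 v = 0) := by
  filter_upwards [eventually_side A p] with v hv h hh
  constructor
  · intro heq
    have hp : inner ℝ h.1 p = h.2 := by
      rcases lt_trichotomy (inner ℝ h.1 p) h.2 with hlt | h0 | hgt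
      · exact absurd heq ((hv h hh).1 hlt).ne
      · exact h0
      · exact absurd heq ((hv h hh).2 hgt).ne'
    refine ⟨hp, ?_⟩
    rw [inner_add_right, hp] at heq
    linarith
  · rintro ⟨h1, h2⟩
    rw [inner_add_right, h1, h2, add_zero]

theorem tendsto_smul_zero (v : Vec n) : Tendsto (fun t : ℝ => t • v) (𝓝 0) (𝓝 (0 : Vec n)) := by
  have : Continuous (fun t : ℝ => t • v) := by fun_prop
  simpa using this.tendsto 0

theorem exists_pos_smul {q : Vec n → Prop} (hq : ∀ᶠ v in 𝓝 (0 : Vec n), q v) (v : Vec n) :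
    ∃ s : ℝ, 0 < s ∧ q (s • v) := by
  have h1 : ∀ᶠ t in 𝓝[>] (0 : ℝ), q (t • v) :=
    ((tendsto_smul_zero v).eventually hq).filter_mono nhdsWithin_le_nhds
  obtain ⟨t, ht, ht0⟩ := (h1.and self_mem_nhdsWithin).exists
  exact ⟨t, ht0, ht⟩

theorem sub_mem_dir {H : Finset (Vec n × ℝ)} {p q : Vec n} (hp : p ∈ poly H) (hq : q ∈ poly H) :
    q - p ∈ dir H := vsub_mem_vectorSpan ℝ hq hp

theorem sub_mem_tcone {H : Finset (Vec n × ℝ)} {p q : Vec n} (hq : q ∈ poly H) :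
    q - p ∈ tcone H p := by
  intro h hh hp'
  rw [inner_sub_right, hp']
  linarith [hq h hh]

theorem tcone_subset_dir {H : Finset (Vec n × ℝ)} {p : Vec n} (hp : p ∈ poly H) {v : Vec n}
    (hv : v ∈ tcone H p) : v ∈ dir H := by
  obtain ⟨s, hs, h⟩ := exists_pos_smul (eventually_mem_poly H p) v
  have h2 := sub_mem_dir hp (h.2 ⟨hp, smul_mem_tcone hs.le hv⟩)
  rw [add_sub_cancel_left] at h2
  exact ((dir H).smul_mem_iff hs.ne').1 h2

theorem span_tcone {H : Finset (Vec n × ℝ)} {p : Vec n} (hp : p ∈ poly H) :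
    Submodule.span ℝ (tcone H p) = dir H := by
  refine le_antisymm (Submodule.span_le.2 fun v hv => tcone_subset_dir hp hv) ?_
  rw [dir, vectorSpan_eq_span_vsub_set_right ℝ hp, Submodule.span_le]
  rintro _ ⟨q, hq, rfl⟩
  exact Submodule.subset_span (sub_mem_tcone hq)

/-- The tangent cone of the tangent cone: directions at a point of the tangent cone. -/
theorem eventually_tcone_add (H : Finset (Vec n × ℝ)) (x v : Vec n) :
    ∀ᶠ s in 𝓝[>] (0 : ℝ), v ∈ tcone H x → ∀ᶠ w in 𝓝 (0 : Vec n),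
      (v + w ∈ tcone H x ↔ w ∈ tcone H (x + s • v)) := by
  have h1 : ∀ᶠ t in 𝓝[>] (0 : ℝ), ∀ h ∈ H, (inner ℝ h.1 (x + t • v) = h.2 ↔
      inner ℝ h.1 x = h.2 ∧ inner ℝ h.1 (t • v) = 0) :=
    ((tendsto_smul_zero v).eventually (eventually_mem_flat_iff H x)).filter_mono
      nhdsWithin_le_nhds
  filter_upwards [h1, self_mem_nhdsWithin] with s hs hs0 hv
  have hs0 : (0 : ℝ) < s := hs0
  -- After a small step along `v`, the constraints that stay active are those active at `x` that
  -- vanish on `v`; the others become strict and impose nothing near `v`.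
  have hact : ∀ h ∈ H, (inner ℝ h.1 (x + s • v) = h.2 ↔ inner ℝ h.1 x = h.2 ∧ inner ℝ h.1 v = 0) := by
    intro h hh
    rw [hs h hh, inner_smul_right, mul_eq_zero, or_iff_right hs0.ne']
  have h2 : ∀ᶠ w in 𝓝 (0 : Vec n), ∀ h ∈ H, inner ℝ h.1 v < 0 → inner ℝ h.1 (v + w) < 0 := by
    rw [eventually_all_finset]
    intro h _
    by_cases hlt : inner ℝ h.1 v < 0
    · have hc : Tendsto (fun w : Vec n => (inner ℝ h.1 (v + w) : ℝ)) (𝓝 0) (𝓝 (inner ℝ h.1 v)) := by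
        have : Continuous (fun w : Vec n => (inner ℝ h.1 (v + w) : ℝ)) := by fun_prop
        simpa using this.tendsto 0
      filter_upwards [hc.eventually (gt_mem_nhds hlt)] with w hw _ using hw
    · exact Eventually.of_forall fun _ h' => absurd h' hlt
  filter_upwards [h2] with w hw
  constructor
  · intro hm h hh hp
    obtain ⟨ha, hb⟩ := (hact h hh).1 hp
    have := hm h hh ha
    rw [inner_add_right, hb] at this
    linarith
  · intro hm h hh hp
    rcases (hv h hh hp).lt_or_eq with hlt | heq
    · exact (hw h hh hlt).le
    · have := hm h hh ((hact h hh).2 ⟨hp, heq⟩)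
      rw [inner_add_right, heq]
      linarith

/-! ### Generic points, first hitting points, sums with a complementary subspace. -/

/-- A non-empty open set is not covered by finitely many proper subspaces. -/
theorem exists_mem_open_notMem_submodules {E : Type*} [NormedAddCommGroup E] [NormedSpace ℝ E]
    [FiniteDimensional ℝ E] {U : Set E} (hU : IsOpen U) (hne : U.Nonempty)
    {B : Set (Submodule ℝ E)} (hB : B.Finite) (hproper : ∀ W ∈ B, W ≠ ⊤) :
    ∃ u ∈ U, ∀ W ∈ B, u ∉ W := by
  borelize E
  by_contra! hcon
  let b := Module.finBasis ℝ E
  have hz : b.addHaar (⋃ W ∈ B, (W : Set E)) = 0 :=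
    (measure_biUnion_null_iff hB.countable).2 fun W hW =>
      Measure.addHaar_submodule b.addHaar W (hproper W hW)
  have hsub : U ⊆ ⋃ W ∈ B, (W : Set E) := fun u hu => by
    obtain ⟨W, hW, huW⟩ := hcon u hu
    exact mem_biUnion hW huW
  exact (hU.measure_pos b.addHaar hne).ne' (measure_mono_null hsub hz)

/-- The first point of a segment in a closed set. -/
theorem exists_first_mem {E : Type*} [NormedAddCommGroup E] [NormedSpace ℝ E] {K : Set E}
    (hK : IsClosed K) {z u : E} (hz : z ∉ K) (hu : u ∈ K) :
    ∃ t : ℝ, 0 < t ∧ z + t • (u - z) ∈ K ∧ ∀ s, 0 ≤ s → s < t → z + s • (u - z) ∉ K := by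
  have hc : Continuous fun t : ℝ => z + t • (u - z) := by fun_prop
  have hcpt : IsCompact (Icc (0 : ℝ) 1 ∩ (fun t : ℝ => z + t • (u - z)) ⁻¹' K) :=
    isCompact_Icc.inter_right (hK.preimage hc)
  obtain ⟨t, ⟨⟨ht0, ht1⟩, htK⟩, hmin⟩ := hcpt.exists_isLeast ⟨1, by simp, by simpa using hu⟩
  refine ⟨t, lt_of_le_of_ne ht0 ?_, htK, ?_⟩
  · rintro rfl
    apply hz
    simpa using htK
  · intro s hs0 hst hsK
    exact absurd (hmin ⟨⟨hs0, hst.le.trans ht1⟩, hsK⟩) (not_le.2 hst)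

theorem mem_add_iff_projection {D L : Submodule ℝ (Vec n)} (h : IsCompl D L) {K : Set (Vec n)}
    (hK : K ⊆ D) {y : Vec n} :
    (∃ t ∈ K, y - t ∈ L) ↔ D.projection L h y ∈ K := by
  constructor
  · rintro ⟨t, ht, hl⟩
    have : D.projection L h y = t := by
      have h1 : D.projection L h (t + (y - t)) = t := by
        rw [map_add, Submodule.projection_apply_of_mem_left h (hK ht),
          (Submodule.projection_apply_eq_zero_iff h).2 hl, add_zero]
      rwa [add_sub_cancel] at h1
    rwa [this]
  · intro hy
    exact ⟨_, hy, Submodule.sub_projection_mem h y⟩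

/-- A sum of a closed set and a subspace need not be closed; complementarity makes it the preimage
of `K` under a continuous projection. -/
theorem isClosed_add {D L : Submodule ℝ (Vec n)} (h : IsCompl D L) {K : Set (Vec n)}
    (hK : K ⊆ D) (hcl : IsClosed K) : IsClosed {y : Vec n | ∃ t ∈ K, y - t ∈ L} := by
  have : {y : Vec n | ∃ t ∈ K, y - t ∈ L} = (D.projection L h) ⁻¹' K := by
    ext y; exact mem_add_iff_projection h hK
  rw [this]
  exact hcl.preimage (LinearMap.continuous_of_finiteDimensional _)

/-! ### The maximum principle and the covering of a quotient by tangent cones. -/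

open Classical in
/-- All half-spaces that occur in the description of the cells of a complex. -/
noncomputable def walls (F : Finset (Finset (Vec n × ℝ))) : Finset (Vec n × ℝ) := F.biUnion id

theorem subset_walls {F : Finset (Finset (Vec n × ℝ))} {H : Finset (Vec n × ℝ)} (hH : H ∈ F) :
    H ⊆ walls F := by
  classical
  exact Finset.subset_biUnion_of_mem id hH

/-- The maximum principle at the points that lie on flats of codimension one: a linear functional
that is constant along the flat cannot have a strict one-sided maximum on the complex. -/
def MaxPrinciple (F : Finset (Finset (Vec n × ℝ))) (d : ℕ) : Prop :=
  ∀ p, finrank ℝ (flat (walls F) p) + 1 = d → ∀ m : Vec n,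
    (∀ v ∈ flat (walls F) p, inner ℝ m v = 0) →
    (∀ H ∈ F, p ∈ poly H → ∀ v ∈ tcone H p, inner ℝ m v ≤ 0) →
    ∀ H ∈ F, p ∈ poly H → ∀ v ∈ tcone H p, inner ℝ m v = 0

/-- The flat depends only on the set of active hyperplanes. This finiteness is what makes generic
choices possible. -/
theorem finite_range_flat (A : Finset (Vec n × ℝ)) : (range (flat A)).Finite := by
  classical
  let g : Finset (Vec n × ℝ) → Submodule ℝ (Vec n) := fun J => ⨅ h ∈ J, (ℝ ∙ h.1)ᗮ
  refine ((A.powerset.finite_toSet).image g).subset ?_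
  rintro _ ⟨p, rfl⟩
  refine ⟨A.filter fun h => inner ℝ h.1 p = h.2,
    Finset.mem_coe.2 (Finset.mem_powerset.2 (Finset.filter_subset _ _)), ?_⟩
  ext v
  simp only [g, Submodule.mem_iInf, Submodule.mem_orthogonal_singleton_iff_inner_right,
    Finset.mem_filter, mem_flat, and_imp]

theorem exists_orthogonal_pos {W : Submodule ℝ (Vec n)} {c : Vec n} (hc : c ∉ W) :
    ∃ m : Vec n, (∀ v ∈ W, inner ℝ m v = 0) ∧ 0 < inner ℝ m c := by
  obtain ⟨y, hy, z, hz, h⟩ := W.exists_add_mem_mem_orthogonal c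
  refine ⟨z, fun v hv => W.inner_left_of_mem_orthogonal hv hz, ?_⟩
  rw [h, inner_add_right, W.inner_left_of_mem_orthogonal hy hz, zero_add]
  refine real_inner_self_pos.2 ?_
  rintro rfl
  exact hc (by rw [h, add_zero]; exact hy)

theorem exists_eq_add_smul {E D : Submodule ℝ (Vec n)} (hED : E ≤ D)
    (hdim : finrank ℝ E + 1 = finrank ℝ D) {v : Vec n} (hv : v ∈ D) (hvE : v ∉ E)
    {g : Vec n} (hg : g ∈ D) : ∃ e ∈ E, ∃ b : ℝ, g = e + b • v := by
  have hle : E ⊔ ℝ ∙ v ≤ D := sup_le hED ((Submodule.span_singleton_le_iff_mem _ _).2 hv)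
  have hlt : E < E ⊔ ℝ ∙ v := left_lt_sup.2 fun h =>
    hvE (h (Submodule.mem_span_singleton_self v))
  have h1 := Submodule.finrank_lt_finrank_of_lt hlt
  have heq := Submodule.eq_of_le_of_finrank_le hle (by omega)
  rw [← heq] at hg
  obtain ⟨e, he, w, hw, rfl⟩ := Submodule.mem_sup.1 hg
  obtain ⟨b, rfl⟩ := Submodule.mem_span_singleton.1 hw
  exact ⟨e, he, b, rfl⟩

theorem finrank_add_of_isCompl {D L : Submodule ℝ (Vec n)} (h : IsCompl D L) :
    finrank ℝ D + finrank ℝ L = n := by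
  rw [Submodule.finrank_add_eq_of_isCompl h, finrank_euclideanSpace_fin]

theorem isCompl_of_disjoint_finrank {D L : Submodule ℝ (Vec n)} (h : Disjoint D L)
    (hd : finrank ℝ D + finrank ℝ L = n) : IsCompl D L := by
  refine ⟨h, codisjoint_iff.2 (Submodule.eq_top_of_finrank_eq ?_)⟩
  have := Submodule.finrank_sup_add_finrank_inf_eq D L
  rw [h.eq_bot, finrank_bot] at this
  rw [finrank_euclideanSpace_fin]
  omega

/-- The set is convex and spans `dir C ⊔ L`, which is the whole space. -/
theorem interior_tcone_add_nonempty {C : Finset (Vec n × ℝ)} {x : Vec n} {L : Submodule ℝ (Vec n)}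
    (hx : x ∈ poly C) (hCL : IsCompl (dir C) L) :
    (interior {y : Vec n | ∃ t ∈ tcone C x, y - t ∈ L}).Nonempty := by
  have hconv : Convex ℝ {y : Vec n | ∃ t ∈ tcone C x, y - t ∈ L} := by
    rintro y ⟨t, ht, hl⟩ y' ⟨t', ht', hl'⟩ a b ha hb hab
    refine ⟨a • t + b • t', convex_tcone C x ht ht' ha hb hab, ?_⟩
    have : a • y + b • y' - (a • t + b • t') = a • (y - t) + b • (y' - t') := by module
    rw [this]
    exact L.add_mem (L.smul_mem _ hl) (L.smul_mem _ hl')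
  have h0 : (0 : Vec n) ∈ {y : Vec n | ∃ t ∈ tcone C x, y - t ∈ L} :=
    ⟨0, zero_mem_tcone, by simp⟩
  rw [hconv.interior_nonempty_iff_affineSpan_eq_top,
    AffineSubspace.affineSpan_eq_top_iff_vectorSpan_eq_top_of_nonempty ℝ _ _ ⟨0, h0⟩,
    eq_top_iff, ← hCL.sup_eq_top, ← span_tcone hx]
  have hmem : ∀ y ∈ {y : Vec n | ∃ t ∈ tcone C x, y - t ∈ L},
      y ∈ vectorSpan ℝ {y : Vec n | ∃ t ∈ tcone C x, y - t ∈ L} := by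
    intro y hy
    simpa using vsub_mem_vectorSpan ℝ hy h0
  refine sup_le (Submodule.span_le.2 fun t ht => hmem t ⟨t, ht, by simp⟩) fun l hl => ?_
  exact hmem l ⟨0, zero_mem_tcone, by simpa using hl⟩

/-- If a cell through `x` is transversal to `L`, then the tangent cones at `x` of the cells that are
transversal to `L` project onto the whole quotient by `L`. -/
theorem exists_tcone_sub_mem {F : Finset (Finset (Vec n × ℝ))} {d : ℕ}
    (hd : ∀ H ∈ F, finrank ℝ (dir H) = d) (hmax : MaxPrinciple F d)
    {x : Vec n} {C : Finset (Vec n × ℝ)} {L : Submodule ℝ (Vec n)} (hC : C ∈ F)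
    (hx : x ∈ poly C) (hCL : IsCompl (dir C) L) (z : Vec n) :
    ∃ D ∈ F, x ∈ poly D ∧ IsCompl (dir D) L ∧ ∃ t ∈ tcone D x, z - t ∈ L := by
  -- Walk from an uncovered `z` towards a generic interior point `u` of the covered set `K` and stop
  -- at the first point `y` of `K`. Its representative `p` in a cone is moved into the complex as
  -- `p' = x + s • p`. By genericity the flat at `p'` has dimension `d` or `d - 1`, and in both
  -- cases the covering extends back towards `z`.
  by_contra hcon
  have hLd : d + finrank ℝ L = n := by rw [← hd C hC]; exact finrank_add_of_isCompl hCL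
  let G : Set (Finset (Vec n × ℝ)) := {D | D ∈ F ∧ x ∈ poly D ∧ IsCompl (dir D) L}
  have hGfin : G.Finite := F.finite_toSet.subset fun D h => h.1
  let K : Set (Vec n) := ⋃ D ∈ G, {y | ∃ t ∈ tcone D x, y - t ∈ L}
  have hK : IsClosed K := hGfin.isClosed_biUnion fun D hD =>
    isClosed_add hD.2.2 (fun t ht => tcone_subset_dir hD.2.1 ht) (isClosed_tcone D x)
  have hz : z ∉ K := by
    intro hzK
    obtain ⟨D, hD, hzD⟩ := mem_iUnion₂.1 hzK
    exact hcon ⟨D, hD.1, hD.2.1, hD.2.2, hzD⟩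
  -- a generic point in the interior
  obtain ⟨u, hu, hugen⟩ := exists_mem_open_notMem_submodules isOpen_interior
    (interior_tcone_add_nonempty hx hCL)
    -- Each of these has dimension at most `1 + (d - 2) + (n - d) = n - 1`. If `u` avoids them, the
    -- segment avoids `W ⊔ L` for every small flat `W`, except possibly at `z`.
    (B := (fun W => (ℝ ∙ z) ⊔ (W ⊔ L)) '' {W ∈ range (flat (walls F)) | finrank ℝ W + 2 ≤ d})
    (((finite_range_flat (walls F)).subset (sep_subset _ _)).image _) (by
      rintro _ ⟨W, ⟨_, hW⟩, rfl⟩ htop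
      change (ℝ ∙ z) ⊔ (W ⊔ L) = ⊤ at htop
      have h1 := Submodule.finrank_add_le_finrank_add_finrank (ℝ ∙ z) (W ⊔ L)
      have h2 := Submodule.finrank_add_le_finrank_add_finrank W L
      have h3 : finrank ℝ (ℝ ∙ z) ≤ 1 := (finrank_span_le_card {z}).trans (by simp)
      rw [htop, finrank_top, finrank_euclideanSpace_fin] at h1
      omega)
  have huK : u ∈ K := mem_biUnion (x := C) ⟨hC, hx, hCL⟩ (interior_subset hu)
  obtain ⟨t, ht0, htK, htmin⟩ := exists_first_mem hK hz huK
  set y := z + t • (u - z) with hy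
  obtain ⟨D, ⟨hDF, hxD, hDL⟩, p, hpD, hypL⟩ := mem_iUnion₂.1 htK
  -- a point of the complex close to `x` in the direction `p`
  have hev : ∀ᶠ s in 𝓝[>] (0 : ℝ), (0 < s) ∧
      (∀ H ∈ F, p ∈ tcone H x → ∀ᶠ w in 𝓝 (0 : Vec n),
        (p + w ∈ tcone H x ↔ w ∈ tcone H (x + s • p))) ∧
      (∀ H ∈ F, (x + s • p ∈ poly H ↔ x ∈ poly H ∧ s • p ∈ tcone H x)) ∧
      (∀ h ∈ walls F, (inner ℝ h.1 (x + s • p) = h.2 ↔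
        inner ℝ h.1 x = h.2 ∧ inner ℝ h.1 (s • p) = 0)) := by
    refine Filter.Eventually.and self_mem_nhdsWithin (Filter.Eventually.and ?_
      (Filter.Eventually.and ?_ ?_))
    · rw [eventually_all_finset]
      exact fun H _ => eventually_tcone_add H x p
    · rw [eventually_all_finset]
      exact fun H _ => ((tendsto_smul_zero p).eventually (eventually_mem_poly H x)).filter_mono
        nhdsWithin_le_nhds
    · exact ((tendsto_smul_zero p).eventually
        (eventually_mem_flat_iff (walls F) x)).filter_mono nhdsWithin_le_nhds
  obtain ⟨s, hs0, hst, hsp, hsf⟩ := hev.exists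
  set p' := x + s • p with hp'
  have hp'D : p' ∈ poly D := (hsp D hDF).2 ⟨hxD, smul_mem_tcone hs0.le hpD⟩
  set E := flat (walls F) p' with hE
  have hEt : ∀ H ∈ F, ∀ v ∈ E, v ∈ tcone H p' := fun H hH v hv =>
    flat_subset_tcone (subset_walls hH) hv
  have hED : E ≤ dir D := fun v hv => tcone_subset_dir hp'D (hEt D hDF v hv)
  have hEle : finrank ℝ E ≤ d := hd D hDF ▸ Submodule.finrank_mono hED
  have hEge : d < finrank ℝ E + 2 := by
    by_contra! hle
    refine hugen _ ⟨E, ⟨⟨p', rfl⟩, hle⟩, rfl⟩ ?_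
    have hpE : p ∈ E := by
      intro h hh hact
      have := ((hsf h hh).1 hact).2
      rwa [inner_smul_right, mul_eq_zero, or_iff_right hs0.ne'] at this
    have hyW : y ∈ E ⊔ L := by
      rw [← add_sub_cancel p y]
      exact Submodule.add_mem_sup hpE hypL
    have : u = (1 - t⁻¹) • z + t⁻¹ • y := by
      rw [hy, smul_add, smul_smul, inv_mul_cancel₀ ht0.ne']
      module
    rw [this]
    exact Submodule.add_mem_sup (Submodule.smul_mem _ _ (Submodule.mem_span_singleton_self z))
      (Submodule.smul_mem _ _ hyW)
  set k := z - u with hk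
  -- By minimality of `t`, no complementary cell at `p'` has a cone vector congruent modulo `L` to
  -- `k`, the direction back to `z`: a small step along it would give an earlier point of `K`.
  have hpush : ∀ D' ∈ F, p' ∈ poly D' → IsCompl (dir D') L → ∀ c ∈ tcone D' p', k - c ∉ L := by
    intro D' hD'F hp'D' hD'L c hc hl
    obtain ⟨hxD', hspt⟩ := (hsp D' hD'F).1 hp'D'
    have hpt : p ∈ tcone D' x := by
      have := smul_mem_tcone (inv_nonneg.2 hs0.le) hspt
      rwa [smul_smul, inv_mul_cancel₀ hs0.ne', one_smul] at this
    have h1 : ∀ᶠ a in 𝓝[>] (0 : ℝ), p + a • c ∈ tcone D' x ↔ a • c ∈ tcone D' p' :=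
      ((tendsto_smul_zero c).eventually (hst D' hD'F hpt)).filter_mono nhdsWithin_le_nhds
    have h2 : ∀ᶠ a in 𝓝[>] (0 : ℝ), a < t := (gt_mem_nhds ht0).filter_mono nhdsWithin_le_nhds
    obtain ⟨a, ⟨ha1, ha2⟩, ha0⟩ := ((h1.and h2).and self_mem_nhdsWithin).exists
    have ha0 : 0 < a := ha0
    refine htmin (t - a) (by linarith) (by linarith) ?_
    refine mem_biUnion (x := D') ⟨hD'F, hxD', hD'L⟩
      ⟨p + a • c, ha1.2 (smul_mem_tcone ha0.le hc), ?_⟩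
    have : z + (t - a) • (u - z) - (p + a • c) = (y - p) + a • (k - c) := by
      rw [hy, hk]; module
    rw [this]
    exact L.add_mem hypL (L.smul_mem _ hl)
  have hsplit : ∀ D' : Finset (Vec n × ℝ), IsCompl (dir D') L → ∃ c ∈ dir D', k - c ∈ L :=
    fun D' h => ⟨_, Submodule.projection_apply_mem h k, Submodule.sub_projection_mem h k⟩
  obtain ⟨c, hcD, hkc⟩ := hsplit D hDL
  have hcE : c ∉ E := fun hcE => hpush D hDF hp'D hDL c (hEt D hDF c hcE) hkc
  have hEd : finrank ℝ E + 1 = d := by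
    rcases (show finrank ℝ E = d ∨ finrank ℝ E + 1 = d by omega) with h | h
    · exact absurd ((Submodule.eq_of_le_of_finrank_eq hED (h.trans (hd D hDF).symm)).symm ▸ hcD) hcE
    · exact h
  have hcW : c ∉ E ⊔ L := by
    intro hcW
    obtain ⟨e, he, l, hl, hel⟩ := Submodule.mem_sup.1 hcW
    have hl0 : l = 0 := Submodule.disjoint_def.1 hDL.disjoint l
      (by rw [← hel] at hcD; exact (Submodule.add_mem_iff_right _ (hED he)).1 hcD) hl
    exact hcE (by rw [← hel, hl0, add_zero]; exact he)
  -- Since `k - c ∈ L`, `m` is positive on the side of `z`. The maximum principle provides a cell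
  -- `D'` with a cone vector `v` on that side, as otherwise `m` would vanish on `dir D`, which
  -- contains `c`.
  obtain ⟨m, hmW, hmc⟩ := exists_orthogonal_pos hcW
  have hmE : ∀ v ∈ E, inner ℝ m v = 0 := fun v hv => hmW v (le_sup_left (a := E) hv)
  have hmL : ∀ v ∈ L, inner ℝ m v = 0 := fun v hv => hmW v (le_sup_right (b := L) hv)
  obtain ⟨D', hD'F, hp'D', v, hv, hmv⟩ :
      ∃ D' ∈ F, p' ∈ poly D' ∧ ∃ v ∈ tcone D' p', 0 < inner ℝ m v := by
    by_contra! hall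
    have hzero := hmax p' hEd m hmE hall D hDF hp'D
    have hspan : dir D ≤ (ℝ ∙ m)ᗮ := by
      rw [← span_tcone hp'D, Submodule.span_le]
      intro v hv
      exact Submodule.mem_orthogonal_singleton_iff_inner_right.2 (hzero v hv)
    exact hmc.ne' (Submodule.mem_orthogonal_singleton_iff_inner_right.1 (hspan hcD))
  have hvD' : v ∈ dir D' := tcone_subset_dir hp'D' hv
  have hED' : E ≤ dir D' := fun w hw => tcone_subset_dir hp'D' (hEt D' hD'F w hw)
  have hvE : v ∉ E := fun h => hmv.ne' (hmE v h)
  have hrep : ∀ g ∈ dir D', ∃ e ∈ E, ∃ b : ℝ, g = e + b • v := fun g hg =>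
    exists_eq_add_smul hED' (by rw [hd D' hD'F, hEd]) hvD' hvE hg
  have hD'L : IsCompl (dir D') L := by
    refine isCompl_of_disjoint_finrank (Submodule.disjoint_def.2 fun g hg hgL => ?_)
      (by rw [hd D' hD'F, hLd])
    obtain ⟨e, he, b, rfl⟩ := hrep g hg
    have := hmL _ hgL
    rw [inner_add_right, hmE e he, inner_smul_right, zero_add, mul_eq_zero,
      or_iff_left hmv.ne'] at this
    subst this
    rw [zero_smul, add_zero] at hgL ⊢
    exact Submodule.disjoint_def.1 hDL.disjoint e (hED he) hgL
  obtain ⟨c', hc'D, hkc'⟩ := hsplit D' hD'L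
  obtain ⟨e, he, b, rfl⟩ := hrep c' hc'D
  -- Here `e` lies in the lineality space of the cone, and `b` is nonnegative because `b * ⟪m, v⟫ =
  -- ⟪m, k⟫ = ⟪m, c⟫ > 0`.
  refine hpush D' hD'F hp'D' hD'L _ (add_mem_tcone (hEt D' hD'F e he) (smul_mem_tcone ?_ hv)) hkc'
  have h1 := hmL _ hkc
  have h2 := hmL _ hkc'
  rw [inner_sub_right, sub_eq_zero] at h1 h2
  rw [inner_add_right, hmE e he, inner_smul_right, zero_add] at h2
  by_contra! hb
  nlinarith

/-- A complement of `D ⊓ W` is cut down to `W`. Choosing `L` inside a prescribed `W` is what adapts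
`exists_tcone_sub_mem` to each of the three statements. -/
theorem exists_isCompl_le {D W : Submodule ℝ (Vec n)} (h : D ⊔ W = ⊤) :
    ∃ L ≤ W, IsCompl D L := by
  obtain ⟨L, hL⟩ := Submodule.exists_isCompl (D ⊓ W)
  refine ⟨W ⊓ L, inf_le_left, disjoint_iff.2 ?_, codisjoint_iff.2 ?_⟩
  · rw [← inf_assoc, hL.inf_eq_bot]
  · rw [eq_top_iff, ← h]
    refine sup_le le_sup_left fun w hw => ?_
    obtain ⟨a, ha, l, hl, rfl⟩ : ∃ a ∈ D ⊓ W, ∃ l ∈ L, a + l = w :=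
      Submodule.mem_sup.1 (hL.sup_eq_top ▸ Submodule.mem_top)
    exact Submodule.add_mem_sup ha.1 ⟨(Submodule.add_mem_iff_right _ ha.2).1 hw, hl⟩

/-! ### Relatively open polyhedra in terms of a direction and strict inequalities. -/

theorem mem_intrinsicInterior_iff {s : Set (Vec n)} {x : Vec n} :
    x ∈ intrinsicInterior ℝ s ↔
      x ∈ s ∧ ∀ᶠ v in 𝓝 (0 : Vec n), v ∈ vectorSpan ℝ s → x + v ∈ s := by
  have key : ∀ hx : x ∈ affineSpan ℝ s, ((⟨x, hx⟩ : affineSpan ℝ s) ∈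
      interior ((↑) ⁻¹' s : Set (affineSpan ℝ s)) ↔
      ∀ᶠ v in 𝓝 (0 : Vec n), v ∈ vectorSpan ℝ s → x + v ∈ s) := by
    intro hx
    rw [mem_interior_iff_mem_nhds, nhds_subtype_eq_comap, mem_comap]
    have hmem : ∀ v, x + v ∈ affineSpan ℝ s ↔ v ∈ vectorSpan ℝ s := by
      intro v
      rw [← direction_affineSpan, add_comm]
      exact AffineSubspace.vadd_mem_iff_mem_direction v hx
    have ht : Tendsto (fun v : Vec n => x + v) (𝓝 0) (𝓝 x) := by
      have : Continuous (fun v : Vec n => x + v) := by fun_prop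
      simpa using this.tendsto 0
    have ht' : Tendsto (fun y : Vec n => y - x) (𝓝 x) (𝓝 0) := by
      have : Continuous (fun y : Vec n => y - x) := by fun_prop
      simpa using this.tendsto x
    constructor
    · rintro ⟨t, htx, hts⟩
      filter_upwards [ht htx] with v hv hvV
      exact hts (show (⟨x + v, (hmem v).2 hvV⟩ : affineSpan ℝ s) ∈ _ from hv)
    · intro h
      refine ⟨_, ht'.eventually h, ?_⟩
      rintro ⟨y, hy⟩ hyt
      have := hyt ((hmem (y - x)).1 (by simpa using hy))
      simpa using this
  rw [mem_intrinsicInterior]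
  constructor
  · rintro ⟨⟨y, hy⟩, h1, rfl⟩
    have h2 := interior_subset h1
    exact ⟨h2, (key hy).1 h1⟩
  · rintro ⟨hx, h⟩
    exact ⟨⟨x, subset_affineSpan ℝ s hx⟩, (key _).2 h, rfl⟩

/-- A description of a relatively open polyhedron by its direction `V` and strict inequalities. -/
structure RelOpenPresentation (P : Set (Vec n)) (V : Submodule ℝ (Vec n))
    (J Q : Finset (Vec n × ℝ)) : Prop where
  vectorSpan_eq : vectorSpan ℝ P = V
  mem_iff : ∀ x₀ ∈ P, ∀ x, x ∈ P ↔ x - x₀ ∈ V ∧ ∀ h ∈ J, inner ℝ h.1 x < h.2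
  mem_closure_iff : ∀ x₀ ∈ P, ∀ x, x ∈ closure P ↔ x - x₀ ∈ V ∧ x ∈ poly J
  closure_eq : closure P = poly Q
  frontier_eq : intrinsicFrontier ℝ P = closure P \ P

theorem eventually_add_mem_strict {J : Finset (Vec n × ℝ)} {x : Vec n}
    (hx : ∀ h ∈ J, inner ℝ h.1 x < h.2) :
    ∀ᶠ v in 𝓝 (0 : Vec n), ∀ h ∈ J, inner ℝ h.1 (x + v) < h.2 := by
  filter_upwards [eventually_side J x] with v hv h hh using (hv h hh).1 (hx h hh)

theorem exists_relOpenPresentation {P : Set (Vec n)} (hP : IsRelOpenPolyhedron P) :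
    P.Nonempty ∧ ∃ V J Q, RelOpenPresentation P V J Q := by
  classical
  obtain ⟨⟨x₀, hx₀⟩, _, ⟨H, rfl⟩, hPQ⟩ := hP
  refine ⟨⟨x₀, hx₀⟩, ?_⟩
  change P = intrinsicInterior ℝ (poly H) at hPQ
  -- The inequalities that are strict somewhere on the polyhedron. All others are equalities on it;
  -- they are exactly the active ones at `x₀` and determine `V`.
  let J := H.filter fun h => ∃ y ∈ poly H, inner ℝ h.1 y < h.2
  have hJH : ∀ h ∈ J, h ∈ H := fun h hh => (Finset.mem_filter.1 hh).1
  have hPH : P ⊆ poly H := hPQ ▸ intrinsicInterior_subset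
  have hstrict : ∀ x ∈ P, ∀ h ∈ J, inner ℝ h.1 x < h.2 := by
    intro x hx h hh
    refine lt_of_le_of_ne (hPH hx h (hJH h hh)) fun heq => ?_
    -- If the inequality were tight at the relative interior point `x`, a small step from `x` away
    -- from `y` would violate it.
    obtain ⟨-, y, hy, hlt⟩ := Finset.mem_filter.1 hh
    rw [hPQ, mem_intrinsicInterior_iff] at hx
    obtain ⟨s, hs, hmem⟩ := exists_pos_smul hx.2 (x - y)
    have h1 := hmem (Submodule.smul_mem _ _ (sub_mem_dir hy hx.1)) h (hJH h hh)
    rw [inner_add_right, inner_smul_right, inner_sub_right, heq] at h1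
    nlinarith
  have heqs : ∀ h ∈ H, h ∉ J → ∀ y ∈ poly H, inner ℝ h.1 y = h.2 := by
    intro h hh hhJ y hy
    refine le_antisymm (hy h hh) ?_
    by_contra! hlt
    exact hhJ (Finset.mem_filter.2 ⟨hh, y, hy, hlt⟩)
  let V := flat H x₀
  have hsubV : ∀ x ∈ poly H, ∀ y ∈ poly H, y - x ∈ V := by
    intro x hx y hy h hh hact
    have hhJ : h ∉ J := fun hhJ => (hstrict x₀ hx₀ h hhJ).ne hact
    rw [inner_sub_right, heqs h hh hhJ x hx, heqs h hh hhJ y hy, sub_self]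
  have hmemH : ∀ x ∈ P, ∀ y, y - x ∈ V → y ∈ poly J → y ∈ poly H := by
    intro x hx y hyV hyJ h hh
    by_cases hhJ : h ∈ J
    · exact hyJ h hhJ
    · have h1 := hyV h hh (heqs h hh hhJ x₀ (hPH hx₀))
      rw [inner_sub_right, heqs h hh hhJ x (hPH hx)] at h1
      linarith
  have hdirV : dir H = V := by
    refine le_antisymm ?_ fun v hv => ?_
    · rw [dir, vectorSpan_eq_span_vsub_set_right ℝ (hPH hx₀), Submodule.span_le]
      rintro _ ⟨y, hy, rfl⟩
      exact hsubV _ (hPH hx₀) _ hy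
    · exact tcone_subset_dir (hPH hx₀) (flat_subset_tcone subset_rfl hv)
  have hmem : ∀ x ∈ P, ∀ y, y ∈ P ↔ y - x ∈ V ∧ ∀ h ∈ J, inner ℝ h.1 y < h.2 := by
    intro x hx y
    refine ⟨fun hy => ⟨hsubV _ (hPH hx) _ (hPH hy), hstrict y hy⟩, fun ⟨h1, h2⟩ => ?_⟩
    rw [hPQ, mem_intrinsicInterior_iff]
    refine ⟨hmemH x hx y h1 fun h hh => (h2 h hh).le, ?_⟩
    filter_upwards [eventually_add_mem_strict h2] with v hv hvV
    refine hmemH x hx _ ?_ fun h hh => (hv h hh).le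
    rw [show y + v - x = (y - x) + v by abel]
    exact V.add_mem h1 (hdirV ▸ hvV)
  have hloc : ∀ x ∈ P, ∀ᶠ v in 𝓝 (0 : Vec n), v ∈ V → x + v ∈ P := by
    intro x hx
    filter_upwards [eventually_add_mem_strict (hstrict x hx)] with v hv hvV
    exact (hmem x hx _).2 ⟨by simpa using hvV, hv⟩
  have hspan : vectorSpan ℝ P = V := by
    refine le_antisymm ?_ fun v hv => ?_
    · rw [← hdirV]
      exact vectorSpan_mono ℝ hPH
    · obtain ⟨s, hs, h⟩ := exists_pos_smul (hloc x₀ hx₀) v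
      have h1 := vsub_mem_vectorSpan ℝ (h (V.smul_mem s hv)) hx₀
      rw [vsub_eq_sub, add_sub_cancel_left] at h1
      exact ((vectorSpan ℝ P).smul_mem_iff hs.ne').1 h1
  have hcl : closure P = poly H := by
    refine subset_antisymm (closure_minimal hPH (isClosed_poly H)) fun y hy => ?_
    have ht : Tendsto (fun s : ℝ => y + s • (x₀ - y)) (𝓝[>] 0) (𝓝 y) := by
      have : Continuous (fun s : ℝ => y + s • (x₀ - y)) := by fun_prop
      simpa using (this.tendsto 0).mono_left nhdsWithin_le_nhds
    refine mem_closure_of_tendsto ht ?_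
    have h1 : ∀ᶠ s in 𝓝[>] (0 : ℝ), s < 1 := (gt_mem_nhds one_pos).filter_mono nhdsWithin_le_nhds
    filter_upwards [self_mem_nhdsWithin, h1] with s hs hs1
    have hs : 0 < s := hs
    refine (hmem x₀ hx₀ _).2 ⟨?_, fun h hh => ?_⟩
    · rw [show y + s • (x₀ - y) - x₀ = (1 - s) • (y - x₀) by module]
      exact V.smul_mem _ (hsubV _ (hPH hx₀) _ hy)
    · rw [inner_add_right, inner_smul_right, inner_sub_right]
      nlinarith [hy h (hJH h hh), hstrict x₀ hx₀ h hh]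
  refine ⟨V, J, H, hspan, hmem, ?_, hcl, ?_⟩
  · intro x hx y
    rw [hcl]
    exact ⟨fun hy => ⟨hsubV _ (hPH hx) _ hy, fun h hh => hy h (hJH h hh)⟩,
      fun ⟨h1, h2⟩ => hmemH x hx y h1 h2⟩
  · rw [← intrinsicClosure_sdiff_intrinsicInterior, intrinsicClosure_eq_closure]
    congr 1
    refine subset_antisymm intrinsicInterior_subset fun x hx => mem_intrinsicInterior_iff.2 ⟨hx, ?_⟩
    rw [hspan]
    exact hloc x hx

namespace RelOpenPresentation

variable {P : Set (Vec n)} {V : Submodule ℝ (Vec n)} {J Q : Finset (Vec n × ℝ)}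

theorem eventually_add_mem (hP : RelOpenPresentation P V J Q) {x : Vec n} (hx : x ∈ P) :
    ∀ᶠ v in 𝓝 (0 : Vec n), v ∈ V → x + v ∈ P := by
  filter_upwards [eventually_add_mem_strict ((hP.mem_iff x hx x).1 hx).2] with v hv hvV
  exact (hP.mem_iff x hx _).2 ⟨by simpa using hvV, hv⟩

theorem sub_mem (hP : RelOpenPresentation P V J Q) {x y : Vec n} (hx : x ∈ P)
    (hy : y ∈ closure P) : y - x ∈ V := ((hP.mem_closure_iff x hx y).1 hy).1

theorem lt (hP : RelOpenPresentation P V J Q) {x : Vec n} (hx : x ∈ P) :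
    ∀ h ∈ J, inner ℝ h.1 x < h.2 := ((hP.mem_iff x hx x).1 hx).2

theorem convex (hP : RelOpenPresentation P V J Q) : Convex ℝ P := by
  intro x hx y hy a b ha hb hab
  refine (hP.mem_iff x hx _).2 ⟨?_, fun h hh => ?_⟩
  · rw [show a • x + b • y - x = b • (y - x) by rw [← eq_sub_iff_add_eq] at hab; subst hab; module]
    exact V.smul_mem _ (hP.sub_mem hx (subset_closure hy))
  · exact (convex_halfSpace_lt (innerSL ℝ h.1).isLinear h.2) (hP.lt hx h hh) (hP.lt hy h hh)
      ha hb hab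

/-- Points of a cell that lie in the closure of `P` belong to the closure of the intersection, if
this intersection is non-empty. -/
theorem mem_closure_inter (hP : RelOpenPresentation P V J Q) {C : Finset (Vec n × ℝ)}
    {c y : Vec n} (hc : c ∈ poly C ∩ P) (hy : y ∈ poly C ∩ closure P) :
    y ∈ closure (poly C ∩ P) := by
  have ht : Tendsto (fun s : ℝ => y + s • (c - y)) (𝓝[>] 0) (𝓝 y) := by
    have : Continuous (fun s : ℝ => y + s • (c - y)) := by fun_prop
    simpa using (this.tendsto 0).mono_left nhdsWithin_le_nhds
  refine mem_closure_of_tendsto ht ?_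
  have h1 : ∀ᶠ s in 𝓝[>] (0 : ℝ), s < 1 := (gt_mem_nhds one_pos).filter_mono nhdsWithin_le_nhds
  filter_upwards [self_mem_nhdsWithin, h1] with s hs hs1
  have hs : 0 < s := hs
  obtain ⟨hyV, hyJ⟩ := (hP.mem_closure_iff c hc.2 y).1 hy.2
  refine ⟨(convex_poly C).add_smul_sub_mem hy.1 hc.1 ⟨hs.le, hs1.le⟩,
    (hP.mem_iff c hc.2 _).2 ⟨?_, fun h hh => ?_⟩⟩
  · rw [show y + s • (c - y) - c = (1 - s) • (y - c) by module]
    exact V.smul_mem _ hyV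
  · rw [inner_add_right, inner_smul_right, inner_sub_right]
    nlinarith [hyJ h hh, hP.lt hc.2 h hh]

end RelOpenPresentation

/-! ### Dimension bounds and maxima on polyhedra. -/

/-- Lower bound for the dimension of a set that contains a neighbourhood of the apex of a cone. -/
theorem finrank_span_le_dimH {E S U : Set (Vec n)} {x : Vec n} (hconv : Convex ℝ E)
    (h0 : (0 : Vec n) ∈ E) (hsmul : ∀ v ∈ E, ∀ s : ℝ, 0 ≤ s → s • v ∈ E)
    (hS : ∀ᶠ v in 𝓝 (0 : Vec n), v ∈ E → x + v ∈ S) (hU : U ∈ 𝓝 x) :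
    (finrank ℝ (Submodule.span ℝ E) : ENNReal) ≤ dimH (S ∩ U) := by
  have ht : Tendsto (fun v : Vec n => x + v) (𝓝 0) (𝓝 x) := by
    have : Continuous (fun v : Vec n => x + v) := by fun_prop
    simpa using this.tendsto 0
  obtain ⟨r, hr, hball⟩ := Metric.eventually_nhds_iff_ball.1 (hS.and (ht.eventually hU))
  have hsub : (fun v : Vec n => x + v) '' (E ∩ Metric.ball 0 r) ⊆ S ∩ U := by
    rintro _ ⟨v, ⟨hvE, hvr⟩, rfl⟩
    exact ⟨(hball v hvr).1 hvE, (hball v hvr).2⟩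
  have hz : (0 : Vec n) ∈ E ∩ Metric.ball 0 r := ⟨h0, Metric.mem_ball_self hr⟩
  have hle : Submodule.span ℝ E ≤ vectorSpan ℝ (E ∩ Metric.ball 0 r) := by
    refine Submodule.span_le.2 fun v hv => ?_
    obtain ⟨s, hs, hsr⟩ := exists_pos_smul (Metric.ball_mem_nhds (0 : Vec n) hr) v
    have hmem : s • v ∈ E ∩ Metric.ball 0 r := ⟨hsmul v hv s hs.le, hsr⟩
    have h1 := vsub_mem_vectorSpan ℝ hmem hz
    rw [vsub_eq_sub, sub_zero] at h1
    exact ((vectorSpan ℝ _).smul_mem_iff hs.ne').1 h1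
  calc (finrank ℝ (Submodule.span ℝ E) : ENNReal)
      ≤ finrank ℝ (vectorSpan ℝ (E ∩ Metric.ball 0 r)) := by
        exact_mod_cast Submodule.finrank_mono hle
    _ = dimH (E ∩ Metric.ball 0 r) :=
        (Real.Convex.dimH_eq_finrank_vectorSpan (hconv.inter (convex_ball 0 r)) ⟨0, hz⟩).symm
    _ = dimH ((fun v : Vec n => x + v) '' (E ∩ Metric.ball 0 r)) :=
        ((isometry_add_left x).dimH_image _).symm
    _ ≤ dimH (S ∩ U) := dimH_mono hsub

/-- Upper bound for the dimension of a set covered by finitely many pieces of flats. -/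
theorem dimH_le_of_subset_biUnion {ι : Type*} {I : Set ι} (hI : I.Finite) {A : ι → Set (Vec n)}
    {S : Set (Vec n)} (hS : S ⊆ ⋃ i ∈ I, A i) {k : ℕ}
    (hA : ∀ i ∈ I, (A i).Nonempty → ∃ K : Submodule ℝ (Vec n), finrank ℝ K ≤ k ∧
      ∀ p ∈ A i, ∀ q ∈ A i, q - p ∈ K) : dimH S ≤ k := by
  refine (dimH_mono hS).trans ?_
  rw [dimH_bUnion hI.countable]
  refine iSup₂_le fun i hi => ?_
  rcases (A i).eq_empty_or_nonempty with h | ⟨p, hp⟩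
  · simp [h]
  · obtain ⟨K, hK, hsub⟩ := hA i hi ⟨p, hp⟩
    have h1 : A i ⊆ (fun v : Vec n => p + v) '' (Subtype.val '' (univ : Set K)) := by
      intro q hq
      exact ⟨q - p, ⟨⟨q - p, hsub p hp q hq⟩, mem_univ _, rfl⟩, by simp⟩
    calc dimH (A i) ≤ dimH ((fun v : Vec n => p + v) '' (Subtype.val '' (univ : Set K))) :=
          dimH_mono h1
      _ = finrank ℝ K := by
          rw [(isometry_add_left p).dimH_image, isometry_subtype_coe.dimH_image,
            Real.dimH_univ_eq_finrank]
      _ ≤ k := by exact_mod_cast hK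

/-- A linear functional that is bounded above on a non-empty polyhedron attains its maximum. -/
theorem exists_isMaxOn_poly {H : Finset (Vec n × ℝ)} (hne : (poly H).Nonempty) {a : Vec n} {B : ℝ}
    (hB : ∀ x ∈ poly H, inner ℝ a x ≤ B) :
    ∃ p ∈ poly H, ∀ x ∈ poly H, inner ℝ a x ≤ inner ℝ a p := by
  classical
  -- While `a` is not constant along the flat through the point, move inside that flat so that `a`
  -- increases, as far as the polyhedron allows. The bound `B` makes the move finite, and a new
  -- constraint becomes active, so the dimension of the flat drops.
  have step : ∀ k, ∀ x ∈ poly H, finrank ℝ (flat H x) = k →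
      ∃ y ∈ poly H, inner ℝ a x ≤ inner ℝ a y ∧ ∀ v ∈ flat H y, inner ℝ a v = 0 := by
    intro k
    induction k using Nat.strong_induction_on with
    | _ k ih =>
    intro x hx hk
    by_cases hconst : ∀ v ∈ flat H x, inner ℝ a v = 0
    · exact ⟨x, hx, le_rfl, hconst⟩
    obtain ⟨v, hv, hav⟩ : ∃ v ∈ flat H x, 0 < inner ℝ a v := by
      push Not at hconst
      obtain ⟨v, hv, hne⟩ := hconst
      rcases hne.lt_or_gt with h | h
      · exact ⟨-v, (flat H x).neg_mem hv, by rw [inner_neg_right]; linarith⟩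
      · exact ⟨v, hv, h⟩
    have hc : Continuous fun t : ℝ => x + t • v := by fun_prop
    have hbd : ∀ t, x + t • v ∈ poly H → t ≤ (B - inner ℝ a x) / inner ℝ a v := by
      intro t ht
      have := hB _ ht
      rw [inner_add_right, inner_smul_right] at this
      rw [le_div_iff₀ hav]
      linarith
    have hcpt : IsCompact (Icc (0 : ℝ) ((B - inner ℝ a x) / inner ℝ a v) ∩
        (fun t : ℝ => x + t • v) ⁻¹' poly H) :=
      isCompact_Icc.inter_right ((isClosed_poly H).preimage hc)
    have hmem : ∀ t, 0 ≤ t → x + t • v ∈ poly H → t ∈ Icc (0 : ℝ) ((B - inner ℝ a x) / inner ℝ a v) ∩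
        (fun t : ℝ => x + t • v) ⁻¹' poly H := fun t h0 ht => ⟨⟨h0, hbd t ht⟩, ht⟩
    obtain ⟨t, ⟨⟨ht0, -⟩, htH⟩, hmax⟩ :=
      hcpt.exists_isGreatest ⟨0, hmem 0 le_rfl (by simpa using hx)⟩
    have htH : x + t • v ∈ poly H := htH
    have hlt : flat H (x + t • v) < flat H x := by
      refine lt_of_le_of_ne (fun w hw h hh hact => hw h hh ?_) fun heq => ?_
      · rw [inner_add_right, inner_smul_right, hact, hv h hh hact, mul_zero, add_zero]
      · obtain ⟨s, hs, hsm⟩ := exists_pos_smul (eventually_mem_poly H (x + t • v)) v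
        have h1 := hsm.2 ⟨htH, smul_mem_tcone hs.le (flat_subset_tcone subset_rfl (heq ▸ hv))⟩
        rw [add_assoc, ← add_smul] at h1
        have := hmax (hmem _ (by linarith) h1)
        linarith
    obtain ⟨y, hy, hxy, hy2⟩ := ih _ (hk ▸ Submodule.finrank_lt_finrank_of_lt hlt) _ htH rfl
    refine ⟨y, hy, le_trans ?_ hxy, hy2⟩
    rw [inner_add_right, inner_smul_right]
    nlinarith
  -- At these points the value of `a` depends only on the set of active constraints, so finitely
  -- many values compete for the maximum.
  let R : Set ℝ := (fun y => inner ℝ a y) '' {y | y ∈ poly H ∧ ∀ v ∈ flat H y, inner ℝ a v = 0}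
  have hR : R.Finite := by
    let act : Vec n → Finset (Vec n × ℝ) := fun y => H.filter fun h => inner ℝ h.1 y = h.2
    have hcover : R ⊆ ⋃ A ∈ (H.powerset : Set (Finset (Vec n × ℝ))), (fun y => inner ℝ a y) ''
        {y | y ∈ poly H ∧ (∀ v ∈ flat H y, inner ℝ a v = 0) ∧ act y = A} := by
      rintro _ ⟨y, ⟨h1, h2⟩, rfl⟩
      exact mem_biUnion (x := act y) (Finset.mem_coe.2 (Finset.mem_powerset.2 (Finset.filter_subset _ _)))
        ⟨y, ⟨h1, h2, rfl⟩, rfl⟩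
    refine (H.powerset.finite_toSet.biUnion fun A _ => Set.Subsingleton.finite ?_).subset hcover
    rintro _ ⟨y, ⟨-, h2, h3⟩, rfl⟩ _ ⟨y', ⟨-, -, h3'⟩, rfl⟩
    have : y' - y ∈ flat H y := by
      intro h hh hact
      have h4 : h ∈ act y' := by
        rw [h3', ← h3]
        exact Finset.mem_filter.2 ⟨hh, hact⟩
      rw [inner_sub_right, hact, (Finset.mem_filter.1 h4).2, sub_self]
    have h5 := h2 _ this
    rw [inner_sub_right] at h5
    change inner ℝ a y = inner ℝ a y'
    linarith
  obtain ⟨x₀, hx₀⟩ := hne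
  obtain ⟨y₀, hy₀, -, hy₀'⟩ := step _ x₀ hx₀ rfl
  obtain ⟨_, ⟨p, ⟨hp, -⟩, rfl⟩, hmax⟩ := exists_max_image R id hR ⟨_, y₀, ⟨hy₀, hy₀'⟩, rfl⟩
  refine ⟨p, hp, fun x hx => ?_⟩
  obtain ⟨y, hy, hxy, hy'⟩ := step _ x hx rfl
  exact hxy.trans (hmax _ ⟨y, ⟨hy, hy'⟩, rfl⟩)

/-! ### Points and purity of the stable intersection. -/

/-- The union of the cells of a complex. -/
def support (F : Finset (Finset (Vec n × ℝ))) : Set (Vec n) := ⋃ H ∈ F, poly H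

theorem mem_support {F : Finset (Finset (Vec n × ℝ))} {x : Vec n} :
    x ∈ support F ↔ ∃ H ∈ F, x ∈ poly H := by simp [support]

variable {F : Finset (Finset (Vec n × ℝ))} {d : ℕ} {P : Set (Vec n)} {V : Submodule ℝ (Vec n)}
  {J Q : Finset (Vec n × ℝ)}

/-- Local version of `exists_tcone_sub_mem`, with control on the smallness of the vectors. -/
theorem eventually_exists_tcone_sub_mem
    (hd : ∀ H ∈ F, finrank ℝ (dir H) = d) (hmax : MaxPrinciple F d)
    {x : Vec n} {C : Finset (Vec n × ℝ)} {L : Submodule ℝ (Vec n)} (hC : C ∈ F)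
    (hx : x ∈ poly C) (hCL : IsCompl (dir C) L) {q : Finset (Vec n × ℝ) → Vec n → Prop}
    (hq : ∀ D ∈ F, ∀ᶠ t in 𝓝 (0 : Vec n), q D t) :
    ∀ᶠ v in 𝓝 (0 : Vec n), ∃ D ∈ F, x ∈ poly D ∧ IsCompl (dir D) L ∧
      ∃ t ∈ tcone D x, v - t ∈ L ∧ q D t := by
  have h1 : ∀ᶠ v in 𝓝 (0 : Vec n), ∀ D ∈ F, ∀ h : IsCompl (dir D) L,
      q D ((dir D).projection L h v) := by
    rw [eventually_all_finset]
    intro D hD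
    by_cases h : IsCompl (dir D) L
    · have hc : Continuous ((dir D).projection L h) := LinearMap.continuous_of_finiteDimensional _
      have ht : Tendsto ((dir D).projection L h) (𝓝 0) (𝓝 0) := by simpa using hc.tendsto 0
      filter_upwards [ht.eventually (hq D hD)] with v hv _ using hv
    · exact Eventually.of_forall fun _ h' => absurd h' h
  filter_upwards [h1] with v hv
  obtain ⟨D, hD, hxD, hDL, ht⟩ := exists_tcone_sub_mem hd hmax hC hx hCL v
  have hmem := (mem_add_iff_projection hDL fun t ht => tcone_subset_dir hxD ht).1 ht
  exact ⟨D, hD, hxD, hDL, _, hmem, Submodule.sub_projection_mem hDL v, hv D hD hDL⟩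

theorem eventually_mem_poly_imp (F : Finset (Finset (Vec n × ℝ))) (x : Vec n) :
    ∀ᶠ v in 𝓝 (0 : Vec n), ∀ D ∈ F, (x + v ∈ poly D ↔ x ∈ poly D ∧ v ∈ tcone D x) := by
  rw [eventually_all_finset]
  exact fun D _ => eventually_mem_poly D x

/-- The stable intersection consists of the points of the cells that are transversal to `P`. -/
theorem mem_stableIntersection_iff
    (hd : ∀ H ∈ F, finrank ℝ (dir H) = d) (hmax : MaxPrinciple F d)
    (hP : RelOpenPresentation P V J Q) {x : Vec n} :
    x ∈ stableIntersection (support F) P ↔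
      x ∈ P ∧ ∃ D ∈ F, x ∈ poly D ∧ dir D ⊔ V = ⊤ := by
  constructor
  · rintro ⟨⟨-, hxP⟩, hst⟩
    refine ⟨hxP, ?_⟩
    obtain ⟨r, hr, hball⟩ := Metric.eventually_nhds_iff_ball.1 (eventually_mem_poly_imp F x)
    obtain ⟨δ, hδ, hv⟩ := hst (r / 2) (by positivity)
    by_contra! hcon
    -- If no cell through `x` is transversal, a small shift `u` can avoid all the proper subspaces
    -- `dir D ⊔ V`. But a point of the shifted complex in `P` near `x` writes `u` as a sum of
    -- vectors of `dir D` and `V`.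
    obtain ⟨u, hu, hugen⟩ := exists_mem_open_notMem_submodules
      (Metric.isOpen_ball (x := (0 : Vec n)) (ε := min δ (r / 2)))
      ⟨0, Metric.mem_ball_self (by positivity)⟩
      (B := (fun D => dir D ⊔ V) '' {D ∈ (F : Set (Finset (Vec n × ℝ))) | x ∈ poly D})
      ((F.finite_toSet.subset (sep_subset _ _)).image _) (by
        rintro _ ⟨D, ⟨hD, hxD⟩, rfl⟩
        exact hcon D hD hxD)
    rw [mem_ball_zero_iff, lt_min_iff] at hu
    obtain ⟨_, ⟨⟨a, haT, rfl⟩, hyP⟩, hdist⟩ := hv u hu.1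
    obtain ⟨D, hD, haD⟩ := mem_support.1 haT
    have hmem : a - x ∈ Metric.ball (0 : Vec n) r := by
      rw [mem_ball_zero_iff]
      calc ‖a - x‖ = ‖(a + u - x) - u‖ := by congr 1; abel
        _ ≤ ‖a + u - x‖ + ‖u‖ := norm_sub_le _ _
        _ < r / 2 + r / 2 := add_lt_add (by rwa [dist_comm, dist_eq_norm] at hdist) hu.2
        _ = r := by ring
    have hxD := ((hball _ hmem D hD).1 (by simpa using haD)).1
    refine hugen _ ⟨D, ⟨hD, hxD⟩, rfl⟩ ?_
    have : u = -(a - x) + ((a + u) - x) := by abel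
    rw [this]
    exact Submodule.add_mem_sup (Submodule.neg_mem _ (sub_mem_dir hxD haD))
      (hP.sub_mem hxP (subset_closure hyP))
  · rintro ⟨hxP, C, hC, hxC, hCV⟩
    refine ⟨⟨mem_support.2 ⟨C, hC, hxC⟩, hxP⟩, fun ε hε => ?_⟩
    -- For a shift by `v`, the covering represents `-v` modulo `L` by a small cone vector `t`. Then
    -- `t + v` lies in `L ≤ V`, so `x + t + v` is in `P`.
    obtain ⟨L, hLV, hCL⟩ := exists_isCompl_le hCV
    obtain ⟨r, hr, hball⟩ := Metric.eventually_nhds_iff_ball.1 (hP.eventually_add_mem hxP)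
    have hsmall : ∀ᶠ v in 𝓝 (0 : Vec n), ‖v‖ < min r ε / 2 := by
      filter_upwards [Metric.ball_mem_nhds (0 : Vec n) (show 0 < min r ε / 2 by positivity)] with v hv
      exact mem_ball_zero_iff.1 hv
    have hq : ∀ D ∈ F, ∀ᶠ t in 𝓝 (0 : Vec n),
        (x + t ∈ poly D ↔ x ∈ poly D ∧ t ∈ tcone D x) ∧ ‖t‖ < min r ε / 2 :=
      fun D _ => (eventually_mem_poly D x).and hsmall
    obtain ⟨δ, hδ, hδball⟩ := Metric.eventually_nhds_iff_ball.1
      ((eventually_exists_tcone_sub_mem hd hmax hC hxC hCL hq).and hsmall)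
    refine ⟨δ, hδ, fun v hv => ?_⟩
    obtain ⟨⟨D, hD, hxD, -, t, ht, hl, hti, htn⟩, hvn⟩ := hδball (-v) (by
      rw [mem_ball_zero_iff, norm_neg]; exact hv)
    have hn : ‖t + v‖ < min r ε := by
      rw [norm_neg] at hvn
      calc ‖t + v‖ ≤ ‖t‖ + ‖v‖ := norm_add_le _ _
        _ < min r ε / 2 + min r ε / 2 := add_lt_add htn hvn
        _ = min r ε := by ring
    refine ⟨x + t + v, ⟨⟨x + t, mem_support.2 ⟨D, hD, hti.2 ⟨hxD, ht⟩⟩, rfl⟩, ?_⟩, ?_⟩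
    · rw [add_assoc]
      refine hball (t + v) ?_ ?_
      · rw [mem_ball_zero_iff]
        exact hn.trans_le (min_le_left _ _)
      · have := hLV (L.neg_mem hl)
        rwa [neg_sub, sub_neg_eq_add] at this
    · rw [add_assoc, dist_self_add_right]
      exact hn.trans_le (min_le_right _ _)

theorem finrank_inf_of_sup_eq_top {D V : Submodule ℝ (Vec n)} (h : D ⊔ V = ⊤) :
    n + finrank ℝ (D ⊓ V : Submodule ℝ (Vec n)) = finrank ℝ D + finrank ℝ V := by
  rw [← Submodule.finrank_sup_add_finrank_inf_eq, h, finrank_top, finrank_euclideanSpace_fin]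

/-- If a non-empty relatively open subset of `V` is covered by finitely many sets, each contained
in a subspace, then one of the subspaces contains `V`. -/
theorem exists_mem_subspace_notMem {V : Submodule ℝ (Vec n)} {q : Vec n} (hq : q ∈ V)
    {p : Vec n → Prop} (hp : ∀ᶠ v in 𝓝 (0 : Vec n), v ∈ V → p (q + v))
    {B : Set (Submodule ℝ (Vec n))} (hB : B.Finite) (hBV : ∀ W ∈ B, ¬ V ≤ W) :
    ∃ u ∈ V, p u ∧ ∀ W ∈ B, u ∉ W := by
  obtain ⟨r, hr, hball⟩ := Metric.eventually_nhds_iff_ball.1 hp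
  obtain ⟨u, hu, hugen⟩ := exists_mem_open_notMem_submodules
    (Metric.isOpen_ball (x := (⟨q, hq⟩ : V)) (ε := r)) ⟨_, Metric.mem_ball_self hr⟩
    (hB.image fun W => W.comap V.subtype) (by
      rintro _ ⟨W, hW, rfl⟩ htop
      exact hBV W hW (by rwa [Submodule.comap_subtype_eq_top] at htop))
  refine ⟨u, u.2, ?_, fun W hW hmem => hugen _ ⟨W, hW, rfl⟩ hmem⟩
  have := hball (u - q) (by
    rw [mem_ball_zero_iff, ← dist_eq_norm]
    exact hu) (V.sub_mem u.2 hq)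
  simpa using this

/-- The upper bound holds since the set is covered by the pieces `poly D ∩ P`, with `dir D ⊓ V` of
dimension `k`. For the lower bound take `L ≤ V`: the cones `tcone D x ∩ V` cover `V` modulo `L`, so
for one `D` the span of this cone together with `L` contains `V`, and `dim V - dim L = k`. -/
theorem isEmptyOrPureDim_stableIntersection
    (hd : ∀ H ∈ F, finrank ℝ (dir H) = d) (hmax : MaxPrinciple F d)
    (hP : RelOpenPresentation P V J Q) {k : ℤ} (hk : (finrank ℝ V : ℤ) + d = n + k) :
    IsEmptyOrPureDim k (stableIntersection (support F) P) := by
  intro x hx U hU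
  obtain ⟨hxP, C, hC, hxC, hCV⟩ := (mem_stableIntersection_iff hd hmax hP).1 hx
  have hj : ∀ D ∈ F, dir D ⊔ V = ⊤ → (finrank ℝ (dir D ⊓ V : Submodule ℝ (Vec n)) : ℤ) = k := by
    intro D hD hDV
    have := finrank_inf_of_sup_eq_top hDV
    rw [hd D hD] at this
    omega
  refine ⟨finrank ℝ (dir C ⊓ V : Submodule ℝ (Vec n)), hj C hC hCV, le_antisymm ?_ ?_⟩
  · refine dimH_le_of_subset_biUnion (I := {D ∈ (F : Set (Finset (Vec n × ℝ))) | dir D ⊔ V = ⊤})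
      (A := fun D => poly D ∩ P) (F.finite_toSet.subset (sep_subset _ _)) ?_ ?_
    · rintro y ⟨hy, -⟩
      obtain ⟨hyP, D, hD, hyD, hDV⟩ := (mem_stableIntersection_iff hd hmax hP).1 hy
      exact mem_biUnion (x := D) ⟨hD, hDV⟩ ⟨hyD, hyP⟩
    · rintro D ⟨hD, hDV⟩ -
      refine ⟨dir D ⊓ V, ?_, fun p hp q hq =>
        ⟨sub_mem_dir hp.1 hq.1, hP.sub_mem hp.2 (subset_closure hq.2)⟩⟩
      have h1 := hj D hD hDV
      have h2 := hj C hC hCV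
      omega
  · obtain ⟨L, hLV, hCL⟩ := exists_isCompl_le hCV
    have hL : d + finrank ℝ L = n := hd C hC ▸ finrank_add_of_isCompl hCL
    let E : Finset (Vec n × ℝ) → Set (Vec n) := fun D => tcone D x ∩ V
    obtain ⟨D, hD, hxD, hDL, hVle⟩ : ∃ D ∈ F, x ∈ poly D ∧ IsCompl (dir D) L ∧
        V ≤ Submodule.span ℝ (E D) ⊔ L := by
      by_contra! hcon
      obtain ⟨u, huV, -, hugen⟩ := exists_mem_subspace_notMem V.zero_mem (p := fun _ => True)
        (Eventually.of_forall fun _ _ => trivial)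
        (B := (fun D => Submodule.span ℝ (E D) ⊔ L) ''
          {D ∈ (F : Set (Finset (Vec n × ℝ))) | x ∈ poly D ∧ IsCompl (dir D) L})
        ((F.finite_toSet.subset (sep_subset _ _)).image _) (by
          rintro _ ⟨D, ⟨hD, hxD, hDL⟩, rfl⟩
          exact hcon D hD hxD hDL)
      obtain ⟨D, hD, hxD, hDL, t, ht, hl⟩ := exists_tcone_sub_mem hd hmax hC hxC hCL u
      refine hugen _ ⟨D, ⟨hD, hxD, hDL⟩, rfl⟩ ?_
      rw [← add_sub_cancel t u]
      exact Submodule.add_mem_sup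
        (Submodule.subset_span ⟨ht, (Submodule.sub_mem_iff_right _ huV).1 (hLV hl)⟩) hl
    have h1 : finrank ℝ (dir C ⊓ V : Submodule ℝ (Vec n)) ≤ finrank ℝ (Submodule.span ℝ (E D)) := by
      have h2 := Submodule.finrank_mono hVle
      have h3 := Submodule.finrank_add_le_finrank_add_finrank (Submodule.span ℝ (E D)) L
      have h4 := hj C hC hCV
      omega
    refine le_trans (by exact_mod_cast h1) (finrank_span_le_dimH (E := E D)
      ((convex_tcone D x).inter V.convex) ⟨zero_mem_tcone, V.zero_mem⟩
      (fun v hv s hs => ⟨smul_mem_tcone hs hv.1, V.smul_mem s hv.2⟩) ?_ hU)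
    filter_upwards [eventually_mem_poly D x, hP.eventually_add_mem hxP] with v hv1 hv2 hvE
    refine (mem_stableIntersection_iff hd hmax hP).2 ⟨hv2 hvE.2, D, hD, hv1.2 ⟨hxD, hvE.1⟩, ?_⟩
    rw [eq_top_iff, ← hDL.sup_eq_top]
    exact sup_le_sup_left hLV _

/-! ### The intersection with the boundary of `P`. -/

theorem exists_cell_of_mem_closure
    (hd : ∀ H ∈ F, finrank ℝ (dir H) = d) (hmax : MaxPrinciple F d)
    (hP : RelOpenPresentation P V J Q) {x : Vec n}
    (hx : x ∈ closure (stableIntersection (support F) P)) :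
    ∃ C ∈ F, dir C ⊔ V = ⊤ ∧ (∃ c, c ∈ poly C ∩ P) ∧ x ∈ poly C ∩ closure P := by
  have hsub : stableIntersection (support F) P ⊆
      ⋃ C ∈ {D ∈ (F : Set (Finset (Vec n × ℝ))) | dir D ⊔ V = ⊤}, poly C ∩ P := by
    intro y hy
    obtain ⟨hyP, D, hD, hyD, hDV⟩ := (mem_stableIntersection_iff hd hmax hP).1 hy
    exact mem_biUnion (x := D) ⟨hD, hDV⟩ ⟨hyD, hyP⟩
  have h1 := closure_mono hsub hx
  rw [(F.finite_toSet.subset (sep_subset _ _)).closure_biUnion] at h1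
  obtain ⟨C, ⟨hC, hCV⟩, hxC⟩ := mem_iUnion₂.1 h1
  refine ⟨C, hC, hCV, closure_nonempty_iff.1 ⟨x, hxC⟩, ?_⟩
  have h2 := closure_inter_subset_inter_closure _ _ hxC
  rwa [(isClosed_poly C).closure_eq] at h2

theorem mem_closure_stableIntersection
    (hd : ∀ H ∈ F, finrank ℝ (dir H) = d) (hmax : MaxPrinciple F d)
    (hP : RelOpenPresentation P V J Q) {D : Finset (Vec n × ℝ)} (hD : D ∈ F)
    (hDV : dir D ⊔ V = ⊤) {c y : Vec n} (hc : c ∈ poly D ∩ P) (hy : y ∈ poly D ∩ closure P) :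
    y ∈ closure (stableIntersection (support F) P) :=
  closure_mono (fun _ hz => (mem_stableIntersection_iff hd hmax hP).2 ⟨hz.2, D, hD, hz.1, hDV⟩)
    (hP.mem_closure_inter hc hy)

theorem RelOpenPresentation.exists_eq_of_notMem (hP : RelOpenPresentation P V J Q) {c x : Vec n}
    (hc : c ∈ P) (hx : x ∈ closure P) (hxP : x ∉ P) : ∃ h ∈ J, inner ℝ h.1 x = h.2 := by
  by_contra! hcon
  obtain ⟨h1, h2⟩ := (hP.mem_closure_iff c hc x).1 hx
  exact hxP ((hP.mem_iff c hc x).2 ⟨h1, fun h hh => lt_of_le_of_ne (h2 h hh) (hcon h hh)⟩)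

/-- The tangent cone of `P` at a boundary point, with its relative interior: small vectors. -/
theorem RelOpenPresentation.eventually_mem_closure (hP : RelOpenPresentation P V J Q) {c x : Vec n}
    (hc : c ∈ P) (hx : x ∈ closure P) :
    ∀ᶠ v in 𝓝 (0 : Vec n), v ∈ V →
      (v ∈ tcone J x → x + v ∈ closure P) ∧
      ((∀ h ∈ J, inner ℝ h.1 x = h.2 → inner ℝ h.1 v < 0) → x + v ∈ P) := by
  obtain ⟨hxV, hxJ⟩ := (hP.mem_closure_iff c hc x).1 hx
  filter_upwards [eventually_mem_poly J x, eventually_side J x] with v hv1 hv2 hvV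
  have hmem : x + v - c ∈ V := by
    rw [show x + v - c = (x - c) + v by abel]
    exact V.add_mem hxV hvV
  refine ⟨fun ht => (hP.mem_closure_iff c hc _).2 ⟨hmem, hv1.2 ⟨hxJ, ht⟩⟩, fun ht => ?_⟩
  refine (hP.mem_iff c hc _).2 ⟨hmem, fun h hh => ?_⟩
  rcases (hxJ h hh).lt_or_eq with hlt | heq
  · exact (hv2 h hh).1 hlt
  · rw [inner_add_right, heq]
    linarith [ht h hh heq]

/-- A boundary point lies on a transversal cell that meets `P`, and on a hyperplane of some `h ∈ J`.
The hyperplane misses the points of the cell in `P`, so it cuts the dimension `k + 1` of `dir C ⊓ V`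
by at least one. -/
theorem dimH_closure_inter_frontier_le
    (hd : ∀ H ∈ F, finrank ℝ (dir H) = d) (hmax : MaxPrinciple F d)
    (hP : RelOpenPresentation P V J Q) {k : ℕ} (hk : finrank ℝ V + d = n + (k + 1)) :
    dimH (closure (stableIntersection (support F) P) ∩ intrinsicFrontier ℝ P) ≤ k := by
  rw [hP.frontier_eq]
  refine dimH_le_of_subset_biUnion
    (I := {i ∈ (F : Set (Finset (Vec n × ℝ))) ×ˢ (J : Set (Vec n × ℝ)) |
      dir i.1 ⊔ V = ⊤ ∧ ∃ c, c ∈ poly i.1 ∩ P})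
    (A := fun i => {y | (y ∈ poly i.1 ∩ closure P) ∧ inner ℝ i.2.1 y = i.2.2})
    ((F.finite_toSet.prod J.finite_toSet).subset (sep_subset _ _)) ?_ ?_
  · rintro y ⟨hy, hyP, hyP'⟩
    obtain ⟨C, hC, hCV, ⟨c, hc⟩, hyC⟩ := exists_cell_of_mem_closure hd hmax hP hy
    obtain ⟨h, hh, hact⟩ := hP.exists_eq_of_notMem hc.2 hyP hyP'
    exact mem_biUnion (x := (C, h)) ⟨⟨hC, hh⟩, hCV, c, hc⟩ ⟨hyC, hact⟩
  · rintro ⟨C, h⟩ ⟨⟨hC, hh⟩, hCV, c, hc⟩ ⟨y, hy, hact⟩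
    have hC : C ∈ F := hC
    have hh : h ∈ J := hh
    have hCV : dir C ⊔ V = ⊤ := hCV
    have hc : c ∈ poly C ∩ P := hc
    have hy : y ∈ poly C ∩ closure P := hy
    have hact : inner ℝ h.1 y = h.2 := hact
    refine ⟨(dir C ⊓ V) ⊓ (ℝ ∙ h.1)ᗮ, ?_, ?_⟩
    · have hlt : (dir C ⊓ V) ⊓ (ℝ ∙ h.1)ᗮ < dir C ⊓ V := by
        refine lt_of_le_of_ne inf_le_left fun heq => ?_
        have hmem : y - c ∈ (dir C ⊓ V) ⊓ (ℝ ∙ h.1)ᗮ := by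
          rw [heq]
          exact ⟨sub_mem_dir hc.1 hy.1, hP.sub_mem hc.2 hy.2⟩
        have h1 := Submodule.mem_orthogonal_singleton_iff_inner_right.1 hmem.2
        rw [inner_sub_right, hact] at h1
        linarith [hP.lt hc.2 h hh]
      have h2 := Submodule.finrank_lt_finrank_of_lt hlt
      have h3 := finrank_inf_of_sup_eq_top hCV
      rw [hd C hC] at h3
      omega
    · rintro p ⟨hp, hpa⟩ q ⟨hq, hqa⟩
      have hpa : inner ℝ h.1 p = h.2 := hpa
      have hqa : inner ℝ h.1 q = h.2 := hqa
      refine ⟨⟨sub_mem_dir hp.1 hq.1, ?_⟩,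
        Submodule.mem_orthogonal_singleton_iff_inner_right.2 ?_⟩
      · rw [show q - p = (q - c) - (p - c) by abel]
        exact V.sub_mem (hP.sub_mem hc.2 hq.2) (hP.sub_mem hc.2 hp.2)
      · rw [inner_sub_right, hpa, hqa, sub_self]

/-- A first-hit argument inside `V`, with `W` the tangent cone of `P` at `x` and `W₀` its relative
interior. Since `L` lies in a supporting hyperplane, `-q` is not in `W + L`, where `q` points from
`x` into `P`. Points of `K` over `W₀` are interior to `K` relative to `V`, so the first point of `K`
on the way from `-q` to a generic `u` lies over a facet of `W`. Genericity makes the face of the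
cell cone there of dimension at least `k`, and small vectors of this face lead to points of the
closure on the boundary. -/
theorem le_dimH_closure_inter_frontier
    (hd : ∀ H ∈ F, finrank ℝ (dir H) = d) (hmax : MaxPrinciple F d)
    (hP : RelOpenPresentation P V J Q) {k : ℕ} (hk : finrank ℝ V + d = n + (k + 1)) {x : Vec n}
    (hx : x ∈ closure (stableIntersection (support F) P) ∩ intrinsicFrontier ℝ P) {U : Set (Vec n)}
    (hU : U ∈ 𝓝 x) :
    (k : ENNReal) ≤ dimH ((closure (stableIntersection (support F) P) ∩ intrinsicFrontier ℝ P) ∩ U) := by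
  obtain ⟨hxS, hxfr⟩ := hx
  rw [hP.frontier_eq] at hxfr
  obtain ⟨C, hC, hCV, ⟨c, hcC, hcP⟩, hxC, -⟩ := exists_cell_of_mem_closure hd hmax hP hxS
  obtain ⟨h₀, hh₀, hact₀⟩ := hP.exists_eq_of_notMem hcP hxfr.1 hxfr.2
  set q := c - x with hq
  have hqV : q ∈ V := by
    rw [hq, ← neg_sub]
    exact V.neg_mem (hP.sub_mem hcP hxfr.1)
  have hqC : q ∈ tcone C x := sub_mem_tcone hcC
  have hqJ : ∀ h ∈ J, inner ℝ h.1 x = h.2 → inner ℝ h.1 q < 0 := by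
    intro h hh hact
    rw [hq, inner_sub_right, hact]
    linarith [hP.lt hcP h hh]
  have hq0 := hqJ h₀ hh₀ hact₀
  -- a complement of the cell inside a supporting hyperplane of `P`
  have hker : dir C ⊔ (V ⊓ (ℝ ∙ h₀.1)ᗮ) = ⊤ := by
    rw [eq_top_iff, ← hCV]
    refine sup_le le_sup_left fun v hv => ?_
    have hsplit : v = (inner ℝ h₀.1 v / inner ℝ h₀.1 q) • q +
        (v - (inner ℝ h₀.1 v / inner ℝ h₀.1 q) • q) := by abel
    rw [hsplit]
    refine Submodule.add_mem_sup (Submodule.smul_mem _ _ (tcone_subset_dir hxC hqC))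
      ⟨V.sub_mem hv (V.smul_mem _ hqV), Submodule.mem_orthogonal_singleton_iff_inner_right.2 ?_⟩
    rw [inner_sub_right, inner_smul_right, div_mul_cancel₀ _ hq0.ne, sub_self]
  obtain ⟨L, hLle, hCL⟩ := exists_isCompl_le hker
  have hLV : L ≤ V := hLle.trans inf_le_left
  have hL0 : ∀ l ∈ L, inner ℝ h₀.1 l = 0 := fun l hl =>
    Submodule.mem_orthogonal_singleton_iff_inner_right.1 (hLle hl).2
  have hLd : d + finrank ℝ L = n := hd C hC ▸ finrank_add_of_isCompl hCL
  have htrans : ∀ D, IsCompl (dir D) L → dir D ⊔ V = ⊤ := fun D hDL => by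
    rw [eq_top_iff, ← hDL.sup_eq_top]
    exact sup_le_sup_left hLV _
  let W : Set (Vec n) := {v | v ∈ V ∧ v ∈ tcone J x}
  let W₀ : Set (Vec n) := {v | v ∈ V ∧ ∀ h ∈ J, inner ℝ h.1 x = h.2 → inner ℝ h.1 v < 0}
  have hW₀W : W₀ ⊆ W := fun v hv => ⟨hv.1, fun h hh hact => (hv.2 h hh hact).le⟩
  have hW₀open : ∀ p ∈ W₀, ∀ᶠ v in 𝓝 (0 : Vec n), v ∈ V → p + v ∈ W₀ := by
    intro p hp
    have h1 : ∀ᶠ v in 𝓝 (0 : Vec n), ∀ h ∈ J, inner ℝ h.1 x = h.2 → inner ℝ h.1 (p + v) < 0 := by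
      rw [eventually_all_finset]
      intro h hh
      by_cases hact : inner ℝ h.1 x = h.2
      · have ht : Tendsto (fun v : Vec n => (inner ℝ h.1 (p + v) : ℝ)) (𝓝 0)
            (𝓝 (inner ℝ h.1 p)) := by
          have : Continuous (fun v : Vec n => (inner ℝ h.1 (p + v) : ℝ)) := by fun_prop
          simpa using this.tendsto 0
        filter_upwards [ht.eventually (gt_mem_nhds (hp.2 h hh hact))] with v hv _ using hv
      · exact Eventually.of_forall fun _ h' => absurd h' hact
    filter_upwards [h1] with v hv hvV using ⟨V.add_mem hp.1 hvV, hv⟩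
  -- Cells whose cone meets `W₀` contain points of `P` near `x`; this is needed for their boundary
  -- points to lie in the closure of the stable intersection.
  let G : Set (Finset (Vec n × ℝ)) :=
    {D | D ∈ F ∧ x ∈ poly D ∧ IsCompl (dir D) L ∧ ∃ t ∈ tcone D x, t ∈ W₀}
  have hGfin : G.Finite := F.finite_toSet.subset fun D h => h.1
  let K : Set (Vec n) := ⋃ D ∈ G, {y | ∃ t ∈ tcone D x ∩ W, y - t ∈ L}
  have hWcl : IsClosed W := (V.closed_of_finiteDimensional).inter (isClosed_tcone J x)
  have hK : IsClosed K := hGfin.isClosed_biUnion fun D hD =>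
    isClosed_add hD.2.2.1 (fun t ht => tcone_subset_dir hD.2.1 ht.1)
      ((isClosed_tcone D x).inter hWcl)
  have hzK : -q ∉ K := by
    intro hmem
    obtain ⟨D, -, t, ⟨-, ht⟩, hl⟩ := mem_iUnion₂.1 hmem
    have h1 := hL0 _ hl
    rw [inner_sub_right, inner_neg_right] at h1
    linarith [ht.2 h₀ hh₀ hact₀]
  -- points over the relative interior of the cone of `P` are interior
  have hint : ∀ D ∈ G, ∀ p ∈ tcone D x, p ∈ W₀ → ∀ᶠ v in 𝓝 (0 : Vec n), v ∈ V →
      ∀ y, y - p ∈ L → y + v ∈ K := by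
    intro D hD p hpD hpW
    have hev : ∀ᶠ s in 𝓝[>] (0 : ℝ), (0 < s) ∧
        (∀ H ∈ F, p ∈ tcone H x → ∀ᶠ w in 𝓝 (0 : Vec n),
          (p + w ∈ tcone H x ↔ w ∈ tcone H (x + s • p))) ∧
        (∀ H ∈ F, (x + s • p ∈ poly H ↔ x ∈ poly H ∧ s • p ∈ tcone H x)) := by
      refine Filter.Eventually.and self_mem_nhdsWithin (Filter.Eventually.and ?_ ?_)
      · rw [eventually_all_finset]
        exact fun H _ => eventually_tcone_add H x p
      · exact ((tendsto_smul_zero p).eventually (eventually_mem_poly_imp F x)).filter_mono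
          nhdsWithin_le_nhds
    obtain ⟨s, hs0, hst, hsp⟩ := hev.exists
    have hq : ∀ H ∈ F, ∀ᶠ t in 𝓝 (0 : Vec n), (p ∈ tcone H x →
        (p + t ∈ tcone H x ↔ t ∈ tcone H (x + s • p))) ∧ (t ∈ V → p + t ∈ W₀) := by
      intro H hH
      refine Filter.Eventually.and ?_ (hW₀open p hpW)
      by_cases hpH : p ∈ tcone H x
      · filter_upwards [hst H hH hpH] with t ht _ using ht
      · exact Eventually.of_forall fun _ h' => absurd h' hpH
    filter_upwards [eventually_exists_tcone_sub_mem hd hmax hD.1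
      ((hsp D hD.1).2 ⟨hD.2.1, smul_mem_tcone hs0.le hpD⟩) hD.2.2.1 hq] with v hv hvV y hy
    obtain ⟨D', hD', hxD', hD'L, t, ht, hl, ht1, ht2⟩ := hv
    obtain ⟨hxD'', hspt⟩ := (hsp D' hD').1 hxD'
    have hpD' : p ∈ tcone D' x := by
      have := smul_mem_tcone (inv_nonneg.2 hs0.le) hspt
      rwa [smul_smul, inv_mul_cancel₀ hs0.ne', one_smul] at this
    have htV : t ∈ V := (Submodule.sub_mem_iff_right _ hvV).1 (hLV hl)
    have hptD' := (ht1 hpD').2 ht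
    refine mem_biUnion (x := D') ⟨hD', hxD'', hD'L, p + t, hptD', ht2 htV⟩
      ⟨p + t, ⟨hptD', hW₀W (ht2 htV)⟩, ?_⟩
    rw [show y + v - (p + t) = (y - p) + (v - t) by abel]
    exact L.add_mem hy hl
  let E : Finset (Vec n × ℝ) → Vec n × ℝ → Set (Vec n) := fun D h =>
    (tcone D x ∩ W) ∩ {v | inner ℝ h.1 v = 0}
  obtain ⟨u, huV, huK, hugen⟩ := exists_mem_subspace_notMem hqV (p := fun u => u ∈ K)
    (by
      filter_upwards [hint C ⟨hC, hxC, hCL, q, hqC, hqV, hqJ⟩ q hqC ⟨hqV, hqJ⟩] with v hv hvV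
      exact hv hvV q (by simp))
    -- Each has dimension at most `1 + (k - 1) + (n - d)`, one less than that of `V`.
    (B := (fun i : Finset (Vec n × ℝ) × (Vec n × ℝ) =>
      (ℝ ∙ (-q)) ⊔ (Submodule.span ℝ (E i.1 i.2) ⊔ L)) ''
      {i ∈ (F : Set (Finset (Vec n × ℝ))) ×ˢ (J : Set (Vec n × ℝ)) |
        finrank ℝ (Submodule.span ℝ (E i.1 i.2)) < k})
    (((F.finite_toSet.prod J.finite_toSet).subset (sep_subset _ _)).image _) (by
      rintro _ ⟨⟨D, h⟩, ⟨-, hlt⟩, rfl⟩ hle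
      have hlt : finrank ℝ (Submodule.span ℝ (E D h)) < k := hlt
      have h0 := Submodule.finrank_mono hle
      have h1 := Submodule.finrank_add_le_finrank_add_finrank (ℝ ∙ (-q))
        (Submodule.span ℝ (E D h) ⊔ L)
      have h2 := Submodule.finrank_add_le_finrank_add_finrank (Submodule.span ℝ (E D h)) L
      have h3 : finrank ℝ (ℝ ∙ (-q)) ≤ 1 := (finrank_span_le_card {-q}).trans (by simp)
      change finrank ℝ V ≤ finrank ℝ ((ℝ ∙ (-q)) ⊔ (Submodule.span ℝ (E D h) ⊔ L) :
        Submodule ℝ (Vec n)) at h0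
      omega)
  obtain ⟨t, ht0, htK, htmin⟩ := exists_first_mem hK hzK huK
  set y := -q + t • (u - -q) with hy
  obtain ⟨D, hDG, p, ⟨hpD, hpW⟩, hypL⟩ := mem_iUnion₂.1 htK
  obtain ⟨hDF, hxD, hDL, t₀, ht₀D, ht₀W⟩ := id hDG
  have hpW₀ : p ∉ W₀ := by
    intro hpW₀
    have h1 : ∀ᶠ a in 𝓝[>] (0 : ℝ), a • (-q - u) ∈ V →
        ∀ y, y - p ∈ L → y + a • (-q - u) ∈ K :=
      ((tendsto_smul_zero (-q - u)).eventually (hint D hDG p hpD hpW₀)).filter_mono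
        nhdsWithin_le_nhds
    have h2 : ∀ᶠ a in 𝓝[>] (0 : ℝ), a < t := (gt_mem_nhds ht0).filter_mono nhdsWithin_le_nhds
    obtain ⟨a, ⟨ha1, ha2⟩, ha0⟩ := ((h1.and h2).and self_mem_nhdsWithin).exists
    have ha0 : 0 < a := ha0
    refine htmin (t - a) (by linarith) (by linarith) ?_
    have := ha1 (V.smul_mem _ (V.sub_mem (V.neg_mem hqV) huV)) y hypL
    convert this using 1
    rw [hy]; module
  obtain ⟨h, hh, hact, hph⟩ : ∃ h ∈ J, inner ℝ h.1 x = h.2 ∧ inner ℝ h.1 p = 0 := by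
    by_contra! hcon
    exact hpW₀ ⟨hpW.1, fun h hh hact => lt_of_le_of_ne (hpW.2 h hh hact) (hcon h hh hact)⟩
  have hfin : k ≤ finrank ℝ (Submodule.span ℝ (E D h)) := by
    by_contra! hlt
    refine hugen _ ⟨(D, h), ⟨⟨hDF, hh⟩, hlt⟩, rfl⟩ ?_
    have hyW : y ∈ Submodule.span ℝ (E D h) ⊔ L := by
      rw [← add_sub_cancel p y]
      exact Submodule.add_mem_sup (Submodule.subset_span ⟨⟨hpD, hpW⟩, hph⟩) hypL
    have : u = (1 - t⁻¹) • (-q) + t⁻¹ • y := by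
      rw [hy, smul_add, smul_smul, inv_mul_cancel₀ ht0.ne']
      module
    rw [this]
    exact Submodule.add_mem_sup (Submodule.smul_mem _ _ (Submodule.mem_span_singleton_self (-q)))
      (Submodule.smul_mem _ _ hyW)
  refine le_trans (by exact_mod_cast hfin) (finrank_span_le_dimH (E := E D h) (x := x) ?_ ?_ ?_ ?_ hU)
  · refine ((convex_tcone D x).inter (V.convex.inter (convex_tcone J x))).inter ?_
    exact convex_hyperplane (innerSL ℝ h.1).isLinear 0
  · exact ⟨⟨zero_mem_tcone, V.zero_mem, zero_mem_tcone⟩, inner_zero_right _⟩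
  · rintro v ⟨⟨hv1, hv2, hv3⟩, hv4⟩ s hs
    refine ⟨⟨smul_mem_tcone hs hv1, V.smul_mem s hv2, smul_mem_tcone hs hv3⟩, ?_⟩
    have hv4 : inner ℝ h.1 v = 0 := hv4
    simp [inner_smul_right, hv4]
  · obtain ⟨s, hs, hs1, hs2⟩ := exists_pos_smul
      ((eventually_mem_poly D x).and (hP.eventually_mem_closure hcP hxfr.1)) t₀
    have hc' : x + s • t₀ ∈ poly D ∩ P := by
      refine ⟨hs1.2 ⟨hxD, smul_mem_tcone hs.le ht₀D⟩, (hs2 (V.smul_mem s ht₀W.1)).2 ?_⟩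
      intro h hh hact
      rw [inner_smul_right]
      exact mul_neg_of_pos_of_neg hs (ht₀W.2 h hh hact)
    filter_upwards [eventually_mem_poly D x, hP.eventually_mem_closure hcP hxfr.1] with v hv1 hv2 hvE
    obtain ⟨⟨hvD, hvV, hvJ⟩, hvh⟩ := hvE
    have hvh : inner ℝ h.1 v = 0 := hvh
    have hcl := (hv2 hvV).1 hvJ
    refine ⟨mem_closure_stableIntersection hd hmax hP hDF (htrans D hDL) hc'
      ⟨hv1.2 ⟨hxD, hvD⟩, hcl⟩, ?_⟩
    rw [hP.frontier_eq]
    refine ⟨hcl, fun hmem => ?_⟩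
    have := hP.lt hmem h hh
    rw [inner_add_right, hact, hvh, add_zero] at this
    exact this.ne rfl

theorem isEmptyOrPureDim_closure_inter_frontier
    (hd : ∀ H ∈ F, finrank ℝ (dir H) = d) (hmax : MaxPrinciple F d)
    (hP : RelOpenPresentation P V J Q) {k : ℤ} (hk : (finrank ℝ V : ℤ) + d = n + k) :
    IsEmptyOrPureDim (k - 1)
      (closure (stableIntersection (support F) P) ∩ intrinsicFrontier ℝ P) := by
  intro x hx U hU
  obtain ⟨C, hC, hCV, ⟨c, hcC, hcP⟩, hxC, hxcl⟩ := exists_cell_of_mem_closure hd hmax hP hx.1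
  have h1 := finrank_inf_of_sup_eq_top hCV
  rw [hd C hC] at h1
  -- This space has dimension `k` and contains the nonzero vector from a point of `P` to the
  -- boundary point `x`; hence `k - 1` is a natural number.
  have hne : dir C ⊓ V ≠ ⊥ := by
    intro hbot
    have hmem : x - c ∈ dir C ⊓ V := ⟨sub_mem_dir hcC hxC, hP.sub_mem hcP hxcl⟩
    rw [hbot, Submodule.mem_bot, sub_eq_zero] at hmem
    have h2 := hx.2
    rw [hP.frontier_eq, hmem] at h2
    exact h2.2 hcP
  have hpos : 0 < finrank ℝ (dir C ⊓ V : Submodule ℝ (Vec n)) :=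
    Nat.pos_of_ne_zero fun h => hne (Submodule.finrank_eq_zero.1 h)
  obtain ⟨j, hj⟩ : ∃ j : ℕ, (j : ℤ) = k - 1 := ⟨(k - 1).toNat, by omega⟩
  have hj' : finrank ℝ V + d = n + (j + 1) := by omega
  exact ⟨j, hj, le_antisymm
    ((dimH_mono inter_subset_left).trans (dimH_closure_inter_frontier_le hd hmax hP hj'))
    (le_dimH_closure_inter_frontier hd hmax hP hj' hx hU)⟩

/-! ### Connected components of the stable intersection. -/

theorem cell_subset_component
    (hd : ∀ H ∈ F, finrank ℝ (dir H) = d) (hmax : MaxPrinciple F d)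
    (hP : RelOpenPresentation P V J Q) {D : Finset (Vec n × ℝ)} (hD : D ∈ F)
    (hDV : dir D ⊔ V = ⊤) {x y : Vec n} (hy : y ∈ poly D ∩ P)
    (hyx : y ∈ connectedComponentIn (stableIntersection (support F) P) x) :
    poly D ∩ P ⊆ connectedComponentIn (stableIntersection (support F) P) x := by
  rw [connectedComponentIn_eq hyx]
  exact ((convex_poly D).inter hP.convex).isPreconnected.subset_connectedComponentIn hy
    fun z hz => (mem_stableIntersection_iff hd hmax hP).2 ⟨hz.2, D, hD, hz.1, hDV⟩

/-- A functional that attains its maximum on a connected component is constant on it. -/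
theorem eq_of_isMaxOn_component
    (hd : ∀ H ∈ F, finrank ℝ (dir H) = d) (hmax : MaxPrinciple F d)
    (hP : RelOpenPresentation P V J Q) {a x p : Vec n}
    (hp : p ∈ connectedComponentIn (stableIntersection (support F) P) x)
    (hpmax : ∀ y ∈ connectedComponentIn (stableIntersection (support F) P) x,
      inner ℝ a y ≤ inner ℝ a p) :
    ∀ y ∈ connectedComponentIn (stableIntersection (support F) P) x,
      inner ℝ a y = inner ℝ a p := by
  set S₀ := connectedComponentIn (stableIntersection (support F) P) x with hS₀
  -- The maximum locus is open in the component. If `a` changed along a cell in direction `v`, take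
  -- `L ≤ V ⊓ (ℝ ∙ a)ᗮ` and cover `⟪a, v⟫ • v` modulo `L`: the resulting cone vector `t ∈ V` has
  -- `⟪a, t⟫ = ⟪a, v⟫ ^ 2 > 0`, whatever the sign of the change, and leads above the maximum inside
  -- the component.
  have hloc : ∀ y ∈ S₀, inner ℝ a y = inner ℝ a p →
      ∀ᶠ v in 𝓝 (0 : Vec n), y + v ∈ S₀ → inner ℝ a (y + v) = inner ℝ a p := by
    intro y hy hya
    have hyP := ((mem_stableIntersection_iff hd hmax hP).1 (connectedComponentIn_subset _ _ hy)).1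
    filter_upwards [eventually_mem_poly_imp F y] with v hv hvS
    obtain ⟨hvP, D, hD, hvD, hDV⟩ :=
      (mem_stableIntersection_iff hd hmax hP).1 (connectedComponentIn_subset _ _ hvS)
    have hyD := ((hv D hD).1 hvD).1
    have hvV : v ∈ V := by simpa using hP.sub_mem hyP (subset_closure hvP)
    have hvdir : v ∈ dir D := tcone_subset_dir hyD ((hv D hD).1 hvD).2
    by_contra hne
    have hav : inner ℝ a v ≠ 0 := by
      intro h0
      exact hne (by rw [inner_add_right, hya, h0, add_zero])
    have hker : dir D ⊔ (V ⊓ (ℝ ∙ a)ᗮ) = ⊤ := by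
      rw [eq_top_iff, ← hDV]
      refine sup_le le_sup_left fun w hw => ?_
      have hsplit : w = (inner ℝ a w / inner ℝ a v) • v +
          (w - (inner ℝ a w / inner ℝ a v) • v) := by abel
      rw [hsplit]
      refine Submodule.add_mem_sup (Submodule.smul_mem _ _ hvdir)
        ⟨V.sub_mem hw (V.smul_mem _ hvV), Submodule.mem_orthogonal_singleton_iff_inner_right.2 ?_⟩
      rw [inner_sub_right, inner_smul_right, div_mul_cancel₀ _ hav, sub_self]
    obtain ⟨L, hLle, hDL⟩ := exists_isCompl_le hker
    have hLV : L ≤ V := hLle.trans inf_le_left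
    obtain ⟨D', hD', hyD', hD'L, t, ht, hl⟩ :=
      exists_tcone_sub_mem hd hmax hD hyD hDL ((inner ℝ a v) • v)
    have hta : 0 < inner ℝ a t := by
      have h1 := Submodule.mem_orthogonal_singleton_iff_inner_right.1 (hLle hl).2
      rw [inner_sub_right, inner_smul_right, sub_eq_zero] at h1
      rw [← h1]
      exact mul_self_pos.2 hav
    have htV : t ∈ V := (Submodule.sub_mem_iff_right _ (V.smul_mem _ hvV)).1 (hLV hl)
    obtain ⟨s, hs, hs1, hs2⟩ := exists_pos_smul
      ((eventually_mem_poly D' y).and (hP.eventually_add_mem hyP)) t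
    have hD'V : dir D' ⊔ V = ⊤ := by
      rw [eq_top_iff, ← hD'L.sup_eq_top]
      exact sup_le_sup_left hLV _
    have hmem := cell_subset_component hd hmax hP hD' hD'V ⟨hyD', hyP⟩ hy
      ⟨hs1.2 ⟨hyD', smul_mem_tcone hs.le ht⟩, hs2 (V.smul_mem s htV)⟩
    have := hpmax _ hmem
    rw [inner_add_right, inner_smul_right, hya] at this
    nlinarith
  have hpre : PreconnectedSpace S₀ :=
    isPreconnected_iff_preconnectedSpace.1 isPreconnected_connectedComponentIn
  have hclopen : IsClopen {y : S₀ | inner ℝ a (y : Vec n) = inner ℝ a p} := by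
    refine ⟨isClosed_eq (by fun_prop) continuous_const, isOpen_iff_mem_nhds.2 ?_⟩
    rintro ⟨y, hy⟩ hya
    have ht : Tendsto (fun z : S₀ => (z : Vec n) - y) (𝓝 ⟨y, hy⟩) (𝓝 0) := by
      have : Continuous fun z : S₀ => (z : Vec n) - y := by fun_prop
      simpa using this.tendsto ⟨y, hy⟩
    filter_upwards [ht.eventually (hloc y hy hya)] with z hz
    have := hz (by simp)
    simpa using this
  intro y hy
  have : (⟨y, hy⟩ : S₀) ∈ {y : S₀ | inner ℝ a (y : Vec n) = inner ℝ a p} := by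
    rw [hclopen.eq_univ ⟨⟨p, hp⟩, rfl⟩]
    exact mem_univ _
  exact this

/-- Without boundary points, a transversal cell that meets `P` does so in a closed polyhedron, where
each inequality of `P` bounds its functional and the maximum is attained. Finitely many cells make
up a component, so each functional is maximal somewhere on it, hence constant, and the component
lies in a common level set inside `P`. Conversely, affine subspaces are closed, so a cell contained
in `M ⊆ P` has no limit point on the boundary. -/
theorem closure_inter_frontier_eq_empty_iff
    (hd : ∀ H ∈ F, finrank ℝ (dir H) = d) (hmax : MaxPrinciple F d)
    (hP : RelOpenPresentation P V J Q) :
    closure (stableIntersection (support F) P) ∩ intrinsicFrontier ℝ P = ∅ ↔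
      ∀ x ∈ stableIntersection (support F) P, ∃ M : AffineSubspace ℝ (Vec n),
        connectedComponentIn (stableIntersection (support F) P) x ⊆ (M : Set (Vec n)) ∧
        (M : Set (Vec n)) ⊆ P := by
  constructor
  · intro hempty x hx
    set S₀ := connectedComponentIn (stableIntersection (support F) P) x with hS₀
    have hxS₀ : x ∈ S₀ := mem_connectedComponentIn hx
    obtain ⟨hxP, C₀, hC₀, hxC₀, hC₀V⟩ := (mem_stableIntersection_iff hd hmax hP).1 hx
    have hcell : ∀ D ∈ F, dir D ⊔ V = ⊤ → ∀ c ∈ poly D ∩ P, poly D ∩ closure P ⊆ P := by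
      intro D hD hDV c hc y hy
      by_contra hyP
      have : y ∈ closure (stableIntersection (support F) P) ∩ intrinsicFrontier ℝ P :=
        ⟨mem_closure_stableIntersection hd hmax hP hD hDV hc hy, by
          rw [hP.frontier_eq]
          exact ⟨hy.2, hyP⟩⟩
      rw [hempty] at this
      exact this
    have hconst : ∀ h ∈ J, ∀ y ∈ S₀, inner ℝ h.1 y = inner ℝ h.1 x := by
      intro h hh
      classical
      let I : Set (Finset (Vec n × ℝ)) :=
        {D | D ∈ F ∧ dir D ⊔ V = ⊤ ∧ (poly D ∩ P ∩ S₀).Nonempty}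
      have hI : I.Finite := F.finite_toSet.subset fun D hD => hD.1
      have hattain : ∀ D ∈ I, ∃ p ∈ S₀, ∀ y ∈ poly D ∩ P, inner ℝ h.1 y ≤ inner ℝ h.1 p := by
        rintro D ⟨hD, hDV, c, hc, hcS⟩
        have hpoly : poly (D ∪ Q) = poly D ∩ P := by
          have h1 : poly (D ∪ Q) = poly D ∩ closure P := by
            rw [hP.closure_eq]
            ext y
            simp only [poly, Finset.mem_union, mem_inter_iff, Set.mem_ofPred_eq]
            exact ⟨fun hy => ⟨fun g hg => hy g (.inl hg), fun g hg => hy g (.inr hg)⟩,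
              fun hy g hg => hg.elim (hy.1 g) (hy.2 g)⟩
          rw [h1]
          exact subset_antisymm (fun y hy => ⟨hy.1, hcell D hD hDV c hc hy⟩)
            (inter_subset_inter_right _ subset_closure)
        obtain ⟨p, hp, hpm⟩ := exists_isMaxOn_poly (H := D ∪ Q) (a := h.1) (B := h.2)
          ⟨c, hpoly ▸ hc⟩ fun y hy => (hP.lt (hpoly ▸ hy : y ∈ poly D ∩ P).2 h hh).le
        rw [hpoly] at hp hpm
        exact ⟨p, cell_subset_component hd hmax hP hD hDV hc hcS hp, hpm⟩
      choose! g hgS hg using hattain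
      obtain ⟨D, hD, hDmax⟩ := exists_max_image I (fun D => inner ℝ h.1 (g D)) hI
        ⟨C₀, hC₀, hC₀V, x, ⟨hxC₀, hxP⟩, hxS₀⟩
      have hmaxS : ∀ y ∈ S₀, inner ℝ h.1 y ≤ inner ℝ h.1 (g D) := by
        intro y hy
        obtain ⟨hyP, D', hD', hyD', hD'V⟩ :=
          (mem_stableIntersection_iff hd hmax hP).1 (connectedComponentIn_subset _ _ hy)
        have hD'I : D' ∈ I := ⟨hD', hD'V, y, ⟨hyD', hyP⟩, hy⟩
        exact (hg D' hD'I y ⟨hyD', hyP⟩).trans (hDmax D' hD'I)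
      have h1 := eq_of_isMaxOn_component hd hmax hP (hgS D hD) hmaxS
      intro y hy
      rw [h1 y hy, h1 x hxS₀]
    let W : Submodule ℝ (Vec n) := V ⊓ ⨅ h ∈ J, (ℝ ∙ h.1)ᗮ
    have hW : ∀ v, v ∈ W ↔ v ∈ V ∧ ∀ h ∈ J, inner ℝ h.1 v = 0 := by
      intro v
      simp only [W, Submodule.mem_inf, Submodule.mem_iInf,
        Submodule.mem_orthogonal_singleton_iff_inner_right]
    refine ⟨AffineSubspace.mk' x W, fun y hy => ?_, fun y hy => ?_⟩
    · rw [SetLike.mem_coe, AffineSubspace.mem_mk', vsub_eq_sub, hW]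
      have hyP := ((mem_stableIntersection_iff hd hmax hP).1 (connectedComponentIn_subset _ _ hy)).1
      refine ⟨hP.sub_mem hxP (subset_closure hyP), fun h hh => ?_⟩
      rw [inner_sub_right, hconst h hh y hy, sub_self]
    · rw [SetLike.mem_coe, AffineSubspace.mem_mk', vsub_eq_sub, hW] at hy
      refine (hP.mem_iff x hxP y).2 ⟨hy.1, fun h hh => ?_⟩
      have := hy.2 h hh
      rw [inner_sub_right, sub_eq_zero] at this
      rw [this]
      exact hP.lt hxP h hh
  · intro hM
    rw [eq_empty_iff_forall_notMem]
    rintro y ⟨hyS, hyfr⟩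
    rw [hP.frontier_eq] at hyfr
    obtain ⟨C, hC, hCV, ⟨c, hc⟩, hyC⟩ := exists_cell_of_mem_closure hd hmax hP hyS
    have hcS : c ∈ stableIntersection (support F) P :=
      (mem_stableIntersection_iff hd hmax hP).2 ⟨hc.2, C, hC, hc.1, hCV⟩
    obtain ⟨M, hSM, hMP⟩ := hM c hcS
    have h1 := (cell_subset_component hd hmax hP hC hCV hc (mem_connectedComponentIn hcS)).trans hSM
    have h2 := closure_minimal h1 M.closed_of_finiteDimensional (hP.mem_closure_inter hc hyC)
    exact hyfr.2 (hMP h2)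

/-! ### Lattices and rational subspaces. -/

theorem inner_lattice {a x : Vec n} (ha : a ∈ lattice n) (hx : x ∈ lattice n) :
    ∃ k : ℤ, inner ℝ a x = k := by
  choose f hf using ha
  choose g hg using hx
  refine ⟨∑ i, g i * f i, ?_⟩
  simp [PiLp.inner_apply, hf, hg]

theorem zsmul_eq_smul (k : ℤ) (x : Vec n) : k • x = (k : ℝ) • x := (Int.cast_smul_eq_zsmul ℝ k x).symm

theorem int_smul_mem_lattice {a : Vec n} (ha : a ∈ lattice n) (k : ℤ) :
    (k : ℝ) • a ∈ lattice n := by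
  rw [← zsmul_eq_smul]
  exact (lattice n).zsmul_mem ha k

theorem isRationalSubspace_of_span {s : Set (Vec n)} (hs : ∀ x ∈ s, x ∈ lattice n) :
    IsRationalSubspace (Submodule.span ℝ s) := by
  refine le_antisymm (Submodule.span_le.2 fun x hx => hx.2) ?_
  exact Submodule.span_mono fun x hx => ⟨hs x hx, Submodule.subset_span hx⟩

theorem isRationalSubspace_top : IsRationalSubspace (⊤ : Submodule ℝ (Vec n)) := by
  have h := (EuclideanSpace.basisFun (Fin n) ℝ).toBasis.span_eq
  rw [← h]
  refine isRationalSubspace_of_span ?_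
  rintro _ ⟨i, rfl⟩ j
  by_cases hij : j = i
  · exact ⟨1, by simp [hij]⟩
  · exact ⟨0, by simp [hij]⟩

/-- If `⟪a, e⟫ ≠ 0` for a lattice vector `e` of `W`, the map `x ↦ ⟪a, e⟫ • x - ⟪a, x⟫ • e` sends
lattice vectors of `W` to lattice vectors of `W ⊓ (ℝ ∙ a)ᗮ`, and on the latter it is multiplication
by a nonzero number. -/
theorem IsRationalSubspace.inf_orthogonal {W : Submodule ℝ (Vec n)} (hW : IsRationalSubspace W)
    {a : Vec n} (ha : a ∈ lattice n) : IsRationalSubspace (W ⊓ (ℝ ∙ a)ᗮ) := by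
  by_cases hz : ∀ x, x ∈ lattice n ∧ x ∈ W → inner ℝ a x = 0
  · have hle : W ≤ (ℝ ∙ a)ᗮ := by
      rw [← hW, Submodule.span_le]
      intro x hx
      exact Submodule.mem_orthogonal_singleton_iff_inner_right.2 (hz x hx)
    rwa [inf_eq_left.2 hle]
  · push Not at hz
    obtain ⟨e, ⟨heΓ, heW⟩, hae⟩ := hz
    obtain ⟨k, hk⟩ := inner_lattice ha heΓ
    refine le_antisymm (Submodule.span_le.2 fun x hx => hx.2) fun v hv => ?_
    let φ : Vec n →ₗ[ℝ] Vec n :=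
      (inner ℝ a e : ℝ) • LinearMap.id - (innerSL ℝ a).toLinearMap.smulRight e
    have hφ : ∀ x, φ x = (inner ℝ a e : ℝ) • x - (inner ℝ a x : ℝ) • e := fun x => rfl
    have hmap : W.map φ ≤ Submodule.span ℝ {x | x ∈ lattice n ∧ x ∈ W ⊓ (ℝ ∙ a)ᗮ} := by
      conv_lhs => rw [← hW]
      rw [Submodule.map_span, Submodule.span_le]
      rintro _ ⟨x, ⟨hxΓ, hxW⟩, rfl⟩
      obtain ⟨l, hl⟩ := inner_lattice ha hxΓ
      refine Submodule.subset_span ⟨?_, ?_, ?_⟩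
      · rw [hφ, hk, hl]
        exact (lattice n).sub_mem (int_smul_mem_lattice hxΓ k) (int_smul_mem_lattice heΓ l)
      · rw [hφ]
        exact W.sub_mem (W.smul_mem _ hxW) (W.smul_mem _ heW)
      · refine Submodule.mem_orthogonal_singleton_iff_inner_right.2 ?_
        rw [hφ, inner_sub_right, inner_smul_right, inner_smul_right]
        ring
    have h1 := hmap (Submodule.mem_map_of_mem hv.1)
    rw [hφ, Submodule.mem_orthogonal_singleton_iff_inner_right.1 hv.2, zero_smul, sub_zero] at h1
    exact (Submodule.smul_mem_iff _ hae).1 h1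

theorem isRationalSubspace_flat {A : Finset (Vec n × ℝ)} (hA : ∀ h ∈ A, h.1 ∈ lattice n)
    (p : Vec n) : IsRationalSubspace (flat A p) := by
  classical
  have key : ∀ B : Finset (Vec n × ℝ), (∀ h ∈ B, h.1 ∈ lattice n) →
      IsRationalSubspace (⨅ h ∈ B, (ℝ ∙ h.1)ᗮ) := by
    intro B
    induction B using Finset.induction_on with
    | empty => intro _; simpa using isRationalSubspace_top
    | insert g B _ ih =>
      intro hB
      rw [Finset.iInf_insert, inf_comm]
      exact (ih fun h hh => hB h (Finset.mem_insert_of_mem hh)).inf_orthogonal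
        (hB g (Finset.mem_insert_self _ _))
  have heq : flat A p = ⨅ h ∈ A.filter (fun h => inner ℝ h.1 p = h.2), (ℝ ∙ h.1)ᗮ := by
    ext v
    simp only [Submodule.mem_iInf, Submodule.mem_orthogonal_singleton_iff_inner_right,
      Finset.mem_filter, mem_flat, and_imp]
  rw [heq]
  exact key _ fun h hh => hA h (Finset.mem_filter.1 hh).1

/-- A subspace of a rational subspace has a rational complement in it. -/
theorem IsRationalSubspace.exists_compl {E M : Submodule ℝ (Vec n)} (hM : IsRationalSubspace M)
    (hEM : E ≤ M) : ∃ L, IsRationalSubspace L ∧ Disjoint E L ∧ E ⊔ L = M := by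
  let b := Module.finBasis ℝ E
  let s : Set (Vec n) := range fun i => (b i : Vec n)
  have hs : LinearIndepOn ℝ id s := by
    have h1 : LinearIndependent ℝ fun i => (b i : Vec n) :=
      b.linearIndependent.map' E.subtype E.ker_subtype
    exact h1.linearIndepOn_id
  have hspan : Submodule.span ℝ s = E := by
    have h1 := congrArg (Submodule.map E.subtype) b.span_eq
    rw [Submodule.map_span, Submodule.map_subtype_top, ← range_comp] at h1
    exact h1
  -- A basis of `E`, which need not be rational, is extended by lattice vectors of `M`; these span
  -- the complement.
  let t : Set (Vec n) := {x | x ∈ lattice n ∧ x ∈ M}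
  obtain ⟨c, hct, hsc, htc, hc⟩ := exists_linearIndepOn_id_extension hs
    (subset_union_left (s := s) (t := t))
  refine ⟨Submodule.span ℝ (c \ s), isRationalSubspace_of_span ?_, ?_, ?_⟩
  · rintro x ⟨hxc, hxs⟩
    exact ((hct hxc).resolve_left hxs).1
  · rw [← hspan]
    have := hc.disjoint_span_image (s := ((↑) ⁻¹' s : Set c)) (t := ((↑) ⁻¹' (c \ s) : Set c)) (by
      rw [Set.disjoint_left]
      intro x hx hx'
      exact hx'.2 hx)
    simpa [Subtype.image_preimage_coe, inter_eq_self_of_subset_right hsc,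
      inter_eq_self_of_subset_right (sdiff_subset : c \ s ⊆ c)] using this
  · rw [← hspan, ← Submodule.span_union, union_sdiff_cancel hsc]
    refine le_antisymm (Submodule.span_le.2 fun x hx => ?_) ?_
    · rcases hct hx with h | h
      · obtain ⟨i, rfl⟩ := h
        exact hEM (b i).2
      · exact h.2
    · rw [← hM]
      exact Submodule.span_le.2 fun x hx => htc (.inr hx)

/-- A subgroup that is not contained in any of finitely many subspaces has an element that is
outside all of them. -/
theorem exists_mem_notMem_submodules {Γ : AddSubgroup (Vec n)} {B : Set (Submodule ℝ (Vec n))}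
    (hB : B.Finite) (h : ∀ W ∈ B, ∃ v ∈ Γ, v ∉ W) : ∃ m ∈ Γ, ∀ W ∈ B, m ∉ W := by
  induction B, hB using Set.Finite.induction_on with
  | empty => exact ⟨0, Γ.zero_mem, by simp⟩
  | @insert W B _ hB ih =>
    obtain ⟨m, hm, hmB⟩ := ih fun W' hW' => h W' (mem_insert_of_mem _ hW')
    by_cases hmW : m ∈ W
    · obtain ⟨v, hv, hvW⟩ := h W (mem_insert _ _)
      -- As `m` is outside each `W' ∈ B`, at most one point of the progression `N • m + v` lies in
      -- it.
      have hbad : (⋃ W' ∈ B, {N : ℕ | N • m + v ∈ W'}).Finite := by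
        refine hB.biUnion fun W' hW' => Set.Subsingleton.finite fun N hN N' hN' => ?_
        by_contra hne
        have h1 := W'.sub_mem hN hN'
        rw [add_sub_add_right_eq_sub, ← Nat.cast_smul_eq_nsmul ℝ, ← Nat.cast_smul_eq_nsmul ℝ,
          ← sub_smul] at h1
        exact hmB W' hW' ((W'.smul_mem_iff (sub_ne_zero.2 (Nat.cast_injective.ne hne))).1 h1)
      obtain ⟨N, hN⟩ := hbad.exists_notMem
      refine ⟨N • m + v, Γ.add_mem (Γ.nsmul_mem hm N) hv, ?_⟩
      rintro W' (rfl | hW') hmem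
      · exact hvW ((Submodule.add_mem_iff_right _ (W'.nsmul_mem hmW N)).1 hmem)
      · exact hN (mem_biUnion hW' hmem)
    · refine ⟨m, hm, ?_⟩
      rintro W' (rfl | hW')
      · exact hmW
      · exact hmB W' hW'

theorem finite_lattice_ball (R : ℝ) : {x : Vec n | x ∈ lattice n ∧ ‖x‖ ≤ R}.Finite := by
  obtain ⟨N, hN⟩ := exists_nat_ge R
  let φ : Vec n → (Fin n → ℤ) := fun x i => ⌊x i⌋
  have hfin : (Set.Icc (fun _ : Fin n => -(N : ℤ)) fun _ => (N : ℤ)).Finite := Set.finite_Icc _ _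
  refine Set.Finite.of_finite_image (f := φ) (hfin.subset ?_) ?_
  · rintro _ ⟨x, ⟨hxΓ, hx⟩, rfl⟩
    have hle : ∀ i, |x i| ≤ N := fun i => by
      rw [← Real.norm_eq_abs]
      exact (PiLp.norm_apply_le x i).trans (hx.trans hN)
    refine ⟨fun i => ?_, fun i => ?_⟩ <;> obtain ⟨z, hz⟩ := hxΓ i <;> have h1 := abs_le.1 (hle i)
    · simp only [φ, hz, Int.floor_intCast]
      rw [hz] at h1
      have h2 : ((-(N : ℤ) : ℤ) : ℝ) ≤ z := by push_cast; exact h1.1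
      exact_mod_cast h2
    · simp only [φ, hz, Int.floor_intCast]
      rw [hz] at h1
      have h2 : (z : ℝ) ≤ ((N : ℤ) : ℝ) := by push_cast; exact h1.2
      exact_mod_cast h2
  · intro x hx y hy hxy
    ext i
    obtain ⟨z, hz⟩ := hx.1 i
    obtain ⟨z', hz'⟩ := hy.1 i
    have := congrFun hxy i
    simp only [φ, hz, hz', Int.floor_intCast] at this
    rw [hz, hz', this]

/-- A subgroup of lattice vectors has finite index in the lattice vectors of its real span. -/
theorem relIndex_ne_zero {N : AddSubgroup (Vec n)} (hN : N ≤ lattice n) :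
    N.relIndex (lattice n ⊓ (Submodule.span ℝ (N : Set (Vec n))).toAddSubgroup) ≠ 0 := by
  set K := lattice n ⊓ (Submodule.span ℝ (N : Set (Vec n))).toAddSubgroup with hK
  obtain ⟨b, hbN, hbspan, hb⟩ := exists_linearIndependent ℝ (N : Set (Vec n))
  have hbfin : b.Finite := Set.finite_coe_iff.1 hb.finite
  let B := hbfin.toFinset
  have hBspan : ∀ x ∈ K, ∃ f : Vec n → ℝ, ∑ a ∈ B, f a • a = x := by
    intro x hx
    have hx2 : x ∈ Submodule.span ℝ (B : Set (Vec n)) := by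
      rw [Finite.coe_toFinset, hbspan]
      exact hx.2
    obtain ⟨f, -, hf⟩ := Submodule.mem_span_finset.1 hx2
    exact ⟨f, hf⟩
  -- Removing the integer parts of the coordinates in a basis taken from `N` leaves a bounded
  -- lattice vector, so there are finitely many cosets.
  have hrep : ∀ x ∈ K, ∃ y, y ∈ lattice n ∧ ‖y‖ ≤ ∑ a ∈ B, ‖a‖ ∧ x - y ∈ N := by
    intro x hx
    obtain ⟨f, hf⟩ := hBspan x hx
    have hmem : ∑ a ∈ B, ⌊f a⌋ • a ∈ N :=
      N.sum_mem fun a ha => N.zsmul_mem (hbN (hbfin.mem_toFinset.1 ha)) _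
    refine ⟨x - ∑ a ∈ B, ⌊f a⌋ • a, (lattice n).sub_mem hx.1 (hN hmem), ?_, by simpa using hmem⟩
    have : x - ∑ a ∈ B, ⌊f a⌋ • a = ∑ a ∈ B, Int.fract (f a) • a := by
      rw [← hf, ← Finset.sum_sub_distrib]
      refine Finset.sum_congr rfl fun a _ => ?_
      rw [zsmul_eq_smul, ← sub_smul, Int.self_sub_floor]
    rw [this]
    refine (norm_sum_le _ _).trans (Finset.sum_le_sum fun a _ => ?_)
    rw [norm_smul, Real.norm_eq_abs, abs_of_nonneg (Int.fract_nonneg _)]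
    exact mul_le_of_le_one_left (norm_nonneg _) (Int.fract_lt_one _).le
  have hNK : N ≤ K := fun x hx => ⟨hN hx, Submodule.subset_span hx⟩
  have hfin : Finite (K ⧸ N.addSubgroupOf K) := by
    have hset := finite_lattice_ball (n := n) (∑ a ∈ B, ‖a‖)
    let R : Set K := {y | (y : Vec n) ∈ {x : Vec n | x ∈ lattice n ∧ ‖x‖ ≤ ∑ a ∈ B, ‖a‖}}
    have hR : R.Finite := hset.preimage Subtype.val_injective.injOn
    have := hR.to_subtype
    refine Finite.of_surjective (fun y : R => (QuotientAddGroup.mk (y : K) : K ⧸ N.addSubgroupOf K)) ?_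
    intro q
    obtain ⟨⟨x, hx⟩, rfl⟩ := QuotientAddGroup.mk_surjective q
    obtain ⟨y, hy, hyn, hxy⟩ := hrep x hx
    have hyK : y ∈ K := by
      have := K.sub_mem hx (hNK hxy)
      simpa using this
    refine ⟨⟨⟨y, hyK⟩, hy, hyn⟩, ?_⟩
    rw [QuotientAddGroup.eq, AddSubgroup.mem_addSubgroupOf]
    simpa [neg_add_eq_sub] using hxy
  exact AddSubgroup.index_ne_zero_of_finite

theorem exists_zmultiples_eq {G : AddSubgroup ℝ} (hG : ∀ x ∈ G, ∃ k : ℤ, x = k) :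
    ∃ g ∈ G, G = AddSubgroup.zmultiples g := by
  obtain ⟨k, hk⟩ := Int.subgroup_cyclic (G.comap (Int.castAddHom ℝ))
  have hkG : (k : ℝ) ∈ G := by
    have : k ∈ G.comap (Int.castAddHom ℝ) := hk ▸ AddSubgroup.subset_closure rfl
    exact this
  refine ⟨k, hkG, le_antisymm (fun x hx => ?_) ((AddSubgroup.zmultiples_le_of_mem) hkG)⟩
  obtain ⟨l, rfl⟩ := hG x hx
  have hl : l ∈ G.comap (Int.castAddHom ℝ) := hx
  rw [hk, ← AddSubgroup.zmultiples_eq_closure] at hl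
  obtain ⟨j, hj⟩ := AddSubgroup.mem_zmultiples_iff.1 hl
  refine AddSubgroup.mem_zmultiples_iff.2 ⟨j, ?_⟩
  rw [← hj]
  simp

/-! ### Lattice indices and primitive vectors. -/

/-- The lattice index of `L` and a subspace `V ⊇ E` of one dimension more than `E` is proportional
to the height of a generator of the lattice of `V` modulo `E`, if `L + E` is the hyperplane
orthogonal to `m`. -/
theorem exists_latticeIndex_eq {E L : Submodule ℝ (Vec n)} (hE : IsRationalSubspace E)
    (hL : IsRationalSubspace L) {m : Vec n} (hm : m ∈ lattice n) (hEL : E ⊔ L = (ℝ ∙ m)ᗮ) :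
    ∃ c : ℝ, 0 < c ∧ ∀ (V : Submodule ℝ (Vec n)) (r : Vec n), E ≤ V → r ∈ lattice n → r ∈ V →
      (∀ v ∈ lattice n, v ∈ V → ∃ k : ℤ, v - k • r ∈ E) → inner ℝ m r ≠ 0 →
      (latticeIndex L V : ℝ) = c * |inner ℝ m r| := by
  set Γ := lattice n
  set K := Γ ⊓ ((ℝ ∙ m)ᗮ).toAddSubgroup with hK
  let N := (Γ ⊓ L.toAddSubgroup) ⊔ (Γ ⊓ E.toAddSubgroup)
  have hNΓ : N ≤ Γ := sup_le inf_le_left inf_le_left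
  have hspan : Submodule.span ℝ (N : Set (Vec n)) = (ℝ ∙ m)ᗮ := by
    rw [← hEL]
    refine le_antisymm (Submodule.span_le.2 ?_) (sup_le ?_ ?_)
    · have : N ≤ (E ⊔ L).toAddSubgroup := sup_le
        (fun x hx => Submodule.mem_sup_right hx.2) (fun x hx => Submodule.mem_sup_left hx.2)
      exact this
    · conv_lhs => rw [← hE]
      exact Submodule.span_mono fun x hx => AddSubgroup.mem_sup_right ⟨hx.1, hx.2⟩
    · conv_lhs => rw [← hL]
      exact Submodule.span_mono fun x hx => AddSubgroup.mem_sup_left ⟨hx.1, hx.2⟩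
  have hNK : N.relIndex K ≠ 0 := by
    have := relIndex_ne_zero hNΓ
    rwa [hspan] at this
  let ψ : Vec n →+ ℝ := (innerSL ℝ m).toLinearMap.toAddMonoidHom
  have hψ : ∀ x, ψ x = inner ℝ m x := fun x => rfl
  obtain ⟨g, -, hg⟩ := exists_zmultiples_eq (G := Γ.map ψ) (by
    rintro _ ⟨x, hx, rfl⟩
    exact inner_lattice hm hx)
  have hKmem : ∀ x, x ∈ K ↔ x ∈ Γ ∧ ψ x = 0 := fun x => by
    rw [hψ, ← Submodule.mem_orthogonal_singleton_iff_inner_right]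
    rfl
  have hNleK : N ≤ K := by
    refine sup_le (fun x hx => ⟨hx.1, ?_⟩) fun x hx => ⟨hx.1, ?_⟩
    · exact hEL ▸ Submodule.mem_sup_right hx.2
    · exact hEL ▸ Submodule.mem_sup_left hx.2
  -- If `m` vanishes on the lattice, no `r` satisfies the hypotheses and any positive constant will
  -- do.
  by_cases hg0 : g = 0
  · refine ⟨1, one_pos, fun V r _ hr _ _ hmr => absurd ?_ hmr⟩
    have : ψ r ∈ Γ.map ψ := ⟨r, hr, rfl⟩
    rw [hg, hg0, AddSubgroup.zmultiples_zero_eq_bot] at this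
    exact this
  -- The index of `H` in `Γ` factors through `K ⊔ H`. The lower factor equals the index of `N` in
  -- `K`, which does not depend on `V`. The upper factor is the index of the multiples of `ψ r` in
  -- `ψ(Γ)`, the multiples of `g`.
  refine ⟨N.relIndex K / |g|, by positivity, fun V r hEV hrΓ hrV hgen hmr => ?_⟩
  set H := (Γ ⊓ L.toAddSubgroup) ⊔ (Γ ⊓ V.toAddSubgroup) with hH
  have hNH : N ≤ H := sup_le_sup_left (inf_le_inf_left Γ (Submodule.toAddSubgroup_mono hEV)) _
  have hrH : r ∈ H := AddSubgroup.mem_sup_right ⟨hrΓ, hrV⟩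
  have hHrep : ∀ x ∈ H, ∃ y ∈ N, ∃ k : ℤ, x = y + k • r := by
    intro x hx
    obtain ⟨l, hl, v, hv, rfl⟩ := AddSubgroup.mem_sup.1 hx
    obtain ⟨k, hk⟩ := hgen v hv.1 hv.2
    refine ⟨l + (v - k • r), ?_, k, by abel⟩
    exact N.add_mem (AddSubgroup.mem_sup_left hl)
      (AddSubgroup.mem_sup_right ⟨Γ.sub_mem hv.1 (Γ.zsmul_mem hrΓ k), hk⟩)
  have hHΓ : H ≤ Γ := sup_le inf_le_left inf_le_left
  have hHK : H ⊓ K = N := by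
    refine le_antisymm ?_ (le_inf hNH hNleK)
    rintro x ⟨hxH, hxK⟩
    obtain ⟨y, hy, k, rfl⟩ := hHrep x hxH
    have h1 := ((hKmem _).1 hxK).2
    rw [map_add, ((hKmem y).1 (hNleK hy)).2, zero_add, map_zsmul, zsmul_eq_mul, mul_eq_zero,
      or_iff_left (by rwa [hψ])] at h1
    rw [Int.cast_eq_zero.1 h1, zero_smul, add_zero]
    exact hy
  have h1 : H.relIndex (K ⊔ H) = N.relIndex K := by
    rw [AddSubgroup.relIndex_sup_right, ← AddSubgroup.inf_relIndex_right, hHK]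
  have h2 : (AddSubgroup.zmultiples (ψ r)).comap ψ ⊓ Γ = K ⊔ H := by
    refine le_antisymm ?_ (sup_le ?_ ?_)
    · rintro x ⟨hx, hxΓ⟩
      obtain ⟨k, hk⟩ := AddSubgroup.mem_zmultiples_iff.1 (AddSubgroup.mem_comap.1 hx)
      refine AddSubgroup.mem_sup.2 ⟨x - k • r, ?_, k • r, H.zsmul_mem hrH k, by abel⟩
      refine (hKmem _).2 ⟨Γ.sub_mem hxΓ (Γ.zsmul_mem hrΓ k), ?_⟩
      rw [map_sub, map_zsmul, hk, sub_self]
    · intro x hx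
      refine ⟨?_, hx.1⟩
      refine AddSubgroup.mem_comap.2 ?_
      rw [((hKmem x).1 hx).2]
      exact AddSubgroup.zero_mem _
    · intro x hx
      refine ⟨?_, hHΓ hx⟩
      obtain ⟨y, hy, k, rfl⟩ := hHrep x hx
      refine AddSubgroup.mem_comap.2 ?_
      rw [map_add, ((hKmem y).1 (hNleK hy)).2, zero_add, map_zsmul]
      exact AddSubgroup.zsmul_mem _ (AddSubgroup.mem_zmultiples _) k
  obtain ⟨j, hj⟩ : ∃ j : ℤ, j • g = ψ r := by
    have : ψ r ∈ Γ.map ψ := ⟨r, hrΓ, rfl⟩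
    rw [hg] at this
    exact AddSubgroup.mem_zmultiples_iff.1 this
  have h3 : (K ⊔ H).relIndex Γ = j.natAbs := by
    rw [← h2, AddSubgroup.inf_relIndex_right, AddSubgroup.relIndex_comap, hg]
    let f : ℤ →+ ℝ := zmultiplesHom ℝ g
    have hf : ∀ k : ℤ, f k = k • g := fun k => rfl
    have hfinj : Function.Injective f := by
      intro a b hab
      rw [hf, hf, zsmul_eq_mul, zsmul_eq_mul] at hab
      exact_mod_cast mul_right_cancel₀ hg0 hab
    have e1 : AddSubgroup.zmultiples (ψ r) = (AddSubgroup.zmultiples j).map f := by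
      rw [AddMonoidHom.map_zmultiples, hf, hj]
    have e2 : AddSubgroup.zmultiples g = (⊤ : AddSubgroup ℤ).map f := by
      rw [← AddMonoidHom.range_eq_map]
      rfl
    rw [e1, e2, AddSubgroup.relIndex_map_map_of_injective _ _ hfinj, AddSubgroup.relIndex_top_right,
      Int.index_zmultiples]
  have h4 : latticeIndex L V = N.relIndex K * j.natAbs := by
    rw [← h1, ← h3, AddSubgroup.relIndex_mul_relIndex _ _ _ le_sup_right (sup_le inf_le_left hHΓ)]
    rfl
  rw [h4, ← hψ, ← hj, zsmul_eq_mul, abs_mul]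
  push_cast
  rw [Nat.cast_natAbs]
  push_cast
  field_simp

/-- On `V` the kernel of `a` is `E`, so `a` embeds the lattice of `V` modulo `E` into `ℤ`, where
subgroups are cyclic. Rationality of `V` keeps the generator outside `E`. -/
theorem exists_lattice_generator {E V : Submodule ℝ (Vec n)} (hV : IsRationalSubspace V)
    (hEV : E ≤ V) (hdim : finrank ℝ E + 1 = finrank ℝ V) {a : Vec n} (ha : a ∈ lattice n)
    (haE : ∀ v ∈ E, inner ℝ a v = 0) (haV : ∃ v ∈ V, inner ℝ a v ≠ 0) :
    ∃ r ∈ lattice n, r ∈ V ∧ r ∉ E ∧ ∀ v ∈ lattice n, v ∈ V → ∃ k : ℤ, v - k • r ∈ E := by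
  obtain ⟨v₀, hv₀, hav₀⟩ := haV
  have hmemE : ∀ v ∈ V, inner ℝ a v = 0 → v ∈ E := by
    intro v hv h0
    obtain ⟨e, he, b, rfl⟩ := exists_eq_add_smul hEV hdim hv₀ (fun h => hav₀ (haE _ h)) hv
    rw [inner_add_right, haE e he, zero_add, inner_smul_right, mul_eq_zero, or_iff_left hav₀] at h0
    rw [h0, zero_smul, add_zero]
    exact he
  let ψ : Vec n →+ ℝ := (innerSL ℝ a).toLinearMap.toAddMonoidHom
  have hψ : ∀ x, ψ x = inner ℝ a x := fun x => rfl
  obtain ⟨g, ⟨r, ⟨hrΓ, hrV⟩, hrg⟩, hg⟩ :=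
    exists_zmultiples_eq (G := (lattice n ⊓ V.toAddSubgroup).map ψ) (by
      rintro _ ⟨x, hx, rfl⟩
      exact inner_lattice ha hx.1)
  have hgen : ∀ v ∈ lattice n, v ∈ V → ∃ k : ℤ, v - k • r ∈ E := by
    intro v hv hvV
    have h1 : ψ v ∈ (lattice n ⊓ V.toAddSubgroup).map ψ := ⟨v, ⟨hv, hvV⟩, rfl⟩
    rw [hg] at h1
    obtain ⟨k, hk⟩ := AddSubgroup.mem_zmultiples_iff.1 h1
    refine ⟨k, hmemE _ (V.sub_mem hvV (V.toAddSubgroup.zsmul_mem hrV k)) ?_⟩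
    rw [← hψ, map_sub, map_zsmul, hrg, hk, sub_self]
  refine ⟨r, hrΓ, hrV, fun hrE => hav₀ ?_, hgen⟩
  have hle : V ≤ E := by
    rw [← hV, Submodule.span_le]
    rintro v ⟨hv, hvV⟩
    obtain ⟨k, hk⟩ := hgen v hv hvV
    have := E.add_mem hk (E.toAddSubgroup.zsmul_mem hrE k)
    rwa [sub_add_cancel] at this
  exact haE _ (hle hv₀)

/-! ### Regular points, and the rays at a point of codimension one. -/

open Classical in
/-- The projection to `V` along `L`, if these are complementary subspaces. -/
noncomputable def proj (V L : Submodule ℝ (Vec n)) (x : Vec n) : Vec n :=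
  if h : IsCompl V L then V.projection L h x else 0

theorem proj_mem {V L : Submodule ℝ (Vec n)} (h : IsCompl V L) (x : Vec n) : proj V L x ∈ V := by
  rw [proj, dif_pos h]
  exact Submodule.projection_apply_mem h x

theorem sub_proj_mem {V L : Submodule ℝ (Vec n)} (h : IsCompl V L) (x : Vec n) :
    x - proj V L x ∈ L := by
  rw [proj, dif_pos h]
  exact Submodule.sub_projection_mem h x

theorem proj_eq_of_mem {V L : Submodule ℝ (Vec n)} (h : IsCompl V L) {x y : Vec n} (hy : y ∈ V)
    (hxy : x - y ∈ L) : proj V L x = y := by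
  have h1 : proj V L x - y ∈ L := by
    have := L.sub_mem hxy (sub_proj_mem h x)
    rwa [sub_sub_sub_cancel_left] at this
  exact sub_eq_zero.1 (Submodule.disjoint_def.1 h.disjoint _ (V.sub_mem (proj_mem h x) hy) h1)

theorem tendsto_proj (V L : Submodule ℝ (Vec n)) : Tendsto (proj V L) (𝓝 0) (𝓝 0) := by
  by_cases h : IsCompl V L
  · have heq : proj V L = V.projection L h := by
      ext1 x
      rw [proj, dif_pos h]
    have hc : Continuous (V.projection L h) := LinearMap.continuous_of_finiteDimensional _
    rw [heq]
    simpa using hc.tendsto 0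
  · have heq : proj V L = fun _ => 0 := by
      ext1 x
      rw [proj, dif_neg h]
    rw [heq]
    exact tendsto_const_nhds

theorem eventually_flat_add_eq (A : Finset (Vec n × ℝ)) (q : Vec n) :
    ∀ᶠ v in 𝓝 (0 : Vec n), v ∈ flat A q → flat A (q + v) = flat A q := by
  filter_upwards [eventually_mem_flat_iff A q] with v hv hvq
  ext x
  refine forall₂_congr fun h hh => ?_
  rw [hv h hh]
  exact ⟨fun h1 h2 => h1 ⟨h2, hvq h hh h2⟩, fun h1 h2 => h1 h2.1⟩

section Regular

variable (hd : ∀ H ∈ F, finrank ℝ (dir H) = d) {q : Vec n} (hq : d ≤ finrank ℝ (flat (walls F) q))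

include hd hq

/-- Every cell through `q` contains a piece of the flat, whose dimension is already that of the
cell. So near `q` the complex is this flat. -/
theorem dir_eq_flat {H : Finset (Vec n × ℝ)} (hH : H ∈ F) (hqH : q ∈ poly H) :
    dir H = flat (walls F) q := by
  refine (Submodule.eq_of_le_of_finrank_le (fun v hv => ?_) ?_).symm
  · exact tcone_subset_dir hqH (flat_subset_tcone (subset_walls hH) hv)
  · rwa [hd H hH]

theorem eventually_mem_support_iff (hqT : q ∈ support F) :
    ∀ᶠ v in 𝓝 (0 : Vec n), q + v ∈ support F ↔ v ∈ flat (walls F) q := by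
  filter_upwards [eventually_mem_poly_imp F q] with v hv
  constructor
  · intro h
    obtain ⟨H, hH, hmem⟩ := mem_support.1 h
    obtain ⟨h1, h2⟩ := (hv H hH).1 hmem
    exact dir_eq_flat hd hq hH h1 ▸ tcone_subset_dir h1 h2
  · intro h
    obtain ⟨H, hH, hqH⟩ := mem_support.1 hqT
    exact mem_support.2 ⟨H, hH, (hv H hH).2 ⟨hqH, flat_subset_tcone (subset_walls hH) h⟩⟩

theorem isSmoothPoint_of_le_finrank (hqT : q ∈ support F) : IsSmoothPoint (support F) q :=
  ⟨hqT, _, eventually_mem_support_iff hd hq hqT⟩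

theorem tangentSpace_eq_flat (hqT : q ∈ support F) :
    tangentSpace (support F) q = flat (walls F) q :=
  tangentSpace_eq (eventually_mem_support_iff hd hq hqT)

end Regular

/-- At a regular point the nearby points are regular with the same tangent space and weight. -/
theorem eventually_regular (hd : ∀ H ∈ F, finrank ℝ (dir H) = d) {w : Vec n → ℝ}
    (hw : ∀ p, IsSmoothPoint (support F) p →
      ∀ᶠ q in 𝓝[{q | IsSmoothPoint (support F) q}] p, w q = w p)
    {q : Vec n} (hq : d ≤ finrank ℝ (flat (walls F) q)) (hqT : q ∈ support F) :
    ∀ᶠ v in 𝓝 (0 : Vec n), v ∈ flat (walls F) q → q + v ∈ support F ∧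
      tangentSpace (support F) (q + v) = flat (walls F) q ∧ w (q + v) = w q := by
  have ht : Tendsto (fun v : Vec n => q + v) (𝓝 0) (𝓝 q) := by
    have : Continuous (fun v : Vec n => q + v) := by fun_prop
    simpa using this.tendsto 0
  have h1 := ht.eventually (eventually_nhdsWithin_iff.1
    (hw q (isSmoothPoint_of_le_finrank hd hq hqT)))
  filter_upwards [h1, eventually_flat_add_eq (walls F) q,
    eventually_mem_support_iff hd hq hqT] with v hv1 hv2 hv3 hv
  have hT := hv3.2 hv
  have hfl := hv2 hv
  have hq' : d ≤ finrank ℝ (flat (walls F) (q + v)) := by rwa [hfl]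
  exact ⟨hT, by rw [tangentSpace_eq_flat hd hq' hT, hfl],
    hv1 (isSmoothPoint_of_le_finrank hd hq' hT)⟩

/-- The unit vectors, orthogonal to the flat through `p`, that point into the complex. -/
def rays (F : Finset (Finset (Vec n × ℝ))) (p : Vec n) : Set (Vec n) :=
  {u | ‖u‖ = 1 ∧ u ∈ (flat (walls F) p)ᗮ ∧ ∃ H ∈ F, p ∈ poly H ∧ u ∈ tcone H p}

/-- The linear span of the half-flat defined by a ray. -/
noncomputable def raySpace (F : Finset (Finset (Vec n × ℝ))) (p u : Vec n) :
    Submodule ℝ (Vec n) := flat (walls F) p ⊔ ℝ ∙ u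

theorem mem_raySpace_iff {p u v : Vec n} :
    v ∈ raySpace F p u ↔ ∃ e ∈ flat (walls F) p, ∃ s : ℝ, v = e + s • u := by
  constructor
  · intro hv
    obtain ⟨e, he, x, hx, rfl⟩ := Submodule.mem_sup.1 hv
    obtain ⟨s, rfl⟩ := Submodule.mem_span_singleton.1 hx
    exact ⟨e, he, s, rfl⟩
  · rintro ⟨e, he, s, rfl⟩
    exact Submodule.add_mem_sup he (Submodule.smul_mem _ _ (Submodule.mem_span_singleton_self u))

theorem flat_le_raySpace {p u : Vec n} : flat (walls F) p ≤ raySpace F p u := le_sup_left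

theorem self_mem_raySpace {p u : Vec n} : u ∈ raySpace F p u :=
  Submodule.mem_sup_right (Submodule.mem_span_singleton_self u)

theorem inner_ray_add_smul {p u : Vec n} (hu : u ∈ rays F p) {e : Vec n}
    (he : e ∈ flat (walls F) p) (s : ℝ) : inner ℝ u (e + s • u) = s := by
  rw [inner_add_right, Submodule.inner_left_of_mem_orthogonal he hu.2.1, inner_smul_right,
    real_inner_self_eq_norm_sq, hu.1]
  ring

theorem ray_notMem {p u : Vec n} (hu : u ∈ rays F p) : u ∉ flat (walls F) p := by
  intro h
  have h1 := Submodule.inner_left_of_mem_orthogonal h hu.2.1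
  rw [real_inner_self_eq_norm_sq, hu.1] at h1
  norm_num at h1

section Rays

variable (hd : ∀ H ∈ F, finrank ℝ (dir H) = d) {p : Vec n}
  (hp : finrank ℝ (flat (walls F) p) + 1 = d)

include hd hp

theorem dir_eq_raySpace {u : Vec n} (hu : u ∈ rays F p) {H : Finset (Vec n × ℝ)} (hH : H ∈ F)
    (hpH : p ∈ poly H) (huH : u ∈ dir H) : dir H = raySpace F p u := by
  have hE : flat (walls F) p ≤ dir H := fun v hv =>
    tcone_subset_dir hpH (flat_subset_tcone (subset_walls hH) hv)
  refine le_antisymm (fun v hv => ?_) (sup_le hE ((Submodule.span_singleton_le_iff_mem _ _).2 huH))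
  exact mem_raySpace_iff.2
    (exists_eq_add_smul hE (by rw [hd H hH, hp]) huH (ray_notMem hu) hv)

theorem finrank_raySpace {u : Vec n} (hu : u ∈ rays F p) : finrank ℝ (raySpace F p u) = d := by
  obtain ⟨H, hH, hpH, huH⟩ := hu.2.2
  rw [← dir_eq_raySpace hd hp hu hH hpH (tcone_subset_dir hpH huH), hd H hH]

omit hd hp in
theorem exists_ray {H : Finset (Vec n × ℝ)} (hH : H ∈ F) (hpH : p ∈ poly H) {v : Vec n}
    (hv : v ∈ tcone H p) (hvE : v ∉ flat (walls F) p) :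
    ∃ u ∈ rays F p, u ∈ tcone H p ∧ ∃ e ∈ flat (walls F) p, ∃ s : ℝ, 0 < s ∧ v = e + s • u := by
  obtain ⟨e, he, z, hz, hvez⟩ := (flat (walls F) p).exists_add_mem_mem_orthogonal v
  have hz0 : z ≠ 0 := by
    rintro rfl
    rw [add_zero] at hvez
    exact hvE (hvez ▸ he)
  have hzn : 0 < ‖z‖ := norm_pos_iff.2 hz0
  have hzt : z ∈ tcone H p := by
    have : z = v + -e := by rw [hvez]; abel
    rw [this]
    exact add_mem_tcone hv (flat_subset_tcone (subset_walls hH) (Submodule.neg_mem _ he))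
  have hut : ‖z‖⁻¹ • z ∈ tcone H p := smul_mem_tcone (by positivity) hzt
  refine ⟨‖z‖⁻¹ • z, ⟨?_, Submodule.smul_mem _ _ hz, H, hH, hpH, hut⟩, hut, e, he, ‖z‖, hzn, ?_⟩
  · rw [norm_smul, norm_inv, norm_norm, inv_mul_cancel₀ hzn.ne']
  · rw [smul_smul, mul_inv_cancel₀ hzn.ne', one_smul, hvez]

/-- The part of the direction of a cell orthogonal to the flat is a line, so each cell contributes
at most two opposite unit vectors. -/
theorem finite_rays : (rays F p).Finite := by
  have hsub : rays F p ⊆ ⋃ H ∈ F, {u | u ∈ rays F p ∧ p ∈ poly H ∧ u ∈ tcone H p} := by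
    intro u hu
    obtain ⟨H, hH, hpH, huH⟩ := id hu.2.2
    exact mem_biUnion (x := H) hH ⟨hu, hpH, huH⟩
  refine (F.finite_toSet.biUnion fun H hH => ?_).subset hsub
  rcases eq_empty_or_nonempty {u | u ∈ rays F p ∧ p ∈ poly H ∧ u ∈ tcone H p} with h | ⟨u, hu⟩
  · rw [h]
    exact finite_empty
  · refine (Set.toFinite {u, -u}).subset ?_
    rintro v ⟨hv, hpH, hvH⟩
    have h1 : v ∈ raySpace F p u := by
      rw [← dir_eq_raySpace hd hp hu.1 hH hpH (tcone_subset_dir hpH hu.2.2)]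
      exact tcone_subset_dir hpH hvH
    obtain ⟨e, he, s, hves⟩ := mem_raySpace_iff.1 h1
    have he0 : e = 0 := by
      have h2 : e ∈ (flat (walls F) p)ᗮ := by
        have : e = v - s • u := by rw [hves]; abel
        rw [this]
        exact Submodule.sub_mem _ hv.2.1 (Submodule.smul_mem _ _ hu.1.2.1)
      exact Submodule.disjoint_def.1 (Submodule.orthogonal_disjoint _) e he h2
    rw [he0, zero_add] at hves
    have hs : |s| = 1 := by
      have := hv.1
      rwa [hves, norm_smul, hu.1.1, mul_one, Real.norm_eq_abs] at this
    rcases eq_or_eq_neg_of_abs_eq hs with h | h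
    · left; rw [hves, h, one_smul]
    · right; rw [hves, h, neg_one_smul]; rfl

/-- Inside the open half-flat, the active hyperplanes are those active at `p` that contain `u`.
Hence these points are regular. -/
theorem eventually_flat_eq_raySpace :
    ∀ᶠ v in 𝓝 (0 : Vec n), ∀ u ∈ rays F p, v ∈ raySpace F p u → 0 < inner ℝ u v →
      p + v ∈ support F ∧ flat (walls F) (p + v) = raySpace F p u := by
  filter_upwards [eventually_mem_poly_imp F p, eventually_mem_flat_iff (walls F) p] with
    v hv1 hv2 u hu hvu hpos
  obtain ⟨e, he, s, rfl⟩ := mem_raySpace_iff.1 hvu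
  rw [inner_ray_add_smul hu he] at hpos
  obtain ⟨H, hH, hpH, huH⟩ := id hu.2.2
  have hmem : p + (e + s • u) ∈ poly H := (hv1 H hH).2 ⟨hpH, add_mem_tcone
    (flat_subset_tcone (subset_walls hH) he) (smul_mem_tcone hpos.le huH)⟩
  refine ⟨mem_support.2 ⟨H, hH, hmem⟩, le_antisymm ?_ ?_⟩
  · rw [← dir_eq_raySpace hd hp hu hH hpH (tcone_subset_dir hpH huH)]
    exact fun x hx => tcone_subset_dir hmem (flat_subset_tcone (subset_walls hH) hx)
  · refine fun x hx h hh hact => ?_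
    obtain ⟨h1, h2⟩ := (hv2 h hh).1 hact
    rw [inner_add_right, he h hh h1, zero_add, inner_smul_right, mul_eq_zero,
      or_iff_right hpos.ne'] at h2
    obtain ⟨e', he', s', rfl⟩ := mem_raySpace_iff.1 hx
    rw [inner_add_right, he' h hh h1, inner_smul_right, h2, mul_zero, add_zero]

omit hd hp in
theorem eq_of_eventually_eq_of_convex {A : Set (Vec n)} (hA : Convex ℝ A) {f : Vec n → ℝ}
    (hf : ∀ x ∈ A, ∀ᶠ y in 𝓝[A] x, f y = f x) {x y : Vec n} (hx : x ∈ A) (hy : y ∈ A) :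
    f x = f y := by
  have : PreconnectedSpace A := isPreconnected_iff_preconnectedSpace.1 hA.isPreconnected
  have hloc : IsLocallyConstant fun z : A => f z := by
    rw [IsLocallyConstant.iff_eventually_eq]
    intro z
    rw [nhds_subtype_eq_comap_nhdsWithin]
    exact (hf z z.2).comap _
  exact hloc.apply_eq_of_preconnectedSpace ⟨x, hx⟩ ⟨y, hy⟩

/-- The weight is constant and positive along the half-flats at `p`. -/
theorem exists_ray_weights {w : Vec n → ℝ}
    (hw0 : ∀ p, IsSmoothPoint (support F) p → 0 < w p)
    (hw : ∀ p, IsSmoothPoint (support F) p →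
      ∀ᶠ q in 𝓝[{q | IsSmoothPoint (support F) q}] p, w q = w p) :
    ∃ ω : Vec n → ℝ, (∀ u ∈ rays F p, 0 < ω u) ∧ ∃ ρ > 0, ∀ v : Vec n, ‖v‖ < ρ → ∀ u ∈ rays F p,
      v ∈ raySpace F p u → 0 < inner ℝ u v → p + v ∈ support F ∧
        tangentSpace (support F) (p + v) = raySpace F p u ∧ w (p + v) = ω u := by
  obtain ⟨ρ, hρ, hball⟩ := Metric.eventually_nhds_iff_ball.1 (eventually_flat_eq_raySpace hd hp)
  have hreg : ∀ v : Vec n, ‖v‖ < ρ → ∀ u ∈ rays F p, v ∈ raySpace F p u → 0 < inner ℝ u v →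
      p + v ∈ support F ∧ tangentSpace (support F) (p + v) = raySpace F p u ∧
      IsSmoothPoint (support F) (p + v) := by
    intro v hv u hu hvu hpos
    obtain ⟨h1, h2⟩ := hball v (mem_ball_zero_iff.2 hv) u hu hvu hpos
    have h3 : d ≤ finrank ℝ (flat (walls F) (p + v)) := by rw [h2, finrank_raySpace hd hp hu]
    exact ⟨h1, by rw [tangentSpace_eq_flat hd h3 h1, h2], isSmoothPoint_of_le_finrank hd h3 h1⟩
  have hu₀ : ∀ u ∈ rays F p, ‖(ρ / 2) • u‖ < ρ ∧ (ρ / 2) • u ∈ raySpace F p u ∧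
      0 < inner ℝ u ((ρ / 2) • u) := by
    intro u hu
    refine ⟨?_, Submodule.smul_mem _ _ self_mem_raySpace, ?_⟩
    · rw [norm_smul, hu.1, mul_one, Real.norm_eq_abs, abs_of_pos (by positivity)]
      linarith
    · rw [inner_smul_right, real_inner_self_eq_norm_sq, hu.1]
      positivity
  refine ⟨fun u => w (p + (ρ / 2) • u), fun u hu => ?_, ρ, hρ, fun v hv u hu hvu hpos => ?_⟩
  · obtain ⟨h1, h2, h3⟩ := hu₀ u hu
    exact hw0 _ (hreg _ h1 u hu h2 h3).2.2
  · obtain ⟨h1, h2, h3⟩ := hreg v hv u hu hvu hpos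
    refine ⟨h1, h2, ?_⟩
    -- The half-ball is convex and consists of smooth points, so the locally constant weight agrees
    -- with its value at `(ρ / 2) • u`.
    let A : Set (Vec n) := Metric.ball 0 ρ ∩ (raySpace F p u ∩ {x | 0 < inner ℝ u x})
    have hA : Convex ℝ A := (convex_ball 0 ρ).inter ((raySpace F p u).convex.inter
      (convex_halfSpace_gt (innerSL ℝ u).isLinear 0))
    refine eq_of_eventually_eq_of_convex (f := fun v => w (p + v)) hA ?_
      ⟨mem_ball_zero_iff.2 hv, hvu, hpos⟩
      ⟨mem_ball_zero_iff.2 (hu₀ u hu).1, (hu₀ u hu).2.1, (hu₀ u hu).2.2⟩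
    intro x hx
    have hxs := (hreg x (mem_ball_zero_iff.1 hx.1) u hu hx.2.1 hx.2.2).2.2
    have ht : Tendsto (fun v : Vec n => p + v) (𝓝[A] x)
        (𝓝[{q | IsSmoothPoint (support F) q}] (p + x)) := by
      refine tendsto_nhdsWithin_iff.2 ⟨?_, ?_⟩
      · have : Continuous (fun v : Vec n => p + v) := by fun_prop
        exact (this.tendsto x).mono_left nhdsWithin_le_nhds
      · filter_upwards [self_mem_nhdsWithin] with y hy
        exact (hreg y (mem_ball_zero_iff.1 hy.1) u hu hy.2.1 hy.2.2).2.2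
    exact ht.eventually (hw _ hxs)

end Rays

/-! ### Intersection numbers on the two sides of a wall. -/

theorem finrank_orthogonal_singleton_add_one {m : Vec n} (hm : m ≠ 0) :
    finrank ℝ ((ℝ ∙ m)ᗮ : Submodule ℝ (Vec n)) + 1 = n := by
  have h1 := Submodule.finrank_add_finrank_orthogonal (ℝ ∙ m)
  rw [finrank_span_singleton hm, finrank_euclideanSpace_fin] at h1
  omega

theorem isCompl_raySpace (hd : ∀ H ∈ F, finrank ℝ (dir H) = d) {p : Vec n}
    (hp : finrank ℝ (flat (walls F) p) + 1 = d) {L : Submodule ℝ (Vec n)} {m : Vec n}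
    (hdisj : Disjoint (flat (walls F) p) L) (hEL : flat (walls F) p ⊔ L = (ℝ ∙ m)ᗮ)
    (hL : d + finrank ℝ L = n) {u : Vec n} (hu : u ∈ rays F p) (hmu : inner ℝ m u ≠ 0) :
    IsCompl (raySpace F p u) L := by
  refine isCompl_of_disjoint_finrank (Submodule.disjoint_def.2 fun x hx hxL => ?_)
    (by rw [finrank_raySpace hd hp hu, hL])
  obtain ⟨e, he, s, rfl⟩ := mem_raySpace_iff.1 hx
  have h1 : inner ℝ m (e + s • u) = 0 := Submodule.mem_orthogonal_singleton_iff_inner_right.1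
    (hEL ▸ Submodule.mem_sup_right hxL)
  have h2 : inner ℝ m e = 0 := Submodule.mem_orthogonal_singleton_iff_inner_right.1
    (hEL ▸ Submodule.mem_sup_left he)
  rw [inner_add_right, h2, zero_add, inner_smul_right, mul_eq_zero, or_iff_left hmu] at h1
  subst h1
  rw [zero_smul, add_zero] at hxL ⊢
  exact Submodule.disjoint_def.1 hdisj e he hxL

theorem add_smul_ray_injective {p u u' e e' : Vec n} {s s' : ℝ} (hu : u ∈ rays F p)
    (hu' : u' ∈ rays F p) (he : e ∈ flat (walls F) p) (he' : e' ∈ flat (walls F) p)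
    (hs : 0 < s) (hs' : 0 < s') (h : e + s • u = e' + s' • u') : u = u' := by
  have h1 : s • u - s' • u' = e' - e := by
    rw [sub_eq_sub_iff_add_eq_add, add_comm, h]
  have h2 : s • u - s' • u' = 0 := by
    refine Submodule.disjoint_def.1 (Submodule.orthogonal_disjoint (flat (walls F) p)) _ ?_ ?_
    · rw [h1]
      exact Submodule.sub_mem _ he' he
    · exact Submodule.sub_mem _ (Submodule.smul_mem _ _ hu.2.1) (Submodule.smul_mem _ _ hu'.2.1)
  have h3 : s • u = s' • u' := sub_eq_zero.1 h2
  have h4 := congrArg norm h3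
  rw [norm_smul, norm_smul, hu.1, hu'.1, Real.norm_eq_abs, Real.norm_eq_abs, abs_of_pos hs,
    abs_of_pos hs', mul_one, mul_one] at h4
  rw [h4] at h3
  exact smul_right_injective _ hs'.ne' h3

theorem tendsto_nhds_ne {f g : Vec n → Vec n} {x y : Vec n} (hf : Tendsto f (𝓝 0) (𝓝 x))
    (hg : Tendsto g (𝓝 0) (𝓝 y)) (hxy : x ≠ y) : ∀ᶠ z in 𝓝 (0 : Vec n), f z ≠ g z :=
  (hf.prodMk_nhds hg).eventually (isClosed_diagonal.isOpen_compl.mem_nhds hxy)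

/-- The tropical intersection number with generic translates of `L` close to `p + L`, when `p` is
the only point of `p + L` that lies on a flat of codimension one in the complex. -/
theorem exists_intersectionNumber_eq (hd : ∀ H ∈ F, finrank ℝ (dir H) = d)
    (hne : ∀ H ∈ F, (poly H).Nonempty) {w : Vec n → ℝ}
    (hw : ∀ p, IsSmoothPoint (support F) p →
      ∀ᶠ q in 𝓝[{q | IsSmoothPoint (support F) q}] p, w q = w p) {p : Vec n}
    (hp : finrank ℝ (flat (walls F) p) + 1 = d) {L : Submodule ℝ (Vec n)} {m : Vec n}
    (hdisj : Disjoint (flat (walls F) p) L) (hEL : flat (walls F) p ⊔ L = (ℝ ∙ m)ᗮ)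
    (hL : d + finrank ℝ L = n)
    (hgen : ∀ q ∈ support F, q - p ∈ L → q ≠ p → d ≤ finrank ℝ (flat (walls F) q))
    {ω : Vec n → ℝ} (hω : ∀ u ∈ rays F p, ∀ᶠ v in 𝓝 (0 : Vec n), v ∈ raySpace F p u →
      0 < inner ℝ u v → p + v ∈ support F ∧
        tangentSpace (support F) (p + v) = raySpace F p u ∧ w (p + v) = ω u) :
    ∃ c₀ : ℝ, ∀ᶠ ξ in 𝓝 (0 : Vec n),
      (∀ D ∈ F, ¬ IsCompl (dir D) L → ∀ c ∈ poly D, p + ξ - c ∉ dir D ⊔ L) →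
      inner ℝ m ξ ≠ 0 →
      intersectionNumber (support F) w L (-(p + ξ)) =
        c₀ + ∑ᶠ u ∈ {u | u ∈ rays F p ∧ 0 < inner ℝ m u * inner ℝ m ξ},
          ω u * (latticeIndex L (raySpace F p u) : ℝ) := by
  have hmL : ∀ l ∈ L, inner ℝ m l = 0 := fun l hl =>
    Submodule.mem_orthogonal_singleton_iff_inner_right.1 (hEL ▸ Submodule.mem_sup_right hl)
  have hmE : ∀ e ∈ flat (walls F) p, inner ℝ m e = 0 := fun e he =>
    Submodule.mem_orthogonal_singleton_iff_inner_right.1 (hEL ▸ Submodule.mem_sup_left he)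
  have hY := finite_rays hd hp
  -- The transversal intersection points of `p + L` other than `p`. Each moves to one point `f ξ q`
  -- with the same contribution, which gives `c₀`; near `p` the intersection points are the `g ξ u`
  -- on the half-flats on the side of `ξ`.
  let R : Set (Vec n) := {q | q ∈ support F ∧ q - p ∈ L ∧ q ≠ p ∧ IsCompl (flat (walls F) q) L}
  have hRd : ∀ q ∈ R, d ≤ finrank ℝ (flat (walls F) q) := fun q hq => hgen q hq.1 hq.2.1 hq.2.2.1
  have hR : R.Finite := by
    have hsub : R ⊆ ⋃ D ∈ F, {q | q ∈ R ∧ q ∈ poly D} := by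
      intro q hq
      obtain ⟨D, hD, hqD⟩ := mem_support.1 hq.1
      exact mem_biUnion (x := D) hD ⟨hq, hqD⟩
    refine (F.finite_toSet.biUnion fun D hD => Set.Subsingleton.finite ?_).subset hsub
    rintro q ⟨hq, hqD⟩ q' ⟨hq', hq'D⟩
    have hcompl : IsCompl (dir D) L := by
      rw [dir_eq_flat hd (hRd q hq) hD hqD]
      exact hq.2.2.2
    have h1 : q - q' ∈ L := by
      have := L.sub_mem hq.2.1 hq'.2.1
      rwa [sub_sub_sub_cancel_right] at this
    exact sub_eq_zero.1 (Submodule.disjoint_def.1 hcompl.disjoint _ (sub_mem_dir hq'D hqD) h1)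
  choose! b hb using hne
  -- For a complementary cell, this is the point of its affine span on `p + L`; replacing `p` by `p
  -- + ξ` moves it by the projection of `ξ`.
  let a : Finset (Vec n × ℝ) → Vec n := fun D => b D + proj (dir D) L (p - b D)
  let f : Vec n → Vec n → Vec n := fun ξ q => q + proj (flat (walls F) q) L ξ
  let g : Vec n → Vec n → Vec n := fun ξ u => p + proj (raySpace F p u) L ξ
  have hft : ∀ q, Tendsto (fun ξ => f ξ q) (𝓝 0) (𝓝 q) := fun q => by
    simpa using (tendsto_const_nhds (x := q)).add (tendsto_proj (flat (walls F) q) L)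
  have hgt : ∀ u, Tendsto (fun ξ => g ξ u) (𝓝 0) (𝓝 p) := fun u => by
    simpa using (tendsto_const_nhds (x := p)).add (tendsto_proj (raySpace F p u) L)
  refine ⟨∑ᶠ q ∈ R, w q * (latticeIndex L (flat (walls F) q) : ℝ), ?_⟩
  have ev1 : ∀ᶠ ξ in 𝓝 (0 : Vec n), ∀ q ∈ R, f ξ q ∈ support F ∧
      tangentSpace (support F) (f ξ q) = flat (walls F) q ∧ w (f ξ q) = w q := by
    rw [eventually_all_finite hR]
    intro q hq
    filter_upwards [(tendsto_proj (flat (walls F) q) L).eventually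
      (eventually_regular hd hw (hRd q hq) hq.1)] with ξ hξ
    exact hξ (proj_mem hq.2.2.2 ξ)
  have ev2 : ∀ᶠ ξ in 𝓝 (0 : Vec n), ∀ u ∈ rays F p, proj (raySpace F p u) L ξ ∈ raySpace F p u →
      0 < inner ℝ u (proj (raySpace F p u) L ξ) → g ξ u ∈ support F ∧
        tangentSpace (support F) (g ξ u) = raySpace F p u ∧ w (g ξ u) = ω u := by
    rw [eventually_all_finite hY]
    intro u hu
    exact (tendsto_proj (raySpace F p u) L).eventually (hω u hu)
  have ev3 : ∀ᶠ ξ in 𝓝 (0 : Vec n), ∀ D ∈ F, (a D + proj (dir D) L ξ ∈ poly D ↔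
      a D ∈ poly D ∧ proj (dir D) L ξ ∈ tcone D (a D)) := by
    rw [eventually_all_finset]
    intro D _
    exact (tendsto_proj (dir D) L).eventually (eventually_mem_poly D (a D))
  have ev4 : ∀ᶠ ξ in 𝓝 (0 : Vec n), ∀ q ∈ R, ∀ q' ∈ R, q ≠ q' → f ξ q ≠ f ξ q' := by
    rw [eventually_all_finite hR]
    intro q _
    rw [eventually_all_finite hR]
    intro q' _
    by_cases hqq : q = q'
    · exact Eventually.of_forall fun _ h => absurd hqq h
    · filter_upwards [tendsto_nhds_ne (hft q) (hft q') hqq] with ξ hξ _ using hξ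
  have ev5 : ∀ᶠ ξ in 𝓝 (0 : Vec n), ∀ q ∈ R, ∀ u ∈ rays F p, f ξ q ≠ g ξ u := by
    rw [eventually_all_finite hR]
    intro q hq
    rw [eventually_all_finite hY]
    intro u _
    exact tendsto_nhds_ne (hft q) (hgt u) hq.2.2.1
  filter_upwards [ev1, ev2, ev3, ev4, ev5] with ξ h1 h2 h3 h4 h5 hξgen hξm
  set Y : Set (Vec n) := {u | u ∈ rays F p ∧ 0 < inner ℝ m u * inner ℝ m ξ} with hYdef
  have hYfin : Y.Finite := hY.subset fun u hu => hu.1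
  -- decomposition of the projection along a ray
  have hray : ∀ u ∈ Y, IsCompl (raySpace F p u) L ∧ ∃ e ∈ flat (walls F) p, ∃ s : ℝ, 0 < s ∧
      proj (raySpace F p u) L ξ = e + s • u := by
    rintro u ⟨hu, hpos⟩
    have hmu : inner ℝ m u ≠ 0 := fun h0 => by rw [h0, zero_mul] at hpos; exact hpos.ne rfl
    have hc := isCompl_raySpace hd hp hdisj hEL hL hu hmu
    obtain ⟨e, he, s, hes⟩ := mem_raySpace_iff.1 (proj_mem hc ξ)
    refine ⟨hc, e, he, s, ?_, hes⟩
    have h6 := hmL _ (sub_proj_mem hc ξ)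
    rw [inner_sub_right, hes, inner_add_right, hmE e he, inner_smul_right, zero_add, sub_eq_zero]
      at h6
    rw [h6] at hpos
    have h7 : 0 < s * (inner ℝ m u) ^ 2 := by nlinarith
    exact pos_of_mul_pos_left h7 (sq_nonneg _)
  -- A generic `ξ` meets only complementary cells. An intersection point on `D` is close to `a D`,
  -- which then lies in `D` by `h3`; so `a D` is either `p` or a point of `R`.
  have hset : {q : Vec n | q ∈ support F ∧ q + -(p + ξ) ∈ L} = f ξ '' R ∪ g ξ '' Y := by
    apply subset_antisymm
    · rintro y ⟨hyT, hyL⟩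
      obtain ⟨D, hD, hyD⟩ := mem_support.1 hyT
      rw [← sub_eq_add_neg] at hyL
      have hDL : IsCompl (dir D) L := by
        by_contra hnc
        refine hξgen D hD hnc y hyD (Submodule.mem_sup_right ?_)
        rw [← neg_sub]
        exact L.neg_mem hyL
      have haD : a D - b D ∈ dir D := by
        simp only [a, add_sub_cancel_left]
        exact proj_mem hDL _
      have haL : a D - p ∈ L := by
        have := L.neg_mem (sub_proj_mem hDL (p - b D))
        rwa [neg_sub, sub_sub_eq_add_sub, add_comm] at this
      have hya : proj (dir D) L ξ = y - a D := by
        refine proj_eq_of_mem hDL ?_ ?_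
        · have := (dir D).sub_mem (sub_mem_dir (hb D hD) hyD) haD
          rwa [sub_sub_sub_cancel_right] at this
        · rw [show ξ - (y - a D) = (a D - p) - (y - (p + ξ)) by abel]
          exact L.sub_mem haL hyL
      have hmem := (h3 D hD).1 (by rw [hya]; simpa using hyD)
      by_cases hap : a D = p
      · right
        rw [hap] at hmem hya
        have hnE : proj (dir D) L ξ ∉ flat (walls F) p := by
          intro h
          have h6 := hmL _ (sub_proj_mem hDL ξ)
          rw [inner_sub_right, hmE _ h, sub_zero] at h6
          exact hξm h6
        obtain ⟨u, hu, huD, e, he, s, hs, hes⟩ := exists_ray hD hmem.1 hmem.2 hnE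
        have hdirD := dir_eq_raySpace hd hp hu hD hmem.1 (tcone_subset_dir hmem.1 huD)
        refine ⟨u, ⟨hu, ?_⟩, ?_⟩
        · have h6 := hmL _ (sub_proj_mem hDL ξ)
          rw [inner_sub_right, hes, inner_add_right, hmE e he, inner_smul_right, zero_add,
            sub_eq_zero] at h6
          have hmu : inner ℝ m u ≠ 0 := fun h0 => hξm (by rw [h6, h0, mul_zero])
          rw [h6]
          have : 0 < s * (inner ℝ m u * inner ℝ m u) := mul_pos hs (mul_self_pos.2 hmu)
          linarith [mul_left_comm s (inner ℝ m u : ℝ) (inner ℝ m u)]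
        · simp only [g]
          rw [← hdirD, hya]
          abel
      · left
        have haT : a D ∈ support F := mem_support.2 ⟨D, hD, hmem.1⟩
        have hfl := dir_eq_flat hd (hgen _ haT haL hap) hD hmem.1
        refine ⟨a D, ⟨haT, haL, hap, hfl ▸ hDL⟩, ?_⟩
        simp only [f]
        rw [← hfl, hya]
        abel
    · rintro y (⟨q, hq, rfl⟩ | ⟨u, hu, rfl⟩)
      · refine ⟨(h1 q hq).1, ?_⟩
        have := L.sub_mem hq.2.1 (sub_proj_mem hq.2.2.2 ξ)
        convert this using 1
        simp only [f]
        abel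
      · obtain ⟨hc, e, he, s, hs, hes⟩ := hray u hu
        refine ⟨(h2 u hu.1 (proj_mem hc ξ) (by rw [hes, inner_ray_add_smul hu.1 he]; exact hs)).1, ?_⟩
        have := L.neg_mem (sub_proj_mem hc ξ)
        convert this using 1
        simp only [g]
        abel
  have hdisjoint : Disjoint (f ξ '' R) (g ξ '' Y) := by
    rw [Set.disjoint_left]
    rintro _ ⟨q, hq, rfl⟩ ⟨u, hu, huq⟩
    exact h5 q hq u hu.1 huq.symm
  have hfinj : InjOn (f ξ) R := by
    intro q hq q' hq' h
    by_contra hqq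
    exact h4 q hq q' hq' hqq h
  have hginj : InjOn (g ξ) Y := by
    intro u hu u' hu' h
    obtain ⟨-, e, he, s, hs, hes⟩ := hray u hu
    obtain ⟨-, e', he', s', hs', hes'⟩ := hray u' hu'
    have h6 : proj (raySpace F p u) L ξ = proj (raySpace F p u') L ξ := add_left_cancel h
    rw [hes, hes'] at h6
    exact add_smul_ray_injective hu.1 hu'.1 he he' hs hs' h6
  rw [intersectionNumber, hset, finsum_mem_union hdisjoint (hR.image _) (hYfin.image _),
    finsum_mem_image hfinj, finsum_mem_image hginj]
  congr 1
  · refine finsum_mem_congr rfl fun q hq => ?_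
    rw [(h1 q hq).2.1, (h1 q hq).2.2]
  · refine finsum_mem_congr rfl fun u hu => ?_
    obtain ⟨hc, e, he, s, hs, hes⟩ := hray u hu
    have h6 := h2 u hu.1 (proj_mem hc ξ) (by rw [hes, inner_ray_add_smul hu.1 he]; exact hs)
    rw [h6.2.1, h6.2.2]

theorem exists_near_of_ae {q : Vec n → Prop} (hq : ∀ᵐ x : Vec n, q x) (p : Vec n) {m : Vec n}
    (hm : m ≠ 0) {σ : ℝ} (hσ : σ ≠ 0) {ρ : ℝ} (hρ : 0 < ρ) :
    ∃ x, q x ∧ ‖-x - p‖ < ρ ∧ 0 < σ * inner ℝ m (-x - p) := by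
  let A : Set (Vec n) := {x | ‖-x - p‖ < ρ}
  let B : Set (Vec n) := {x | 0 < σ * inner ℝ m (-x - p)}
  have hA : IsOpen A := isOpen_lt (by fun_prop) continuous_const
  have hB : IsOpen B := isOpen_lt continuous_const (by fun_prop)
  obtain ⟨s, hs, hsball⟩ := exists_pos_smul (Metric.ball_mem_nhds (0 : Vec n) hρ) (σ • m)
  have hs2 : -(-(p + s • σ • m)) - p = s • σ • m := by abel
  have hne : (A ∩ B).Nonempty := by
    refine ⟨-(p + s • σ • m), ?_, ?_⟩
    · change ‖-(-(p + s • σ • m)) - p‖ < ρ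
      rw [hs2]
      exact mem_ball_zero_iff.1 hsball
    · change 0 < σ * inner ℝ m (-(-(p + s • σ • m)) - p)
      have hmm : 0 < (inner ℝ m m : ℝ) := real_inner_self_pos.2 hm
      rw [hs2, inner_smul_right, inner_smul_right]
      have : 0 < s * (σ * σ) * (inner ℝ m m : ℝ) :=
        mul_pos (mul_pos hs (mul_self_pos.2 hσ)) hmm
      linarith [show σ * (s * (σ * (inner ℝ m m : ℝ))) = s * (σ * σ) * inner ℝ m m by ring]
  obtain ⟨x, ⟨hxA, hxB⟩, hx⟩ :=
    (Measure.dense_of_ae hq).inter_open_nonempty _ (hA.inter hB) hne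
  exact ⟨x, hx, hxA, hxB⟩

/-- Comparison of the two sides of the wall. -/
theorem finsum_rays_eq (hd : ∀ H ∈ F, finrank ℝ (dir H) = d)
    (hne : ∀ H ∈ F, (poly H).Nonempty) {w : Vec n → ℝ}
    (hw : ∀ p, IsSmoothPoint (support F) p →
      ∀ᶠ q in 𝓝[{q | IsSmoothPoint (support F) q}] p, w q = w p) {p : Vec n}
    (hp : finrank ℝ (flat (walls F) p) + 1 = d) {L : Submodule ℝ (Vec n)} {m : Vec n} (hm : m ≠ 0)
    (hdisj : Disjoint (flat (walls F) p) L) (hEL : flat (walls F) p ⊔ L = (ℝ ∙ m)ᗮ)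
    (hL : d + finrank ℝ L = n)
    (hgen : ∀ q ∈ support F, q - p ∈ L → q ≠ p → d ≤ finrank ℝ (flat (walls F) q))
    {ω : Vec n → ℝ} (hω : ∀ u ∈ rays F p, ∀ᶠ v in 𝓝 (0 : Vec n), v ∈ raySpace F p u →
      0 < inner ℝ u v → p + v ∈ support F ∧
        tangentSpace (support F) (p + v) = raySpace F p u ∧ w (p + v) = ω u)
    {c : ℝ} (hc : ∀ᵐ x : Vec n, intersectionNumber (support F) w L x = c) :
    ∑ᶠ u ∈ {u | u ∈ rays F p ∧ 0 < inner ℝ m u}, ω u * (latticeIndex L (raySpace F p u) : ℝ) =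
      ∑ᶠ u ∈ {u | u ∈ rays F p ∧ inner ℝ m u < 0}, ω u * (latticeIndex L (raySpace F p u) : ℝ) := by
  obtain ⟨c₀, hc₀⟩ := exists_intersectionNumber_eq hd hne hw hp hdisj hEL hL hgen hω
  -- The translates that meet a non-complementary cell have `x` in a proper affine subspace, which
  -- is a null set.
  have hae : ∀ᵐ x : Vec n, ∀ D ∈ F, ¬ IsCompl (dir D) L → ∀ b ∈ poly D, -x - b ∉ dir D ⊔ L := by
    rw [Filter.eventually_all_finset]
    intro D hD
    by_cases hDL : IsCompl (dir D) L
    · exact Eventually.of_forall fun _ h => absurd hDL h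
    obtain ⟨b₀, hb₀⟩ := hne D hD
    have htop : dir D ⊔ L ≠ ⊤ := by
      intro h
      apply hDL
      have h1 := Submodule.finrank_sup_add_finrank_inf_eq (dir D) L
      rw [h, finrank_top, finrank_euclideanSpace_fin, hd D hD, hL] at h1
      exact ⟨disjoint_iff.2 (Submodule.finrank_eq_zero.1 (by omega)), codisjoint_iff.2 h⟩
    have hnull : (volume : Measure (Vec n)) (AffineSubspace.mk' (-b₀) (dir D ⊔ L)) = 0 := by
      refine Measure.addHaar_affineSubspace _ _ fun h => htop ?_
      rw [← AffineSubspace.direction_mk' (-b₀) (dir D ⊔ L), h, AffineSubspace.direction_top]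
    filter_upwards [compl_mem_ae_iff.2 hnull] with x hx _ b hb hmem
    refine hx ?_
    rw [SetLike.mem_coe, AffineSubspace.mem_mk', vsub_eq_sub]
    have h1 := Submodule.add_mem _ hmem (Submodule.mem_sup_left (T := L) (sub_mem_dir hb₀ hb))
    rw [← Submodule.neg_mem_iff]
    convert h1 using 1
    abel
  -- a generic translation on a given side of the wall
  have hside : ∀ σ : ℝ, σ ≠ 0 → c = c₀ + ∑ᶠ u ∈ {u | u ∈ rays F p ∧ 0 < inner ℝ m u * σ},
      ω u * (latticeIndex L (raySpace F p u) : ℝ) := by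
    intro σ hσ
    obtain ⟨ρ, hρ, hball⟩ := Metric.eventually_nhds_iff_ball.1 hc₀
    obtain ⟨x, ⟨hxc, hxgen⟩, hx1, hx2⟩ := exists_near_of_ae (hc.and hae) p hm hσ hρ
    rw [← mem_ball_zero_iff] at hx1
    have hxp : p + (-x - p) = -x := by abel
    have h1 := hball _ hx1 (by rw [hxp]; exact hxgen) (fun h0 => by rw [h0, mul_zero] at hx2; exact hx2.ne rfl)
    rw [hxp, neg_neg, hxc] at h1
    rw [h1]
    congr 2
    ext u
    have hiff : 0 < inner ℝ m u * inner ℝ m (-x - p) ↔ 0 < inner ℝ m u * σ := by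
      rcases pos_and_pos_or_neg_and_neg_of_mul_pos hx2 with ⟨h2, h3⟩ | ⟨h2, h3⟩
      · rw [mul_pos_iff_of_pos_right h3, mul_pos_iff_of_pos_right h2]
      · have key : ∀ a b : ℝ, b < 0 → (0 < a * b ↔ a < 0) := fun a b hb =>
          ⟨fun h => by by_contra! ha; exact absurd h (mul_nonpos_of_nonneg_of_nonpos ha hb.le).not_gt,
            fun h => mul_pos_of_neg_of_neg h hb⟩
        rw [key _ _ h3, key _ _ h2]
    simp only [Set.mem_ofPred_eq, hiff]
  have hpos := hside 1 one_ne_zero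
  have hneg := hside (-1) (by norm_num)
  simp only [mul_one, mul_neg, Left.neg_pos_iff] at hpos hneg
  linarith

/-! ### Generic integral conormals and generic base points. -/

open Classical in
/-- The hyperplanes of the arrangement that pass through a point. -/
noncomputable def active (A : Finset (Vec n × ℝ)) (q : Vec n) : Finset (Vec n × ℝ) :=
  A.filter fun h => inner ℝ h.1 q = h.2

theorem mem_active {A : Finset (Vec n × ℝ)} {q : Vec n} {h : Vec n × ℝ} :
    h ∈ active A q ↔ h ∈ A ∧ inner ℝ h.1 q = h.2 := by
  classical
  exact Finset.mem_filter

theorem sub_mem_flat_of_active_eq {A : Finset (Vec n × ℝ)} {q q' : Vec n}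
    (h : active A q = active A q') : q - q' ∈ flat A q := by
  intro g hg hact
  have h1 : g ∈ active A q' := h ▸ mem_active.2 ⟨hg, hact⟩
  rw [inner_sub_right, hact, (mem_active.1 h1).2, sub_self]

/-- A set is finite if its elements are determined by the hyperplanes through related points. -/
theorem finite_of_active {α : Type*} {R : Set α} (A : Finset (Vec n × ℝ)) (rel : α → Vec n → Prop)
    (h : ∀ r ∈ R, ∃ q, rel r q)
    (hinj : ∀ r ∈ R, ∀ r' ∈ R, ∀ q q', rel r q → rel r' q' → active A q = active A q' → r = r') :
    R.Finite := by
  classical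
  choose! g hg using h
  refine Set.Finite.of_finite_image (f := fun r => active A (g r))
    (A.powerset.finite_toSet.subset ?_) fun r hr r' hr' hrr' =>
      hinj r hr r' hr' _ _ (hg r hr) (hg r' hr') hrr'
  rintro _ ⟨r, -, rfl⟩
  exact Finset.mem_coe.2 (Finset.mem_powerset.2 fun x hx => (mem_active.1 hx).1)

/-- The conormal space is spanned by the normals of the active hyperplanes, which are integral. -/
theorem isRationalSubspace_flat_orthogonal {A : Finset (Vec n × ℝ)}
    (hA : ∀ h ∈ A, h.1 ∈ lattice n) (p : Vec n) : IsRationalSubspace (flat A p)ᗮ := by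
  have h1 : flat A p = (Submodule.span ℝ {a | ∃ h ∈ active A p, a = h.1})ᗮ := by
    ext v
    rw [Submodule.mem_orthogonal]
    constructor
    · intro hv
      have hle : Submodule.span ℝ {a | ∃ h ∈ active A p, a = h.1} ≤ (ℝ ∙ v)ᗮ := by
        rw [Submodule.span_le]
        rintro _ ⟨h, hh, rfl⟩
        rw [SetLike.mem_coe, Submodule.mem_orthogonal_singleton_iff_inner_left]
        exact hv h (mem_active.1 hh).1 (mem_active.1 hh).2
      exact fun a ha => Submodule.mem_orthogonal_singleton_iff_inner_left.1 (hle ha)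
    · intro hv h hh hact
      exact hv _ (Submodule.subset_span ⟨h, mem_active.2 ⟨hh, hact⟩, rfl⟩)
  rw [h1, Submodule.orthogonal_orthogonal]
  refine isRationalSubspace_of_span ?_
  rintro _ ⟨h, hh, rfl⟩
  exact hA h (mem_active.1 hh).1

theorem IsRationalSubspace.exists_notMem {W W' : Submodule ℝ (Vec n)} (hW : IsRationalSubspace W)
    (h : ¬ W ≤ W') : ∃ v ∈ lattice n ⊓ W.toAddSubgroup, v ∉ W' := by
  by_contra! hcon
  apply h
  rw [← hW, Submodule.span_le]
  exact fun v hv => hcon v ⟨hv.1, hv.2⟩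

/-- A generic integral conormal vector of the flat through `p`. -/
theorem exists_generic_conormal (hint : ∀ h ∈ walls F, h.1 ∈ lattice n) (p : Vec n) {b : Vec n}
    (hb : b ∈ (flat (walls F) p)ᗮ) (hb0 : b ≠ 0) :
    ∃ m ∈ lattice n, m ∈ (flat (walls F) p)ᗮ ∧ inner ℝ b m ≠ 0 ∧
      (∀ q, m ∈ (flat (walls F) q)ᗮ → flat (walls F) q ≤ flat (walls F) p) ∧
      ∀ q, flat (walls F) q = flat (walls F) p → inner ℝ m (q - p) = 0 →
        q - p ∈ flat (walls F) p := by
  set E := flat (walls F) p with hE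
  have hEr : IsRationalSubspace Eᗮ := isRationalSubspace_flat_orthogonal hint p
  -- Offsets of the other flats parallel to `E`. A vector `m` that is orthogonal to none of them
  -- puts these flats at levels other than that of `p`.
  let Z : Set (Vec n) := {z | z ≠ 0 ∧ z ∈ Eᗮ ∧ ∃ q, flat (walls F) q = E ∧ q - p - z ∈ E}
  have hZ : Z.Finite := by
    refine finite_of_active (walls F) (fun z q => flat (walls F) q = E ∧ q - p - z ∈ E)
      (fun z hz => hz.2.2) ?_
    rintro z hz z' hz' q q' ⟨hq, hqz⟩ ⟨-, hqz'⟩ hact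
    have h1 : z - z' ∈ E := by
      rw [show z - z' = (q - q') - ((q - p - z) - (q' - p - z')) by abel]
      exact E.sub_mem (hq ▸ sub_mem_flat_of_active_eq hact) (E.sub_mem hqz hqz')
    exact sub_eq_zero.1 (Submodule.disjoint_def.1 (Submodule.orthogonal_disjoint E) _ h1
      (Submodule.sub_mem _ hz.2.1 hz'.2.1))
  let B : Set (Submodule ℝ (Vec n)) := (fun z => (ℝ ∙ z)ᗮ) '' (insert b Z) ∪
    (fun A => Aᗮ) '' {A ∈ range (flat (walls F)) | ¬ A ≤ E}
  have hB : B.Finite := ((hZ.insert b).image _).union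
    (((finite_range_flat (walls F)).subset (sep_subset _ _)).image _)
  have hsing : ∀ z ∈ Eᗮ, z ≠ 0 → ¬ Eᗮ ≤ (ℝ ∙ z)ᗮ := by
    intro z hz hz0 hle
    exact hz0 (inner_self_eq_zero.1 (Submodule.mem_orthogonal_singleton_iff_inner_right.1 (hle hz)))
  obtain ⟨m, hm, hmB⟩ := exists_mem_notMem_submodules (Γ := lattice n ⊓ (Eᗮ).toAddSubgroup) hB (by
    rintro _ (⟨z, hz, rfl⟩ | ⟨A, ⟨-, hA⟩, rfl⟩)
    · refine hEr.exists_notMem ?_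
      rcases hz with rfl | hz
      · exact hsing _ hb hb0
      · exact hsing z hz.2.1 hz.1
    · refine hEr.exists_notMem fun hle => hA ?_
      have := Submodule.orthogonal_le hle
      rwa [Submodule.orthogonal_orthogonal, Submodule.orthogonal_orthogonal] at this)
  refine ⟨m, hm.1, hm.2, fun h0 => ?_, fun q hq => ?_, fun q hq h0 => ?_⟩
  · exact hmB _ (.inl ⟨b, mem_insert _ _, rfl⟩)
      (Submodule.mem_orthogonal_singleton_iff_inner_right.2 h0)
  · by_contra hle
    exact hmB _ (.inr ⟨_, ⟨⟨q, rfl⟩, hle⟩, rfl⟩) hq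
  · obtain ⟨e, he, z, hz, hez⟩ := E.exists_add_mem_mem_orthogonal (q - p)
    have hz0 : z = 0 := by
      by_contra hz0
      refine hmB _ (.inl ⟨z, mem_insert_of_mem _ ⟨hz0, hz, q, hq, ?_⟩, rfl⟩) ?_
      · rw [hez, add_sub_cancel_right]
        exact he
      · rw [hez, inner_add_right, Submodule.inner_left_of_mem_orthogonal he hm.2, zero_add] at h0
        exact Submodule.mem_orthogonal_singleton_iff_inner_left.2 h0
    rw [hez, hz0, add_zero]
    exact he

/-- This allows the base point to be moved along its flat without changing the rays. -/
theorem eventually_rays_add_eq (F : Finset (Finset (Vec n × ℝ))) (p : Vec n) :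
    ∀ᶠ v in 𝓝 (0 : Vec n), v ∈ flat (walls F) p →
      flat (walls F) (p + v) = flat (walls F) p ∧ rays F (p + v) = rays F p := by
  filter_upwards [eventually_flat_add_eq (walls F) p, eventually_mem_poly_imp F p,
    eventually_mem_flat_iff (walls F) p] with v h1 h2 h3 hv
  refine ⟨h1 hv, ?_⟩
  ext u
  have hex : (∃ H ∈ F, p + v ∈ poly H ∧ u ∈ tcone H (p + v)) ↔
      ∃ H ∈ F, p ∈ poly H ∧ u ∈ tcone H p := by
    refine exists_congr fun H => and_congr_right fun hH => and_congr ?_ ?_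
    · rw [h2 H hH]
      exact and_iff_left (flat_subset_tcone (subset_walls hH) hv)
    · refine forall₂_congr fun h hh => ?_
      rw [h3 h (subset_walls hH hh)]
      exact ⟨fun h4 h5 => h4 ⟨h5, hv h (subset_walls hH hh) h5⟩, fun h4 h5 => h4 h5.1⟩
  simp only [rays, Set.mem_ofPred_eq, h1 hv, hex]

/-- A complement `L` of the flat through `p` in a generic integral hyperplane: some point close to
`p` in the flat is the only point of its translate of `L` that lies on a small flat. -/
theorem exists_generic_base {p : Vec n} (hp : finrank ℝ (flat (walls F) p) + 1 = d)
    {m : Vec n}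
    (hm1 : ∀ q, m ∈ (flat (walls F) q)ᗮ → flat (walls F) q ≤ flat (walls F) p)
    (hm2 : ∀ q, flat (walls F) q = flat (walls F) p → inner ℝ m (q - p) = 0 →
        q - p ∈ flat (walls F) p)
    {L : Submodule ℝ (Vec n)} (hdisj : Disjoint (flat (walls F) p) L)
    (hEL : flat (walls F) p ⊔ L = (ℝ ∙ m)ᗮ) {r : Vec n → Prop}
    (hr : ∀ᶠ v in 𝓝 (0 : Vec n), r v) :
    ∃ e ∈ flat (walls F) p, r e ∧
      ∀ q, q - (p + e) ∈ L → q ≠ p + e → d ≤ finrank ℝ (flat (walls F) q) := by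
  set E := flat (walls F) p with hE
  have hmM : ∀ x ∈ E ⊔ L, inner ℝ m x = 0 := fun x hx =>
    Submodule.mem_orthogonal_singleton_iff_inner_right.1 (hEL ▸ hx)
  obtain ⟨e₀, he₀, he₀B⟩ := exists_mem_notMem_submodules (Γ := E.toAddSubgroup)
    (B := {W ∈ (fun A => A ⊔ L) '' range (flat (walls F)) | ¬ E ≤ W})
    (((finite_range_flat (walls F)).image _).subset (sep_subset _ _)) (by
      rintro W ⟨-, hW⟩
      exact SetLike.not_le_iff_exists.1 hW)
  -- Two parameters with the same active hyperplanes would put a nonzero multiple of `e₀` into `flat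
  -- (walls F) q ⊔ L`, which `e₀` avoids.
  have hbad : {t : ℝ | ∃ q, q - (p + t • e₀) ∈ L ∧ ¬ E ≤ flat (walls F) q ⊔ L}.Finite := by
    refine finite_of_active (walls F)
      (fun t q => q - (p + t • e₀) ∈ L ∧ ¬ E ≤ flat (walls F) q ⊔ L) (fun t ht => ht) ?_
    rintro t - t' - q q' ⟨hq, hqE⟩ ⟨hq', -⟩ hact
    by_contra htt
    refine he₀B _ ⟨⟨_, ⟨q, rfl⟩, rfl⟩, hqE⟩ ?_
    have h1 : (t - t') • e₀ ∈ flat (walls F) q ⊔ L := by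
      rw [show (t - t') • e₀ = (q - q') + ((q' - (p + t' • e₀)) - (q - (p + t • e₀))) by
        rw [sub_smul]; abel]
      exact Submodule.add_mem_sup (sub_mem_flat_of_active_eq hact) (L.sub_mem hq' hq)
    exact (Submodule.smul_mem_iff _ (sub_ne_zero.2 htt)).1 h1
  obtain ⟨δ, hδ, hball⟩ := Metric.eventually_nhds_iff_ball.1
    ((tendsto_smul_zero e₀).eventually hr)
  obtain ⟨t, ht, htbad⟩ := (Ioo_infinite hδ).exists_notMem_finite hbad
  refine ⟨t • e₀, E.smul_mem t he₀, hball t ?_, fun q hqL hqp => ?_⟩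
  · rw [mem_ball_zero_iff, Real.norm_eq_abs, abs_of_pos ht.1]
    exact ht.2
  -- A remaining small flat satisfies `E ≤ flat (walls F) q ⊔ L`. By dimension its sum with `L` is
  -- the hyperplane `E ⊔ L`, so `hm1` makes it equal to `E`. Then `hm2` places `q` on the flat
  -- through `p`, which meets the translate of `L` only at the base point.
  by_contra! hlt
  have hEle : E ≤ flat (walls F) q ⊔ L := by
    by_contra hnle
    exact htbad ⟨q, hqL, hnle⟩
  have hEd := Submodule.finrank_sup_add_finrank_inf_eq E L
  rw [hdisj.eq_bot, finrank_bot] at hEd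
  have hAL := Submodule.finrank_add_le_finrank_add_finrank (flat (walls F) q) L
  have hle : E ⊔ L ≤ flat (walls F) q ⊔ L := sup_le hEle le_sup_right
  have heq := Submodule.eq_of_le_of_finrank_le hle (by omega)
  have hAE : flat (walls F) q ≤ E := by
    refine hm1 q fun a ha => ?_
    rw [real_inner_comm]
    exact hmM a (heq ▸ Submodule.mem_sup_left ha)
  have hAeq : flat (walls F) q = E := by
    refine Submodule.eq_of_le_of_finrank_le hAE ?_
    rw [← heq] at hAL
    omega
  have h1 : inner ℝ m (q - p) = 0 := by
    rw [show q - p = (q - (p + t • e₀)) + t • e₀ by abel, inner_add_right,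
      hmM _ (Submodule.mem_sup_right hqL),
      hmM _ (Submodule.mem_sup_left (E.smul_mem t he₀)), add_zero]
  have h2 : q - (p + t • e₀) ∈ E := by
    rw [show q - (p + t • e₀) = (q - p) - t • e₀ by abel]
    exact E.sub_mem (hm2 q hAeq h1) (E.smul_mem t he₀)
  exact hqp (sub_eq_zero.1 (Submodule.disjoint_def.1 hdisj _ h2 hqL))

/-! ### Balancing and the maximum principle. -/

/-- The balancing condition at a point that lies on a flat of codimension one. -/
theorem exists_balancing (hint : ∀ h ∈ walls F, h.1 ∈ lattice n)
    (hd : ∀ H ∈ F, finrank ℝ (dir H) = d) (hne : ∀ H ∈ F, (poly H).Nonempty) {w : Vec n → ℝ}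
    (hw0 : ∀ p, IsSmoothPoint (support F) p → 0 < w p)
    (hw : ∀ p, IsSmoothPoint (support F) p →
      ∀ᶠ q in 𝓝[{q | IsSmoothPoint (support F) q}] p, w q = w p)
    (hconst : ∀ L : Submodule ℝ (Vec n), IsRationalSubspace L → finrank ℝ L + d = n →
      ∃ c : ℝ, ∀ᵐ x : Vec n, intersectionNumber (support F) w L x = c)
    {p : Vec n} (hp : finrank ℝ (flat (walls F) p) + 1 = d) :
    ∃ κ : Vec n → ℝ, (∀ u ∈ rays F p, 0 < κ u) ∧
      ∑ u ∈ (finite_rays hd hp).toFinset, κ u • u = 0 := by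
  classical
  set E := flat (walls F) p with hE
  obtain ⟨ω, hω0, ρ, hρ, hω⟩ := exists_ray_weights hd hp hw0 hw
  have hr : ∀ u ∈ rays F p, ∃ r ∈ lattice n, r ∈ raySpace F p u ∧ r ∉ E ∧
      ∀ v ∈ lattice n, v ∈ raySpace F p u → ∃ k : ℤ, v - k • r ∈ E := by
    intro u hu
    obtain ⟨s, hs, hflat⟩ := exists_pos_smul (eventually_flat_eq_raySpace hd hp) u
    have hrat : IsRationalSubspace (raySpace F p u) := by
      rw [← (hflat u hu (Submodule.smul_mem _ _ self_mem_raySpace) (by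
        rw [inner_smul_right, real_inner_self_eq_norm_sq, hu.1]; positivity)).2]
      exact isRationalSubspace_flat hint _
    obtain ⟨h, hh, hact, hhu⟩ : ∃ h ∈ walls F, inner ℝ h.1 p = h.2 ∧ inner ℝ h.1 u ≠ 0 := by
      by_contra! hcon
      exact ray_notMem hu hcon
    exact exists_lattice_generator hrat flat_le_raySpace
      (by rw [finrank_raySpace hd hp hu, hp]) (hint h hh) (fun v hv => hv h hh hact)
      ⟨u, self_mem_raySpace, hhu⟩
  choose! r hrΓ hrV hrE hrgen using hr
  have hrdec : ∀ u ∈ rays F p, ∃ e ∈ E, r u = e + (inner ℝ u (r u) : ℝ) • u := by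
    intro u hu
    obtain ⟨e, he, s, hes⟩ := mem_raySpace_iff.1 (hrV u hu)
    have hs : inner ℝ u (r u) = s := by rw [hes, inner_ray_add_smul hu he]
    exact ⟨e, he, by rw [hs]; exact hes⟩
  have hs0 : ∀ u ∈ rays F p, inner ℝ u (r u) ≠ 0 := by
    intro u hu h0
    obtain ⟨e, he, hre⟩ := hrdec u hu
    rw [h0, zero_smul, add_zero] at hre
    exact hrE u hu (hre ▸ he)
  set Y := (finite_rays hd hp).toFinset with hY
  have hmemY : ∀ u, u ∈ Y ↔ u ∈ rays F p := fun u => (finite_rays hd hp).mem_toFinset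
  -- Up to sign, `κ u • u` is the weight times the part of the primitive vector `r u` orthogonal to
  -- `E`. It depends neither on `m` nor on `L`.
  let κ : Vec n → ℝ := fun u => ω u * |inner ℝ u (r u)|
  refine ⟨κ, fun u hu => mul_pos (hω0 u hu) (abs_pos.2 (hs0 u hu)), ?_⟩
  -- A nonzero sum would pair nontrivially with some generic integral conormal `m`. A rational
  -- complement `L` of `E` in the hyperplane orthogonal to `m` then gives equal weighted heights on
  -- both sides, so the pairing is zero.
  by_contra hb0
  have hbE : ∑ u ∈ Y, κ u • u ∈ Eᗮ := Submodule.sum_mem _ fun u hu =>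
    Submodule.smul_mem _ _ ((hmemY u).1 hu).2.1
  obtain ⟨m, hmΓ, hmE, hbm, hm1, hm2⟩ := exists_generic_conormal hint p hbE hb0
  have hm0 : m ≠ 0 := fun h => hbm (by rw [h, inner_zero_right])
  have hinner : ∀ e ∈ E, inner ℝ m e = 0 := fun e he =>
    Submodule.inner_left_of_mem_orthogonal he hmE
  have hMr : IsRationalSubspace ((ℝ ∙ m)ᗮ : Submodule ℝ (Vec n)) := by
    have := (isRationalSubspace_top (n := n)).inf_orthogonal hmΓ
    rwa [top_inf_eq] at this
  obtain ⟨L, hLr, hdisj, hEL⟩ := hMr.exists_compl (E := E) fun e he =>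
    Submodule.mem_orthogonal_singleton_iff_inner_right.2 (hinner e he)
  have hLd : d + finrank ℝ L = n := by
    have h1 := Submodule.finrank_sup_add_finrank_inf_eq E L
    have h2 := finrank_orthogonal_singleton_add_one hm0
    rw [hdisj.eq_bot, finrank_bot, hEL] at h1
    omega
  obtain ⟨c, hc0, hindex⟩ := exists_latticeIndex_eq (isRationalSubspace_flat hint p) hLr hmΓ hEL
  obtain ⟨c', hc'⟩ := hconst L hLr (by omega)
  have hsmall : ∀ᶠ v in 𝓝 (0 : Vec n), ‖v‖ < ρ / 2 := by
    filter_upwards [Metric.ball_mem_nhds (0 : Vec n) (half_pos hρ)] with v hv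
      using mem_ball_zero_iff.1 hv
  obtain ⟨e, he, ⟨hev, hen⟩, hgen⟩ := exists_generic_base hp hm1 hm2 hdisj hEL
    ((eventually_rays_add_eq F p).and hsmall)
  obtain ⟨hfl, hrays⟩ := hev he
  have hspace : ∀ u, raySpace F (p + e) u = raySpace F p u := fun u => by
    rw [raySpace, raySpace, hfl]
  have hωe : ∀ u ∈ rays F (p + e), ∀ᶠ v in 𝓝 (0 : Vec n), v ∈ raySpace F (p + e) u →
      0 < inner ℝ u v → p + e + v ∈ support F ∧
        tangentSpace (support F) (p + e + v) = raySpace F (p + e) u ∧ w (p + e + v) = ω u := by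
    intro u hu
    rw [hrays] at hu
    filter_upwards [hsmall] with v hv hvu hpos
    rw [hspace] at hvu ⊢
    rw [add_assoc]
    refine hω (e + v) ?_ u hu (Submodule.add_mem _ (flat_le_raySpace he) hvu) ?_
    · calc ‖e + v‖ ≤ ‖e‖ + ‖v‖ := norm_add_le _ _
        _ < ρ / 2 + ρ / 2 := add_lt_add hen hv
        _ = ρ := by ring
    · rwa [inner_add_right, Submodule.inner_left_of_mem_orthogonal he hu.2.1, zero_add]
  have hmain := finsum_rays_eq hd hne hw (p := p + e) (L := L) (by rw [hfl]; exact hp) hm0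
    (by rw [hfl]; exact hdisj) (by rw [hfl]; exact hEL) hLd
    (fun q _ hqL hqp => hgen q hqL hqp) hωe hc'
  have hterm : ∀ u ∈ rays F p, inner ℝ m u ≠ 0 →
      ω u * (latticeIndex L (raySpace F p u) : ℝ) = c * (κ u * |inner ℝ m u|) := by
    intro u hu hmu
    obtain ⟨e', he', hre⟩ := hrdec u hu
    have h1 : inner ℝ m (r u) = inner ℝ u (r u) * inner ℝ m u := by
      conv_lhs => rw [hre]
      rw [inner_add_right, hinner e' he', zero_add, inner_smul_right]
    rw [hindex _ (r u) flat_le_raySpace (hrΓ u hu) (hrV u hu) (hrgen u hu)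
      (by rw [h1]; exact mul_ne_zero (hs0 u hu) hmu), h1, abs_mul]
    ring
  have hsum : ∀ q : ℝ → Prop, (¬ q 0) →
      ∑ᶠ u ∈ {u | u ∈ rays F (p + e) ∧ q (inner ℝ m u)},
        ω u * (latticeIndex L (raySpace F (p + e) u) : ℝ) =
      c * ∑ u ∈ Y, if q (inner ℝ m u) then κ u * |inner ℝ m u| else 0 := by
    intro q hq
    have hset : {u | u ∈ rays F (p + e) ∧ q (inner ℝ m u)} =
        (Y.filter fun u => q (inner ℝ m u) : Finset (Vec n)) := by
      ext u
      simp [hmemY, hrays]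
    rw [hset, finsum_mem_coe_finset, Finset.mul_sum, Finset.sum_filter]
    refine Finset.sum_congr rfl fun u hu => ?_
    by_cases hqu : q (inner ℝ m u)
    · rw [if_pos hqu, if_pos hqu, hspace]
      exact hterm u ((hmemY u).1 hu) fun h0 => hq (h0 ▸ hqu)
    · rw [if_neg hqu, if_neg hqu, mul_zero]
  rw [hsum (fun x => 0 < x) (lt_irrefl 0), hsum (fun x => x < 0) (lt_irrefl 0)] at hmain
  have hmain' := mul_left_cancel₀ hc0.ne' hmain
  apply hbm
  rw [sum_inner, ← sub_eq_zero.2 hmain', ← Finset.sum_sub_distrib]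
  refine Finset.sum_congr rfl fun u _ => ?_
  rw [real_inner_smul_left, real_inner_comm]
  rcases lt_trichotomy (inner ℝ m u) 0 with h | h | h
  · rw [if_neg h.not_gt, if_pos h, abs_of_neg h]
    ring
  · simp [h]
  · rw [if_pos h, if_neg h.not_gt, abs_of_pos h]
    ring

/-- Pairing the balancing relation with `m` gives a vanishing sum of nonpositive terms with positive
coefficients. So `m` vanishes on every ray, and the cones are generated by the flat and the rays. -/
theorem maxPrinciple_of_tropical (hint : ∀ H ∈ F, ∀ h ∈ H, h.1 ∈ lattice n)
    (hd : ∀ H ∈ F, finrank ℝ (dir H) = d) (hne : ∀ H ∈ F, (poly H).Nonempty)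
    (hT : IsTropicalComplex d (support F)) : MaxPrinciple F d := by
  classical
  obtain ⟨-, w, hw0, hw, hconst⟩ := hT
  have hint' : ∀ h ∈ walls F, h.1 ∈ lattice n := by
    intro h hh
    obtain ⟨H, hH, hhH⟩ := Finset.mem_biUnion.1 hh
    exact hint H hH h hhH
  intro p hp m hmE hmle H hH hpH v hv
  obtain ⟨κ, hκ, hsum⟩ := exists_balancing hint' hd hne hw0 hw hconst hp
  have hray : ∀ u ∈ rays F p, inner ℝ m u = 0 := by
    have h1 : ∑ u ∈ (finite_rays hd hp).toFinset, κ u * inner ℝ m u = 0 := by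
      rw [← inner_zero_right (𝕜 := ℝ) m, ← hsum, inner_sum]
      exact Finset.sum_congr rfl fun u _ => (inner_smul_right _ _ _).symm
    have h2 := (Finset.sum_eq_zero_iff_of_nonpos fun u hu => ?_).1 h1
    · intro u hu
      have := h2 u ((finite_rays hd hp).mem_toFinset.2 hu)
      exact (mul_eq_zero.1 this).resolve_left (hκ u hu).ne'
    · have hu := (finite_rays hd hp).mem_toFinset.1 hu
      obtain ⟨H', hH', hpH', huH'⟩ := id hu.2.2
      exact mul_nonpos_of_nonneg_of_nonpos (hκ u hu).le (hmle H' hH' hpH' u huH')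
  by_cases hvE : v ∈ flat (walls F) p
  · exact hmE v hvE
  · obtain ⟨u, hu, -, e, he, s, -, rfl⟩ := exists_ray hH hpH hv hvE
    rw [inner_add_right, hmE e he, inner_smul_right, hray u hu, mul_zero, add_zero]

/-! ### Passage from complexes to finite families of cells, and conclusion. -/

theorem IsPolyhedralComplex.exists_cells {T : Set (Vec n)} (hT : IsPolyhedralComplex d T) :
    ∃ F : Finset (Finset (Vec n × ℝ)), (∀ H ∈ F, ∀ h ∈ H, h.1 ∈ lattice n) ∧
      (∀ H ∈ F, finrank ℝ (dir H) = d) ∧ (∀ H ∈ F, (poly H).Nonempty) ∧ T = support F := by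
  classical
  obtain ⟨F, hF, hC, rfl⟩ := hT
  choose! g hg using fun C hCF => (hC C hCF).1
  have hpoly : ∀ C ∈ F, poly (g C) = C := fun C hCF => (hg C hCF).2.symm
  have hmem : ∀ H ∈ hF.toFinset.image g, ∃ C ∈ F, g C = H := by
    intro H hH
    obtain ⟨C, hCF, rfl⟩ := Finset.mem_image.1 hH
    exact ⟨C, hF.mem_toFinset.1 hCF, rfl⟩
  refine ⟨hF.toFinset.image g, ?_, ?_, ?_, ?_⟩
  · intro H hH
    obtain ⟨C, hCF, rfl⟩ := hmem H hH
    exact (hg C hCF).1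
  · intro H hH
    obtain ⟨C, hCF, rfl⟩ := hmem H hH
    rw [dir, hpoly C hCF]
    exact (hC C hCF).2.2
  · intro H hH
    obtain ⟨C, hCF, rfl⟩ := hmem H hH
    rw [hpoly C hCF]
    exact (hC C hCF).2.1
  · ext x
    rw [mem_support]
    constructor
    · rintro ⟨C, hCF, hx⟩
      exact ⟨g C, Finset.mem_image_of_mem g (hF.mem_toFinset.2 hCF), by rwa [hpoly C hCF]⟩
    · rintro ⟨H, hH, hx⟩
      obtain ⟨C, hCF, rfl⟩ := hmem H hH
      exact ⟨C, hCF, by rwa [hpoly C hCF] at hx⟩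

end TropPurity

theorem mainTheorem8 (n : ℕ) (P T : Set (TropPurity.Vec n)) (d : ℕ) (k : ℤ)
    (hP : TropPurity.IsRelOpenPolyhedron P)
    (hT : TropPurity.IsTropicalComplex d T)
    (hdim : (TropPurity.convexDim P : ℤ) + (d : ℤ) = (n : ℤ) + k) :
    TropPurity.IsEmptyOrPureDim k (TropPurity.stableIntersection T P) ∧
    TropPurity.IsEmptyOrPureDim (k - 1)
      (closure (TropPurity.stableIntersection T P) ∩ intrinsicFrontier ℝ P) ∧
    (closure (TropPurity.stableIntersection T P) ∩ intrinsicFrontier ℝ P = ∅ ↔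
      ∀ x ∈ TropPurity.stableIntersection T P, ∃ M : AffineSubspace ℝ (TropPurity.Vec n),
        connectedComponentIn (TropPurity.stableIntersection T P) x ⊆ (M : Set (TropPurity.Vec n)) ∧
        (M : Set (TropPurity.Vec n)) ⊆ P) := by
  obtain ⟨F, hint, hd, hne, rfl⟩ := hT.1.exists_cells
  obtain ⟨-, V, J, Q, hPV⟩ := TropPurity.exists_relOpenPresentation hP
  have hmax := TropPurity.maxPrinciple_of_tropical hint hd hne hT
  have hk : (Module.finrank ℝ V : ℤ) + d = n + k := by
    rw [← hPV.vectorSpan_eq]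
    exact hdim
  exact ⟨TropPurity.isEmptyOrPureDim_stableIntersection hd hmax hPV hk,
    TropPurity.isEmptyOrPureDim_closure_inter_frontier hd hmax hPV hk,
    TropPurity.closure_inter_frontier_eq_empty_iff hd hmax hPV⟩
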